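/- A Hoffman graph $\mathfrak H$ is a finite simple graph whose vertices are labelled slim or fat, such that every fat vertex is adjacent to a slim vertex and fat vertices are pairwise non-adjacent. It is fat if every slim vertex has a fat neighbour. With adjacency matrix $\begin{pmatrix}A_s&C\\C^{T}&O\end{pmatrix}$ (slim vertices first), $\lambda_{\min}(\mathfrak H)$ is the smallest eigenvalue of $A_s-CC^{T}$ (set to be $0$ for the graph without vertices). Subgraphs are induced, carry the inherited labels, and must be Hoffman graphs; isomorphisms preserve labels. A decomposition of $\mathfrak H$ is a family $\mathfrak H^1,\dots,\mathfrak H^n$ of such subgraphs that cover all vertices and share no slim vertices, such that every fat neighbour in $\mathfrak H$ of a slim vertex of $\mathfrak H^i$ lies in $\mathfrak H^i$, and such that slim vertices $x\in\mathfrak H^i$, $y\in\mathfrak H^j$ with $i\ne j$ have at most one common fat neighbour, and have one if and only if $x,y$ are adjacent. For $\alpha<0$, a Hoffman graph $\mathfrak H$ with $\lambda_{\min}(\mathfrak H)\ge\alpha$ is $\alpha$-irreducible if there is no Hoffman graph $\mathfrak H'$ containing $\mathfrak H$ as an induced Hoffman subgraph with a decomposition $\mathfrak H^1,\mathfrak H^2$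 such that, for $i=1,2$, $\lambda_{\min}(\mathfrak H^i)\ge\alpha$ and $\mathfrak H^i$ contains a slim vertex of $\mathfrak H$. For a set $\mathcal H$ of isomorphism classes of Hoffman graphs, an $\mathcal H$-line graph is an induced Hoffman subgraph of a Hoffman graph that has a decomposition into subgraphs whose isomorphism classes lie in $\mathcal H$. Let $\tau=\frac{1+\sqrt5}{2}$ and let $\mathcal H$ be the set of isomorphism classes of those fat $(-1-\tau)$-irreducible Hoffman graphs that are maximal, with respect to taking induced Hoffman subgraphs, among all fat $(-1-\tau)$-irreducible Hoffman graphs. Theorem. (a) $\mathcal H$ consists of exactly $20$ isomorphism classes, represented by the following pairwise non-isomorphic Hoffman graphs. Each is given by its slim vertices $0,1,\dots$, the edges $ij$ between slim vertices, and the family of the slim neighbourhoods of its fat vertices. - Two slim vertices: edge $01$, fat $\{0\},\{1\},\{1\}$ ($\mathfrak H_{\rm XVI}$); no edge, fat $\{0,1\},\{1\}$ ($\mathfrak H_{\rm XVII}$). - Four slim vertices, slim path with edges $01,12,23$: fat $\{0,1,2,3\}$ ($\mathfrak H^1_{4,1}$); fat $\{0,3\},\{1,2\}$ ($\mathfrak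 H^2_{4,3}$). - Five slim vertices: edges $01,12,34$, fat $\{0,3\},\{1\},\{2,4\}$; edges $01,12,23,30$, fat $\{0,1,4\},\{2\},\{3\}$ (these two are $\mathfrak H^1_{5,2}$ and $\mathfrak H^1_{5,3}$); edges $01,02,12,13,23,34$, fat $\{0,4\},\{1\},\{2\},\{3\}$ ($\mathfrak H^1_{5,6}$). - Six slim vertices: for each graph $S$ on $\{0,\dots,5\}$ and each partition $P$ below, the Hoffman graph whose slim edges are the edges of $S$ together with all pairs inside a part of $P$, with one fat vertex for each part of $P$ adjacent to exactly the vertices of this part (only the parts with at least two elements are listed; all other parts are singletons). - $S$ the wheel with hub $0$ and rim $1,2,3,4,5$ (three graphs): $P=\emptyset$; $13$; $13,24$. - $S$ the 3-sun, that is the triangle $0,1,2$ with $3$ joined to $1,2$, with $4$ joined to $0,2$, and with $5$ joined to $0,1$ (seven graphs): $P=\emptyset$; $03$; $03,14$; $03,14,25$; $34$; $34,25$; $345$. - $S$ the union of a complete graph on $0,1,2$ and a complete graph on $0,3,4,5$ (three graphs): $P=\emptyset$; $13$; $13,24$. (b) Every fat Hoffman graph with smallest eigenvalue at least $-1-\tau$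 is an $\mathcal H$-line graph. -/

import Mathlib

universe u v w

/-- A Hoffman graph on the vertex set `V`: a simple graph whose vertices are labelled fat
(the members of `fat`) or slim (the other vertices), such that every fat vertex has a slim
neighbour and the fat vertices are pairwise non-adjacent. -/
structure HoffmanGraph (V : Type u) where
  graph : SimpleGraph V
  fat : Set V
  fat_adj_slim : ∀ f ∈ fat, ∃ x, x ∉ fat ∧ graph.Adj f x
  fat_not_adj : ∀ f ∈ fat, ∀ g ∈ fat, ¬ graph.Adj f g

namespace HoffmanGraph

variable {V : Type u} {W : Type v} {X : Type w}

/-- The set of slim vertices. -/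
def slim (H : HoffmanGraph V) : Set V := {x | x ∉ H.fat}

/-- The set of fat neighbours of a vertex. -/
def fatNbrs (H : HoffmanGraph V) (x : V) : Set V := {f | f ∈ H.fat ∧ H.graph.Adj x f}

/-- A Hoffman graph is fat if every slim vertex has a fat neighbour. -/
def IsFat (H : HoffmanGraph V) : Prop := ∀ x ∈ H.slim, (H.fatNbrs x).Nonempty

/-- Label-preserving graph isomorphisms. -/
structure Iso (H : HoffmanGraph V) (K : HoffmanGraph W) where
  toIso : H.graph ≃g K.graph
  map_fat : ∀ x, toIso x ∈ K.fat ↔ x ∈ H.fat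

/-- Label-preserving embeddings of `H` onto an induced Hoffman subgraph of `K`. -/
structure Embedding (H : HoffmanGraph V) (K : HoffmanGraph W) where
  toEmbedding : H.graph ↪g K.graph
  map_fat : ∀ x, toEmbedding x ∈ K.fat ↔ x ∈ H.fat

/-- `H` is (up to isomorphism) an induced Hoffman subgraph of `K`. -/
def IsInducedIn (H : HoffmanGraph V) (K : HoffmanGraph W) : Prop := Nonempty (Embedding H K)

/-- The Hoffman subgraph induced by a set of vertices `s`. The condition `hs` says that the
induced labelled graph is again a Hoffman graph. -/
def induce (H : HoffmanGraph V) (s : Set V)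
    (hs : ∀ f ∈ s, f ∈ H.fat → ∃ x ∈ s, x ∉ H.fat ∧ H.graph.Adj f x) : HoffmanGraph s where
  graph := H.graph.induce s
  fat := {x | (x : V) ∈ H.fat}
  fat_adj_slim := by
    rintro ⟨f, hf⟩ hfat
    obtain ⟨x, hx, hxs, hadj⟩ := hs f hf hfat
    exact ⟨⟨x, hx⟩, hxs, hadj⟩
  fat_not_adj := fun f hf g hg h => H.fat_not_adj f hf g hg h

open Classical in
/-- The block `A_s` of the adjacency matrix, indexed by the slim vertices. -/
noncomputable def slimAdj (H : HoffmanGraph V) : Matrix H.slim H.slim ℝ :=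
  (H.graph.adjMatrix ℝ).submatrix Subtype.val Subtype.val

open Classical in
/-- The block `C` of the adjacency matrix, indexed by slim and fat vertices. -/
noncomputable def slimFatAdj (H : HoffmanGraph V) : Matrix H.slim H.fat ℝ :=
  (H.graph.adjMatrix ℝ).submatrix Subtype.val Subtype.val

open Classical in
/-- The matrix `B(H) = A_s - C Cᵀ`. -/
noncomputable def B [Fintype V] (H : HoffmanGraph V) : Matrix H.slim H.slim ℝ :=
  H.slimAdj - H.slimFatAdj * H.slimFatAdj.transpose

open Classical in
/-- The smallest eigenvalue of `B(H)` (equal to `0` for the graph without vertices). -/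
noncomputable def lambdaMin [Fintype V] (H : HoffmanGraph V) : ℝ := sInf (spectrum ℝ H.B)

/-- A decomposition of `H` into `n` induced Hoffman subgraphs, given by their vertex sets. -/
structure Decomposition (H : HoffmanGraph V) (n : ℕ) where
  part : Fin n → Set V
  part_fat : ∀ i, ∀ f ∈ part i, f ∈ H.fat → ∃ x ∈ part i, x ∉ H.fat ∧ H.graph.Adj f x
  cover : ⋃ i, part i = Set.univ
  slim_disjoint : ∀ i j, i ≠ j → (part i ∩ H.slim) ∩ (part j ∩ H.slim) = ∅
  fat_mem : ∀ i, ∀ x ∈ part i ∩ H.slim, ∀ y ∈ H.fat, H.graph.Adj x y → y ∈ part i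
  common_le : ∀ i j, i ≠ j → ∀ x ∈ part i ∩ H.slim, ∀ y ∈ part j ∩ H.slim,
    (H.fatNbrs x ∩ H.fatNbrs y).encard ≤ 1
  common_iff : ∀ i j, i ≠ j → ∀ x ∈ part i ∩ H.slim, ∀ y ∈ part j ∩ H.slim,
    ((H.fatNbrs x ∩ H.fatNbrs y).encard = 1 ↔ H.graph.Adj x y)

/-- The `i`-th Hoffman subgraph of a decomposition. -/
def Decomposition.piece {H : HoffmanGraph V} {n : ℕ} (D : H.Decomposition n) (i : Fin n) :
    HoffmanGraph (D.part i) :=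
  H.induce (D.part i) (D.part_fat i)

open Classical in
/-- `α`-reducibility of a Hoffman graph (meant for graphs with smallest eigenvalue at least `α`):
`H` is an induced Hoffman subgraph of a finite Hoffman graph `K` with a decomposition into two
subgraphs, each with smallest eigenvalue at least `α` and with a slim vertex of `H`. -/
def IsReducible (α : ℝ) (H : HoffmanGraph V) : Prop :=
  ∃ (W : Type u) (_ : Fintype W) (K : HoffmanGraph W) (e : Embedding H K)
    (D : K.Decomposition 2), ∀ i, α ≤ (D.piece i).lambdaMin ∧
      ∃ x ∈ H.slim, e.toEmbedding x ∈ D.part i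

/-- `α`-irreducibility. -/
def IsIrreducible [Fintype V] (α : ℝ) (H : HoffmanGraph V) : Prop :=
  α ≤ H.lambdaMin ∧ ¬ H.IsReducible α

/-- The identity isomorphism. -/
def Iso.refl (H : HoffmanGraph V) : Iso H H := ⟨RelIso.refl _, fun _ => Iff.rfl⟩

/-- The inverse isomorphism. -/
def Iso.symm {H : HoffmanGraph V} {K : HoffmanGraph W} (e : Iso H K) : Iso K H :=
  ⟨e.toIso.symm, fun x => by simpa using (e.map_fat (e.toIso.symm x)).symm⟩

/-- The composition of two isomorphisms. -/
def Iso.trans {H : HoffmanGraph V} {K : HoffmanGraph W} {L : HoffmanGraph X}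
    (e : Iso H K) (f : Iso K L) : Iso H L :=
  ⟨e.toIso.trans f.toIso, fun x => (f.map_fat (e.toIso x)).trans (e.map_fat x)⟩

/-- The Hoffman graph with slim vertices `0, …, n - 1` and fat vertices `0, …, m - 1` in which
two distinct slim vertices are adjacent iff the list `E` contains the pair in some order, and the
fat vertex `k` is adjacent to the slim vertices in the list `F k`. -/
def ofLists {n m : ℕ} (E : List (Fin n × Fin n)) (F : Fin m → List (Fin n))
    (hF : ∀ k, F k ≠ []) : HoffmanGraph (Fin n ⊕ Fin m) where
  graph := SimpleGraph.fromRel fun a b =>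
    match a, b with
    | Sum.inl i, Sum.inl j => (i, j) ∈ E
    | Sum.inl i, Sum.inr k => i ∈ F k
    | Sum.inr _, _ => False
  fat := Set.range Sum.inr
  fat_adj_slim := by
    rintro _ ⟨k, rfl⟩
    obtain ⟨i, hi⟩ := List.exists_mem_of_ne_nil _ (hF k)
    exact ⟨Sum.inl i, by simp, by simp [SimpleGraph.fromRel_adj, hi]⟩
  fat_not_adj := by
    rintro _ ⟨k, rfl⟩ _ ⟨l, rfl⟩
    simp [SimpleGraph.fromRel_adj]

end HoffmanGraph

/-- A finite Hoffman graph together with its vertex set. -/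
structure FinHoffmanGraph where
  V : Type
  fintype : Fintype V
  toHoffman : HoffmanGraph V

namespace FinHoffmanGraph

instance instFintype (G : FinHoffmanGraph) : Fintype G.V := G.fintype

/-- Isomorphism of finite Hoffman graphs. -/
instance isoSetoid : Setoid FinHoffmanGraph where
  r G K := Nonempty (HoffmanGraph.Iso G.toHoffman K.toHoffman)
  iseqv :=
    { refl := fun G => ⟨HoffmanGraph.Iso.refl G.toHoffman⟩
      symm := fun ⟨e⟩ => ⟨e.symm⟩
      trans := fun ⟨e⟩ ⟨f⟩ => ⟨e.trans f⟩ }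

/-- Isomorphism classes of finite Hoffman graphs. -/
abbrev IsoClass : Type 1 := Quotient isoSetoid

/-- The isomorphism class of a finite Hoffman graph. -/
def isoClass (G : FinHoffmanGraph) : IsoClass := Quotient.mk isoSetoid G

/-- `G` is a fat `α`-irreducible Hoffman graph. -/
def IsFatIrreducible (α : ℝ) (G : FinHoffmanGraph) : Prop :=
  G.toHoffman.IsFat ∧ G.toHoffman.IsIrreducible α

/-- `G` is maximal, with respect to taking induced Hoffman subgraphs, among the fat
`α`-irreducible Hoffman graphs. -/
def IsMaximalFatIrreducible (α : ℝ) (G : FinHoffmanGraph) : Prop :=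
  G.IsFatIrreducible α ∧ ∀ K : FinHoffmanGraph, K.IsFatIrreducible α →
    G.toHoffman.IsInducedIn K.toHoffman → isoClass G = isoClass K

/-- The set of isomorphism classes of the maximal fat `α`-irreducible Hoffman graphs. -/
def maximalClasses (α : ℝ) : Set IsoClass :=
  {c | ∃ G : FinHoffmanGraph, G.IsMaximalFatIrreducible α ∧ isoClass G = c}

/-- The bundled version of `HoffmanGraph.ofLists`. -/
def ofLists {n m : ℕ} (E : List (Fin n × Fin n)) (F : Fin m → List (Fin n))
    (hF : ∀ k, F k ≠ []) : FinHoffmanGraph :=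
  ⟨Fin n ⊕ Fin m, inferInstance, HoffmanGraph.ofLists E F hF⟩

end FinHoffmanGraph

open Classical in
/-- An `𝓗`-line graph: an induced Hoffman subgraph of a finite Hoffman graph with a decomposition
into Hoffman graphs whose isomorphism classes belong to `𝓗`. -/
def HoffmanGraph.IsLineGraph {V : Type u} (𝓗 : Set FinHoffmanGraph.IsoClass)
    (H : HoffmanGraph V) : Prop :=
  ∃ (W : Type) (_ : Fintype W) (K : HoffmanGraph W), H.IsInducedIn K ∧
    ∃ (n : ℕ) (D : K.Decomposition n), ∀ i,
      FinHoffmanGraph.isoClass ⟨D.part i, inferInstance, D.piece i⟩ ∈ 𝓗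

/-- Edges of the wheel with hub `0` and rim `1, 2, 3, 4, 5`. -/
def wheelEdges : List (Fin 6 × Fin 6) :=
  [(0, 1), (0, 2), (0, 3), (0, 4), (0, 5), (1, 2), (2, 3), (3, 4), (4, 5), (5, 1)]

/-- Edges of the 3-sun: the triangle `0, 1, 2` together with the vertices `3, 4, 5`, where `3` is
joined to `1, 2`, `4` is joined to `0, 2`, and `5` is joined to `0, 1`. -/
def sunEdges : List (Fin 6 × Fin 6) :=
  [(0, 1), (0, 2), (1, 2), (1, 3), (2, 3), (0, 4), (2, 4), (0, 5), (1, 5)]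

/-- Edges of two complete graphs, on `0, 1, 2` and on `0, 3, 4, 5`, sharing the vertex `0`. -/
def cliquesEdges : List (Fin 6 × Fin 6) :=
  [(0, 1), (0, 2), (1, 2), (0, 3), (0, 4), (0, 5), (3, 4), (3, 5), (4, 5)]

open FinHoffmanGraph in
/-- The explicit list of the maximal fat `(-1-τ)`-irreducible Hoffman graphs. -/
def maximalList : Fin 20 → FinHoffmanGraph := ![
  -- two slim vertices
  ofLists (n := 2) [(0, 1)] ![[0], [1], [1]] (by decide),
  ofLists (n := 2) [] ![[0, 1], [1]] (by decide),
  -- four slim vertices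
  ofLists (n := 4) [(0, 1), (1, 2), (2, 3)] ![[0, 1, 2, 3]] (by decide),
  ofLists (n := 4) [(0, 1), (1, 2), (2, 3)] ![[0, 3], [1, 2]] (by decide),
  -- five slim vertices
  ofLists (n := 5) [(0, 1), (1, 2), (3, 4)] ![[0, 3], [1], [2, 4]] (by decide),
  ofLists (n := 5) [(0, 1), (1, 2), (2, 3), (3, 0)] ![[0, 1, 4], [2], [3]] (by decide),
  ofLists (n := 5) [(0, 1), (0, 2), (1, 2), (1, 3), (2, 3), (3, 4)]
    ![[0, 4], [1], [2], [3]] (by decide),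
  -- six slim vertices, special graph the wheel
  ofLists wheelEdges ![[0], [1], [2], [3], [4], [5]] (by decide),
  ofLists ((1, 3) :: wheelEdges) ![[0], [1, 3], [2], [4], [5]] (by decide),
  ofLists ((1, 3) :: (2, 4) :: wheelEdges) ![[0], [1, 3], [2, 4], [5]] (by decide),
  -- six slim vertices, special graph the 3-sun
  ofLists sunEdges ![[0], [1], [2], [3], [4], [5]] (by decide),
  ofLists ((0, 3) :: sunEdges) ![[0, 3], [1], [2], [4], [5]] (by decide),
  ofLists ((0, 3) :: (1, 4) :: sunEdges) ![[0, 3], [1, 4], [2], [5]] (by decide),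
  ofLists ((0, 3) :: (1, 4) :: (2, 5) :: sunEdges) ![[0, 3], [1, 4], [2, 5]] (by decide),
  ofLists ((3, 4) :: sunEdges) ![[0], [1], [2], [3, 4], [5]] (by decide),
  ofLists ((3, 4) :: (2, 5) :: sunEdges) ![[0], [1], [2, 5], [3, 4]] (by decide),
  ofLists ((3, 4) :: (3, 5) :: (4, 5) :: sunEdges) ![[0], [1], [2], [3, 4, 5]] (by decide),
  -- six slim vertices, special graph the two complete graphs sharing a vertex
  ofLists cliquesEdges ![[0], [1], [2], [3], [4], [5]] (by decide),
  ofLists ((1, 3) :: cliquesEdges) ![[0], [1, 3], [2], [4], [5]] (by decide),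
  ofLists ((1, 3) :: (2, 4) :: cliquesEdges) ![[0], [1, 3], [2, 4], [5]] (by decide)]

/-! Write τ for the golden ratio. A graph satisfies λ_min ≥ -1-τ iff B + (1+τ)I is positive
semidefinite; call it good. The nonzero off-diagonal entries of B are the edges of the special graph
on the slim vertices. The condition that a decomposition imposes on slim vertices of different parts
is exactly that their entry vanishes (`entry_eq_zero_iff`). Decompositions therefore correspond to
block structures of B, and H is reducible iff some good K containing H has a special graph in which
two slim vertices of H can be separated (`isReducible_iff`).

The diagonal of B is minus the number of fat neighbours, and τ < 2, so in a good fat graph every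
slim vertex has one or two of them. Suppose that x has two and is joined to y in the special graph.
Then y has one, and the block [[τ-1, ±1], [±1, τ]] has determinant τ² - τ - 1 = 0. By
semidefiniteness its kernel vector is orthogonal to every other row; as τ is irrational and the
entries are integers, x and y have no further neighbours (`IsPsd.isolated`). Such components have at
most two vertices and lie in one of the first two listed graphs.

In every other component each slim vertex has one fat neighbour, and the special graph is a signed
graph with smallest eigenvalue at least -τ. It is recorded, together with the relation of having a
common fat neighbour, by a matrix of codes in {0, 1, 2, 3}. Call it a pendant clique if it is a
positive clique with at least two vertices and at most one pendant vertex at each of them. A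
connected signed graph avoiding eight small seeds is a pendant clique, has at most one vertex, or is
a single negative edge (`IsFree.classify`). A good completion of a seed is one of finitely many
representatives (`seeds_resolve`), and these are closed under good connected extension by one vertex
(`table_extends`). Hence a connected good signed graph containing a seed is itself a representative.
The representatives and the small exceptions embed into 18 targets, the codes of the other listed
graphs.

Pendant cliques are removed by attaching a new fat vertex to the clique: its entries drop from 1 to
0, and B splits into blocks formed by a clique vertex and its pendant vertex, which are semidefinite
by the same determinant (`IsExtendable.isGood_addFat`). Thus pendant cliques are reducible.
Conversely, if a good extension cuts a connected special graph with one fat neighbour per slim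
vertex, then a new fat vertex is shared across the cut, and semidefiniteness forces a pendant clique
(`isPendantClique_of_isPsd`). No target is one, so the targets are irreducible.

For (a), every fat irreducible graph embeds into a listed one, and the listed graphs are irreducible
and pairwise not embeddable into each other. For (b), fat vertices are attached to cliques until
none is left to treat, each time decreasing the number of special edges; the remaining components
then embed into listed graphs, which are glued along their images. -/

/-! ### Codes of signed graphs -/

namespace SignedCode

/-- The code `e` of a pair of slim vertices is `1` if they are adjacent, plus `2` if they have
a common fat neighbour. The entry `B(x, y)` depends on `e` only. -/
def mval : ℕ → ℤ
  | 1 => 1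
  | 2 => -1
  | _ => 0

/-- The part of the matrix `e` above the diagonal, with rows and columns indexed by a list. -/
def code {α : Type*} (e : α → α → ℕ) : List α → List (List ℕ)
  | [] => []
  | x :: l => l.map (e x) :: code e l

/-- Whether the codes of the three pairs in a triple are compatible. -/
def tri (a u v : ℕ) : Bool :=
  !(((Nat.ble 2 a && Nat.ble 2 u && Nat.ble v 1)) || ((Nat.ble 2 a && Nat.ble 2 v && Nat.ble u 1)) ||
    ((Nat.ble 2 u && Nat.ble 2 v && Nat.ble a 1)) ||
    (mval a * mval u * mval v == -1))

/-- Here `a` is the code of a pair, and the two lists are the codes of its members with the same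
further vertices. -/
def tris (a : ℕ) : List ℕ → List ℕ → Bool
  | u :: us, v :: vs => tri a u v && tris a us vs
  | _, _ => true

/-- The rows compatible with a code whose entries are taken from given lists. -/
def rows : List (List ℕ) → List (List ℕ) → List (List ℕ)
  | p :: P, r :: R => (rows P R).flatMap fun v => (p.filter fun a => tris a r v).map (· :: v)
  | _, _ => [[]]

/-- The codes following a pattern of lists of allowed entries. -/
def codes : List (List (List ℕ)) → List (List (List ℕ))
  | [] => [[]]
  | p :: P => (codes P).flatMap fun R => (rows p R).map (· :: R)

def dot : List ℤ → List ℕ → ℤ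
  | z :: zs, a :: v => z * mval a + dot zs v
  | _, _ => 0

/-- The quadratic form of the signed graph with a given code. -/
def form : List ℤ → List (List ℕ) → ℤ
  | z :: zs, v :: R => 2 * (z * dot zs v) + form zs R
  | _, _ => 0

def normSq : List ℤ → ℕ
  | z :: zs => z.natAbs * z.natAbs + normSq zs
  | [] => 0

def isNeg : ℤ → Bool
  | Int.negSucc _ => true
  | Int.ofNat _ => false

/-- Whether one of the vectors in the list `zs` shows that the smallest eigenvalue of the signed
graph with code `R` is less than `-τ`. -/
def bad (zs : List (List ℤ)) (R : List (List ℕ)) : Bool :=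
  zs.any fun z => isNeg (100000 * form z R + (161804 * normSq z : ℕ)) 

/-- The entry in position `i, j` of the matrix with a given code. -/
def look (R : List (List ℕ)) (i j : ℕ) : ℕ :=
  if Nat.blt i j then (R.getD i []).getD (j - i - 1) 0 else (R.getD j []).getD (i - j - 1) 0

def eqList : List ℕ → List ℕ → Bool
  | a :: l, b :: m => Nat.beq a b && eqList l m
  | [], [] => true
  | _, _ => false

def notIn (a : ℕ) : List ℕ → Bool
  | b :: l => !Nat.beq a b && notIn a l
  | [] => true

/-- The lists of distinct indices below `n` on which the matrix `e` has code `R`. -/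
def isos (n : ℕ) (e : ℕ → ℕ → ℕ) : List (List ℕ) → List (List ℕ)
  | [] => [[]]
  | v :: R => (isos n e R).flatMap fun l =>
      ((List.range n).filter fun i => notIn i l && eqList (l.map (e i)) v).map (· :: l)

/-- With equal lengths, an injective placement of `R` in `C` is a relabelling. -/
def hasIso (C R : List (List ℕ)) : Bool :=
  Nat.beq C.length R.length && !(isos C.length (look C) R).isEmpty

def anyValue : List ℕ := [0, 1, 2, 3]

/-- The codes of the irreducible graphs, together with test vectors for their extensions. -/
def table : List (List (List ℤ) × List (List (List ℕ))) :=
  [([[-1, 2, 1, 1], [1, 2, 1, 1]],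
    [[[2, 2], [3], []]]),
   ([[1, 2, 2, 1, 1], [-1, 2, 2, 1, 1]],
    [[[2, 2, 3], [3, 2], [3], []]]),
   ([[-1, 2, 1, 2, -1], [1, 2, 1, 2, -1]],
    [[[2, 2, 0], [3, 0], [1], []]]),
   ([[-1, 2, 2, -1, -1], [2, 3, 4, -3, -2], [1, 2, 1, -1, -2]],
    [[[2, 0, 1], [1, 0], [3], []], [[2, 0, 1], [1, 0], [0], []]]),
   ([[1, 2, 2, -1, -1], [-1, 1, 2, -2, 1], [-1, 2, 1, 1, -2], [1, 1, 0, 1, -2], [1, 0, 1, -2, 1]],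
    [[[2, 0, 1], [1, 0], [1], []]]),
   ([[-1, 2, -1, 2, -1], [1, 2, -2, 2, -1], [1, -1, 0, -1, 2], [1, 1, 0, 1, -2], [1, -1, 2, -1, 0], [2, 3, -3, 2, -3], [2, 2, -3, 3, -3]],
    [[[1, 3, 1], [1, 1], [1], []], [[1, 0, 1], [1, 1], [1], []]]),
   ([[-2, 4, 3, 3, -1, -1], [1, 2, 2, 2, -1, -1], [1, -1, -2, 1, -2, 2], [1, -1, 1, -2, 2, -2]],
    [[[2, 2, 0, 0], [3, 0, 1], [1, 0], [1], []]]),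
   ([[2, 1, 3, -4, -3, 1], [2, -3, -4, 3, 1, 1], [2, 3, 1, 1, 3, -4], [1, -2, -1, -1, -2, 2]],
    [[[2, 0, 0, 1], [1, 0, 0], [2, 0], [1], []]]),
   ([[1, 0, -2, 1, 2, -2], [1, 0, 2, -1, -2, 2], [1, -2, -1, 0, 0, 1], [1, 2, 1, 0, 0, -1], [2, -1, 1, -2, -2, 2], [1, 0, 1, -2, 0, 1], [1, 0, -1, 2, 0, -1], [1, 1, 2, -1, -1, 0], [1, 0, -2, 1, 1, -2], [2, -1, -2, -1, 1, 1], [2, 1, 1, -1, 1, -2], [2, -1, -2, 1, -1, 1], [2, 1, 1, 1, -1, -2], [2, -1, -1, -1, 2, -1], [2, -1, -1, 2, -1, -1]],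
    [[[2, 0, 0, 1], [1, 1, 0], [1, 1], [1], []]]),
   ([[2, 3, -1, -1, 3, -4], [2, -3, 1, 1, -3, 4], [2, 1, -3, 4, -3, 1], [2, -3, 4, -3, 1, 1], [1, 0, 0, -1, 2, -1], [1, 2, -1, 0, 0, -1]],
    [[[1, 3, 0, 1], [1, 3, 0], [1, 0], [1], []], [[1, 3, 0, 1], [1, 0, 0], [1, 0], [1], []], [[1, 0, 0, 1], [1, 0, 0], [1, 0], [1], []]]),
   ([[1, 1, -2, 2, -1, 0], [1, -1, 2, -2, 1, 0], [1, -1, 0, 0, -1, 2], [1, 1, 0, 0, 1, -2], [1, -2, 1, -2, 0, 1], [1, -2, 1, -2, 1, 1], [1, 1, -2, 1, -2, 1]],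
    [[[1, 3, 0, 1], [1, 3, 1], [1, 1], [1], []], [[1, 3, 0, 1], [1, 0, 1], [1, 1], [1], []], [[1, 0, 3, 1], [1, 0, 1], [1, 1], [1], []], [[1, 0, 0, 1], [1, 0, 1], [1, 1], [1], []]]),
   ([[1, -2, 2, -1, -1, 0], [1, 2, -3, 1, 1, 0], [-1, 0, -2, 1, 1, 2], [1, 0, -3, 1, 1, 2], [1, -1, 2, 0, -2, -1], [1, -1, 2, -2, 0, -1], [1, 1, -2, 2, 0, 1], [1, 1, -2, 0, 2, 1], [2, 2, 0, -2, 1, -1], [2, -2, 0, -1, 2, 1], [2, -1, 0, 1, -2, 2], [2, 1, 0, 2, -1, -2], [2, 1, 0, -1, 2, -2], [2, -2, 0, 2, -1, 1], [2, 2, 0, 1, -2, -1], [2, -1, 0, -2, 1, 2]],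
    [[[1, 3, 0, 1], [1, 1, 1], [1, 0], [3], []], [[1, 3, 0, 1], [1, 1, 1], [1, 0], [0], []], [[1, 0, 0, 1], [1, 1, 1], [1, 0], [0], []]]),
   ([[2, -2, 1, -3, 1, 1, 1], [1, 0, -2, 1, -2, 0, 1], [2, 1, 1, 1, 1, -2, -3], [2, -2, 3, 0, -1, -2, 0], [1, 2, -1, 2, 0, 0, -1], [2, -1, -1, -1, -1, 2, 2], [2, 1, -2, 1, -2, 1, 1], [2, 1, 0, -3, 2, 2, 0], [2, -1, 2, -1, 2, -1, -1], [2, -1, -2, 2, -2, -1, 2], [1, 1, 0, 1, -1, -1, -1], [1, 1, -2, 0, 1, 1, 0], [1, 1, 0, 0, 1, 1, -2], [1, -1, 3, -2, 1, -1, -2], [1, 1, -2, 3, -1, -1, -2], [1, -1, -2, -2, -1, 1, 3]],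
    [[[1, 3, 0, 0, 1], [1, 3, 1, 1], [1, 1, 1], [0, 1], [3], []], [[1, 3, 0, 0, 1], [1, 3, 1, 1], [1, 1, 1], [0, 1], [0], []], [[1, 3, 0, 0, 1], [1, 0, 1, 1], [1, 1, 1], [3, 1], [0], []], [[1, 3, 0, 0, 1], [1, 0, 1, 1], [1, 1, 1], [0, 1], [0], []], [[1, 0, 3, 3, 1], [1, 0, 1, 1], [1, 1, 1], [3, 1], [0], []], [[1, 0, 0, 3, 1], [1, 0, 1, 1], [1, 1, 1], [0, 1], [0], []], [[1, 0, 0, 0, 1], [1, 0, 1, 1], [1, 1, 1], [0, 1], [0], []]]),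
   ([[2, 0, -2, 2, -2, 0, 1], [2, -1, 2, -3, 2, -1, 1], [2, -2, 1, 1, -2, 3, -1], [2, 3, -2, 1, 1, -2, -1], [1, 0, 0, -2, 1, -2, 1], [1, -2, 1, -2, 0, 0, 1], [1, -1, 2, -1, 0, 0, 0], [1, 0, 0, -1, 2, -1, 0], [1, -1, 0, 0, -1, 2, 0], [1, 2, -1, 0, 0, -1, 0], [1, -1, 1, -1, 1, -1, 0], [1, 1, -1, 1, -1, 1, -1], [2, -1, -1, -1, -1, -1, 3], [2, 1, 1, 1, 1, 1, -3]],
    [[[1, 3, 0, 1, 1], [1, 3, 0, 1], [1, 0, 1], [1, 1], [1], []], [[1, 3, 0, 1, 1], [1, 0, 0, 1], [1, 0, 1], [1, 1], [1], []], [[1, 0, 0, 1, 1], [1, 0, 0, 1], [1, 0, 1], [1, 1], [1], []]]),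
   ([[-1, 0, -3, 1, 1, 2, 1], [1, 2, -5, 1, 1, 2, 1], [1, -2, 3, -1, -1, 0, -1], [-1, 1, -2, 0, 0, 1, 2], [1, -1, 2, 0, -2, -1, 0], [1, 1, -3, 0, 0, 1, 2], [1, 1, -3, 0, 2, 1, 0], [1, 1, -3, 2, 0, 1, 0], [1, -1, 2, -2, 0, -1, 0], [1, 0, -1, 1, 1, 1, -1], [1, 0, -1, -1, 1, 1, 1], [1, 1, -1, 1, 1, 0, -1], [1, 1, -1, 1, -1, 0, 1], [1, 1, -1, -1, 1, 0, 1], [1, 0, -1, 1, -1, 1, 1], [2, -2, 1, -1, 1, 1, -1], [2, 1, 1, 1, -1, -2, -1], [2, 1, 1, -1, 1, -2, -1], [2, -2, 1, 1, -1, 1, -1], [2, 1, 1, -1, -1, -2, 1], [2, -2, 1, -1, -1, 1, 1], [1, 1, -4, 1, 1, 1, 1]],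
    [[[1, 3, 0, 1, 0], [1, 1, 1, 1], [1, 0, 1], [3, 1], [0], []], [[1, 3, 0, 1, 0], [1, 1, 1, 1], [1, 0, 1], [0, 1], [0], []], [[1, 0, 0, 1, 0], [1, 1, 1, 1], [1, 0, 1], [0, 1], [0], []]])]

def reps : List (List (List ℕ)) := table.flatMap Prod.snd

def seedPool : List (List ℤ) :=
  [[-2, 1, 1, 1], [2, -1, 1, -1], [2, -1, -1, 1], [2, 1, -1, -1], [2, 1, 1, -1], [2, 1, 1, 1],
   [2, 1, -1, 1], [2, -1, 1, 1], [1, -2, 2, -2, 1], [1, 1, -2, 2, -1], [-1, 2, 2, -2, 1], [1,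
   -2, 2, 2, -1], [-1, 2, -2, 2, 1], [-1, -1, 2, 2, -1], [1, 1, -2, 2, 1], [1, 2, 2, -2, 1],
   [-1, 2, 2, 2, -1], [1, -2, -2, 2, 1], [1, -2, 2, 2, 1], [-1, -1, 2, 2, 1], [1, 2, 2, 2, -1],
   [1, 2, 2, -2, -1], [-1, 2, 2, 2, 1], [1, 2, 2, 2, 1]]

/-- The minimal signed graphs that are not obtained from a positive clique by attaching pendant
vertices. -/
def seeds : List (List (List (List ℕ))) :=
  let Z := [0, 3]
  let N := [1, 2]
  [[[[2], [2]], [anyValue], []],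
   [[N, N, N], [Z, Z], [Z], []],
   [[[1], [1], Z], [[1], [1]], [[1]], []],
   [[N, Z, anyValue], [[2], Z], [N], []],
   [[N, Z, N], [N, Z], [N], []],
   [[N, Z, Z, anyValue], [N, Z, Z], [N, Z], [N], []],
   [[[1], [1], [1], [1]], [[1], Z, Z], [Z, Z], [[1]], []],
   [[[1], [1], Z, Z], [[1], Z, Z], [N, Z], [N], []]]

/-- The dichotomy behind the search: a code is refuted by a test vector or is a relabelled
representative. -/
def resolves (zs : List (List ℤ)) (R : List (List ℕ)) : Bool :=
  bad zs R || reps.any (hasIso R)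

/-- Starting point of the search: a good graph containing a seed contains a representative. The
pruning in `rows` keeps the enumeration small. -/
theorem seeds_resolve :
    (seeds.all fun P => (codes P).all fun R => resolves seedPool R) = true := by
  decide +kernel

/-- The codes 0 and 3 are those with entry zero in the special graph. -/
def allZero : List ℕ → Bool
  | a :: l => (Nat.beq a 0 || Nat.beq a 3) && allZero l
  | [] => true

/-- Closure of the search: a vertex joined to a representative gives another representative, unless
the extension is not good. In particular the largest representatives have no good connected
extension. -/
theorem table_extends :
    (table.all fun t => t.2.all fun R => (rows (List.replicate R.length anyValue) R).all fun v =>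
      allZero v || resolves t.1 (v :: R)) = true := by
  decide +kernel

end SignedCode

open Real in
/-- The quadratic form of `b + (1 + τ) I` is nonnegative. -/
def IsPsd {S : Type*} [Fintype S] (b : S → S → ℤ) : Prop :=
  ∀ c : S → ℝ, 0 ≤ ∑ x, ∑ y, c x * c y * b x y + (1 + goldenRatio) * ∑ x, c x ^ 2

/-- This bound matches the constants 161804 and 100000 in `bad`, so that a negative integer there
certifies an eigenvalue below -τ. -/
theorem goldenRatio_lt : Real.goldenRatio < 1.61804 := by
  have : √5 < 2.23608 := by
    rw [Real.sqrt_lt' (by norm_num)]; norm_num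
  unfold Real.goldenRatio; linarith

/-! ### Soundness of the finite checks on codes -/

namespace SignedCode

theorem eqList_iff : ∀ {l m : List ℕ}, eqList l m = true ↔ l = m
  | [], [] => by simp [eqList]
  | [], _ :: _ => by simp [eqList]
  | _ :: _, [] => by simp [eqList]
  | a :: l, b :: m => by simp [eqList, eqList_iff (l := l)]

theorem notIn_iff {a : ℕ} : ∀ {l : List ℕ}, notIn a l = true ↔ a ∉ l
  | [] => by simp [notIn]
  | b :: l => by
      have h : a.beq b = false ↔ a ≠ b := by
        rw [← Bool.not_eq_true, ne_eq, Nat.beq_eq]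
      simp [notIn, notIn_iff (l := l), h]

theorem isNeg_iff {n : ℤ} : isNeg n = true ↔ n < 0 := by
  cases n with
  | ofNat k => simp [isNeg]
  | negSucc k => simp [isNeg, Int.negSucc_lt_zero]

theorem mem_isos {n : ℕ} {e : ℕ → ℕ → ℕ} : ∀ {R : List (List ℕ)} {l : List ℕ},
    l ∈ isos n e R ↔ l.Nodup ∧ (∀ i ∈ l, i < n) ∧ code e l = R
  | [], l => by
      cases l <;> simp [isos, code]
  | v :: R, l => by
      cases l with
      | nil => simp [isos, code]
      | cons i l =>
        simp [isos, code, mem_isos (R := R), notIn_iff, eqList_iff]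
        tauto

theorem length_code {α : Type*} (e : α → α → ℕ) : ∀ l : List α, (code e l).length = l.length
  | [] => rfl
  | _ :: l => by simp [code, length_code e l]

theorem code_map {α β : Type*} {e : α → α → ℕ} {e' : β → β → ℕ} {f : α → β} :
    ∀ {l : List α}, l.Nodup → (∀ i ∈ l, ∀ j ∈ l, i ≠ j → e i j = e' (f i) (f j)) →
      code e' (l.map f) = code e l
  | [], _, _ => rfl
  | i :: l, hl, h => by
      rw [List.nodup_cons] at hl
      simp only [List.map_cons, code, List.map_map]
      rw [code_map hl.2 fun a ha b hb => h a (by simp [ha]) b (by simp [hb])]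
      congr 1
      refine List.map_congr_left fun j hj => ?_
      exact (h i (by simp) j (by simp [hj]) (by rintro rfl; exact hl.1 hj)).symm

/-- The properties of the codes `e` coming from Hoffman graphs. -/
structure IsCode {S : Type*} (e : S → S → ℕ) : Prop where
  lt : ∀ x y, e x y < 4
  symm : ∀ x y, e x y = e y x
  trans : ∀ x y z, x ≠ y → y ≠ z → x ≠ z → 2 ≤ e x y → 2 ≤ e y z → 2 ≤ e x z

theorem getD_code {α : Type*} (e : α → α → ℕ) (d : α) : ∀ (l : List α) (i j : ℕ), i < j →
    j < l.length → ((code e l).getD i []).getD (j - i - 1) 0 = e (l.getD i d) (l.getD j d)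
  | [], i, j, _, hj => by simp at hj
  | x :: l, 0, j + 1, _, hj => by
      simp only [List.length_cons, Nat.add_lt_add_iff_right] at hj
      simp [code, List.getD_eq_getElem?_getD, hj]
  | x :: l, i + 1, j + 1, hij, hj => by
      have := getD_code e d l i j (by omega) (by simpa using hj)
      simpa [code, List.getD_cons_succ] using this

theorem look_code {α : Type*} {e : α → α → ℕ} (he : IsCode e) (d : α) (l : List α) {i j : ℕ}
    (hi : i < l.length) (hj : j < l.length) (hij : i ≠ j) :
    look (code e l) i j = e (l.getD i d) (l.getD j d) := by
  unfold look
  by_cases h : i < j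
  · rw [if_pos (by simpa using h), getD_code e d l i j h hj]
  · rw [if_neg (by simpa using h), getD_code e d l j i (by omega) hi, he.symm]

theorem exists_of_hasIso {α : Type*} {e : α → α → ℕ} (he : IsCode e) {l : List α} (hl : l.Nodup)
    {R : List (List ℕ)} (h : hasIso (code e l) R = true) :
    ∃ m : List α, m.Nodup ∧ m.length = l.length ∧ code e m = R := by
  simp only [hasIso, length_code, Bool.and_eq_true, Bool.not_eq_true',
    List.isEmpty_eq_false_iff_exists_mem, mem_isos] at h
  obtain ⟨hlen, idx, hnd, hlt, hc⟩ := h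
  have hidx : idx.length = l.length := by
    rw [Nat.eq_of_beq_eq_true hlen, ← hc, length_code]
  cases l with
  | nil =>
    obtain rfl : idx = [] := by simpa using hidx
    exact ⟨[], List.nodup_nil, rfl, by simpa [code] using hc⟩
  | cons d l' =>
    refine ⟨idx.map fun i => (d :: l').getD i d, ?_, by simpa using hidx, ?_⟩
    · refine List.Nodup.map_on (fun i hi j hj hij => ?_) hnd
      have h1 := hlt i hi
      have h2 := hlt j hj
      rw [List.getD_eq_getElem _ _ h1, List.getD_eq_getElem _ _ h2] at hij
      exact (hl.getElem_inj_iff).1 hij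
    · rw [← hc]
      exact code_map hnd fun i hi j hj hij => look_code he d _ (hlt i hi) (hlt j hj) hij

section Form

variable {S : Type*} [DecidableEq S] {e : S → S → ℕ}

/-- The signed adjacency matrix. -/
def signed (e : S → S → ℕ) (x y : S) : ℤ := if x = y then 0 else mval (e x y)

theorem signed_symm (he : IsCode e) (x y : S) : signed e x y = signed e y x := by
  unfold signed; rw [he.symm x y]; simp only [eq_comm]

/-- The smallest eigenvalue of the signed adjacency matrix is at least `-τ`. -/
def IsGood [Fintype S] (e : S → S → ℕ) : Prop :=
  ∀ c : S → ℝ, 0 ≤ ∑ x, c x * ∑ y, signed e x y * c y + Real.goldenRatio * ∑ x, c x ^ 2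

def vec : List ℤ → List S → S → ℝ
  | z :: zs, x :: l => Pi.single x (z : ℝ) + vec zs l
  | _, _ => 0

theorem vec_apply_of_notMem : ∀ {z : List ℤ} {l : List S} {x : S}, x ∉ l → vec z l x = 0
  | [], _, _, _ => rfl
  | _ :: _, [], _, _ => rfl
  | z :: zs, y :: l, x, h => by
      simp only [List.mem_cons, not_or] at h
      simp [vec, vec_apply_of_notMem h.2, h.1]

variable [Fintype S]

theorem sum_signed_vec {x : S} : ∀ {z : List ℤ} {l : List S}, x ∉ l →
    ∑ y, signed e x y * vec z l y = dot z (l.map (e x))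
  | [], _, _ => by simp [vec, dot]
  | _ :: _, [], _ => by simp [vec, dot]
  | z :: zs, y :: l, h => by
      simp only [List.mem_cons, not_or] at h
      have h1 := sum_signed_vec (z := zs) h.2
      simp only [vec, Pi.add_apply, mul_add, Finset.sum_add_distrib, h1]
      have h2 : ∑ w, (signed e x w : ℝ) * (Pi.single y (z : ℝ) : S → ℝ) w = z * mval (e x y) := by
        rw [Finset.sum_eq_single y (fun w _ hw => by simp [hw]) (by simp)]
        simp [signed, h.1, mul_comm]
      rw [h2]
      simp [dot]

/-- Vertices are added one at a time. The diagonal of the signed matrix is zero, so a new vertex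
only contributes its products with the later ones, twice by symmetry. -/
theorem form_vec (he : IsCode e) : ∀ {z : List ℤ} {l : List S}, l.Nodup →
    ∑ x, vec z l x * ∑ y, signed e x y * vec z l y = form z (code e l)
  | [], _, _ => by simp [vec, form]
  | _ :: _, [], _ => by simp [vec, form, code]
  | z :: zs, x :: l, h => by
      rw [List.nodup_cons] at h
      have h1 := sum_signed_vec (e := e) (z := zs) h.1
      have h2 : ∑ w, vec zs l w * (signed e w x * (z : ℝ)) = z * dot zs (l.map (e x)) := by
        rw [← h1, Finset.mul_sum]
        refine Finset.sum_congr rfl fun w _ => ?_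
        rw [signed_symm he]; ring
      have h3 : ∀ w, ∑ y, (signed e w y : ℝ) * vec (z :: zs) (x :: l) y =
          signed e w x * (z : ℝ) + ∑ y, signed e w y * vec zs l y := by
        intro w
        simp [vec, mul_add, Finset.sum_add_distrib, Pi.single_apply]
      simp only [h3]
      simp only [vec, Pi.add_apply, add_mul, mul_add, Finset.sum_add_distrib, form_vec he h.2, h2,
        Pi.single_apply, ite_mul, zero_mul, Finset.sum_ite_eq', Finset.mem_univ, if_true, h1]
      simp [form, code, signed]
      ring

/-- Only an inequality, since coordinates of `z` beyond the length of `l` count in `normSq` but not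
in the vector. As τ > 0, this is the direction needed. -/
theorem sum_sq_vec : ∀ {z : List ℤ} {l : List S}, l.Nodup →
    ∑ x, vec z l x ^ 2 ≤ (normSq z : ℝ)
  | [], _, _ => by simp [vec, normSq]
  | _ :: _, [], _ => by simp [vec]
  | z :: zs, x :: l, h => by
      rw [List.nodup_cons] at h
      have := sum_sq_vec (z := zs) h.2
      have h2 : ∀ y, vec (z :: zs) (x :: l) y ^ 2
          = (if y = x then (z : ℝ) ^ 2 else 0) + vec zs l y ^ 2 := by
        intro y
        by_cases hy : y = x
        · subst hy
          simp [vec, vec_apply_of_notMem h.1]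
        · simp [vec, hy]
      have h3 : ((z.natAbs : ℕ) : ℝ) * z.natAbs = (z : ℝ) ^ 2 := by
        rw [← sq, Nat.cast_natAbs, Int.cast_abs, sq_abs]
      simp only [h2, Finset.sum_add_distrib, Finset.sum_ite_eq', Finset.mem_univ, if_true, normSq]
      push_cast
      rw [h3]
      linarith

theorem IsGood.form_nonneg (hg : IsGood e) (he : IsCode e) {l : List S} (hl : l.Nodup)
    (z : List ℤ) : 0 ≤ (form z (code e l) : ℝ) + Real.goldenRatio * normSq z := by
  have h := hg (vec z l)
  rw [form_vec he hl] at h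
  have := mul_le_mul_of_nonneg_left (sum_sq_vec (z := z) hl) Real.goldenRatio_pos.le
  linarith

theorem IsGood.not_bad (hg : IsGood e) (he : IsCode e) {l : List S} (hl : l.Nodup)
    (zs : List (List ℤ)) : bad zs (code e l) = false := by
  rw [Bool.eq_false_iff]
  intro h
  simp only [bad, List.any_eq_true, isNeg_iff] at h
  obtain ⟨z, -, hz⟩ := h
  have h1 := hg.form_nonneg he hl z
  have h2 : (100000 * (form z (code e l) : ℝ) + 161804 * normSq z) < 0 := by exact_mod_cast hz
  have h3 := mul_le_mul_of_nonneg_right goldenRatio_lt.le (Nat.cast_nonneg (α := ℝ) (normSq z))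
  linarith

theorem mval_cases (n : ℕ) : mval n = 0 ∨ mval n = 1 ∨ mval n = -1 := by
  unfold mval; split <;> simp

/-- The three transitivity conditions come from `IsCode`. A triangle whose signs have product -1 has
the eigenvalue -2 < -τ. -/
theorem IsGood.tri (hg : IsGood e) (he : IsCode e) {x y z : S} (hxy : x ≠ y) (hyz : y ≠ z)
    (hxz : x ≠ z) : tri (e x y) (e y z) (e x z) = true := by
  have h1 := he.trans x y z hxy hyz hxz
  have h2 := he.trans y x z hxy.symm hxz hyz
  have h3 := he.trans x z y hxz hyz.symm hxy
  rw [he.symm y x] at h2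
  rw [he.symm z y] at h3
  have h4 : ¬ mval (e x y) * mval (e y z) * mval (e x z) = -1 := by
    intro h
    have hl : [x, y, z].Nodup := by simp [hxy, hyz, hxz]
    -- This is the eigenvector for -2: each of the three edges contributes -2 to the form, so that
    -- the value is -6 + 3τ < 0.
    have := hg.form_nonneg he hl [1, -mval (e x y), -mval (e x z)]
    have hlt := goldenRatio_lt
    rcases mval_cases (e x y) with ha | ha | ha <;> rcases mval_cases (e y z) with hb | hb | hb <;>
      rcases mval_cases (e x z) with hc | hc | hc <;> rw [ha, hb, hc] at h <;> norm_num at h <;>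
      simp [form, code, dot, ha, hb, hc, normSq] at this <;> linarith
  have h5 : (mval (e x y) * mval (e y z) * mval (e x z) == -1) = false := by simpa using h4
  unfold SignedCode.tri
  rw [h5]
  by_contra h
  simp only [Bool.or_false, Bool.not_eq_true', Bool.not_eq_false, Bool.or_eq_true,
    Bool.and_eq_true, Nat.ble_eq] at h
  omega

theorem IsGood.tris (hg : IsGood e) (he : IsCode e) {x y : S} (hxy : x ≠ y) :
    ∀ {l : List S}, x ∉ l → y ∉ l → tris (e x y) (l.map (e y)) (l.map (e x)) = true
  | [], _, _ => rfl
  | z :: l, hx, hy => by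
      simp only [List.mem_cons, not_or] at hx hy
      simp [SignedCode.tris, hg.tri he hxy hy.1 hx.1, hg.tris he hxy hx.2 hy.2]

/-- Completeness of the enumeration: only triples violating `tri` are pruned, and a good graph has
none. -/
theorem IsGood.mem_rows (hg : IsGood e) (he : IsCode e) {x : S} : ∀ {P : List (List ℕ)}
    {l : List S}, l.Nodup → x ∉ l → List.Forall₂ (fun p y => e x y ∈ p) P l →
      l.map (e x) ∈ rows P (code e l)
  | _, _, _, _, .nil => by simp [rows]
  | p :: P, y :: l, hl, hx, .cons h h' => by
      rw [List.nodup_cons] at hl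
      simp only [List.mem_cons, not_or] at hx
      simp only [code, rows, List.mem_flatMap]
      exact ⟨_, hg.mem_rows he hl.2 hx.2 h', by simp [h, hg.tris he hx.1 hx.2 hl.1]⟩

/-- Whether the codes of the pairs in a list follow a pattern. -/
def Follows (e : S → S → ℕ) : List (List (List ℕ)) → List S → Prop
  | p :: P, x :: l => List.Forall₂ (fun p y => e x y ∈ p) p l ∧ Follows e P l
  | [], [] => True
  | _, _ => False

theorem IsGood.mem_codes (hg : IsGood e) (he : IsCode e) : ∀ {P : List (List (List ℕ))}
    {l : List S}, l.Nodup → Follows e P l → code e l ∈ codes P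
  | [], [], _, _ => by simp [codes, code]
  | [], _ :: _, _, h => h.elim
  | _ :: _, [], _, h => h.elim
  | p :: P, x :: l, hl, h => by
      rw [List.nodup_cons] at hl
      simp only [codes, code, List.mem_flatMap]
      exact ⟨_, hg.mem_codes he hl.2 h.2, by simp [hg.mem_rows he hl.2 hl.1 h.1]⟩

theorem exists_rep_of_resolves (hg : IsGood e) (he : IsCode e) {l : List S} (hl : l.Nodup)
    {zs : List (List ℤ)} (h : resolves zs (code e l) = true) :
    ∃ m : List S, m.Nodup ∧ m.length = l.length ∧ code e m ∈ reps := by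
  simp only [resolves, hg.not_bad he hl, Bool.false_or, List.any_eq_true] at h
  obtain ⟨R, hR, h⟩ := h
  obtain ⟨m, h1, h2, h3⟩ := exists_of_hasIso he hl h
  exact ⟨m, h1, h2, h3 ▸ hR⟩

/-- A good signed graph containing a seed contains one of the representatives. -/
theorem exists_rep_of_seed (hg : IsGood e) (he : IsCode e) {P : List (List (List ℕ))}
    (hP : P ∈ seeds) {l : List S} (hl : l.Nodup) (h : Follows e P l) :
    ∃ m : List S, m.Nodup ∧ code e m ∈ reps := by
  have h1 := List.all_eq_true.1 seeds_resolve P hP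
  obtain ⟨m, hm, -, h⟩ := exists_rep_of_resolves hg he hl
    (List.all_eq_true.1 h1 _ (hg.mem_codes he hl h))
  exact ⟨m, hm, h⟩

theorem allZero_iff : ∀ {l : List ℕ}, allZero l = true ↔ ∀ a ∈ l, a = 0 ∨ a = 3
  | [] => by simp [allZero]
  | a :: l => by simp [allZero, allZero_iff (l := l)]

/-- In a connected good signed graph, a representative extends to all vertices. -/
theorem exists_rep_forall_mem (hg : IsGood e) (he : IsCode e)
    (hconn : ∀ T : Set S, T.Nonempty → (∀ x ∉ T, ∀ y ∈ T, mval (e x y) = 0) → T = Set.univ)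
    (h : ∃ m : List S, m.Nodup ∧ code e m ∈ reps) :
    ∃ m : List S, m.Nodup ∧ code e m ∈ reps ∧ ∀ x, x ∈ m := by
  by_contra hcon
  push Not at hcon
  -- If no representative covers all vertices, each one can be enlarged by connectedness, which is
  -- impossible beyond the number of vertices.
  have key : ∀ n : ℕ, ∃ m : List S, m.Nodup ∧ code e m ∈ reps ∧ n ≤ m.length := by
    intro n
    induction n with
    | zero =>
      obtain ⟨m, h1, h2⟩ := h
      exact ⟨m, h1, h2, Nat.zero_le _⟩
    | succ n ih =>
      obtain ⟨m, h1, h2, h3⟩ := ih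
      obtain ⟨w, hw⟩ := hcon m h1 h2
      -- The empty code is not a representative, so connectedness applies to the vertices of `m`.
      have hne : {y | y ∈ m}.Nonempty := by
        cases m with
        | nil => exact absurd (show [] ∈ reps from h2) (by decide)
        | cons a l => exact ⟨a, by simp⟩
      have : ∃ x ∉ m, ∃ y ∈ m, mval (e x y) ≠ 0 := by
        by_contra hc
        push Not at hc
        have := hconn {y | y ∈ m} hne hc
        exact hw (this.symm ▸ Set.mem_univ w : w ∈ {y | y ∈ m})
      obtain ⟨x, hx, y, hy, hxy⟩ := this
      have hl : (x :: m).Nodup := List.nodup_cons.2 ⟨hx, h1⟩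
      simp only [reps, List.mem_flatMap] at h2
      obtain ⟨t, ht, h2⟩ := h2
      have h4 := List.all_eq_true.1 (List.all_eq_true.1 (List.all_eq_true.1 table_extends t ht) _ h2)
        (m.map (e x)) (hg.mem_rows he h1 hx (by
          rw [length_code]
          refine List.forall₂_iff_get.2 ⟨by simp, fun i hi hi' => ?_⟩
          have := he.lt x (m.get ⟨i, hi'⟩)
          simp only [List.get_eq_getElem, List.getElem_replicate, anyValue] at this ⊢
          generalize e x m[i] = a at this
          interval_cases a <;> simp))
      have h5 : allZero (m.map (e x)) = false := by
        rw [Bool.eq_false_iff]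
        intro h5
        rcases allZero_iff.1 h5 (e x y) (List.mem_map_of_mem hy) with h6 | h6 <;>
          simp [h6, mval] at hxy
      rw [h5, Bool.false_or] at h4
      obtain ⟨m', h6, h7, h8⟩ := exists_rep_of_resolves hg he hl (l := x :: m) h4
      exact ⟨m', h6, h8, by rw [h7]; simpa using h3⟩
  obtain ⟨m, h1, -, h3⟩ := key (Fintype.card S + 1)
  have := h1.length_le_card
  omega

end Form

end SignedCode

/-! ### Signed graphs without seeds -/

namespace SignedCode

/-- The signed graph `M` is obtained from the positive clique `U` by attaching at most one
pendant vertex to each vertex of `U`. -/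
structure IsPendantClique {S : Type*} (M : S → S → ℤ) (U : Set S) : Prop where
  nontrivial : U.Nontrivial
  clique : ∀ u ∈ U, ∀ v ∈ U, u ≠ v → M u v = 1
  pendant : ∀ u ∈ U, ∀ x ∉ U, ∀ y ∉ U, M u x ≠ 0 → M u y ≠ 0 → x = y
  indep : ∀ x ∉ U, ∀ y ∉ U, x ≠ y → M x y = 0
  unique : ∀ x ∉ U, ∀ u ∈ U, ∀ v ∈ U, M x u ≠ 0 → M x v ≠ 0 → u = v

section

variable {S : Type*} {e : S → S → ℕ}

theorem mem_any (he : IsCode e) (x y : S) : e x y ∈ anyValue := by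
  have := he.lt x y
  generalize e x y = a at *
  interval_cases a <;> simp [anyValue]
variable [DecidableEq S]

theorem signed_self (x : S) : signed e x x = 0 := by simp [signed]

theorem ne_of_signed {x y : S} (h : signed e x y ≠ 0) : x ≠ y := by
  rintro rfl; exact h (signed_self x)

theorem signed_cases (x y : S) : signed e x y = 0 ∨ signed e x y = 1 ∨ signed e x y = -1 := by
  unfold signed; split_ifs
  · simp
  · exact mval_cases _

theorem signed_of_ne {x y : S} (h : x ≠ y) : signed e x y = mval (e x y) := by simp [signed, h]

theorem mem_zero (he : IsCode e) {x y : S} (h : x ≠ y) (h0 : signed e x y = 0) :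
    e x y ∈ [0, 3] := by
  rw [signed_of_ne h] at h0
  have := he.lt x y
  generalize e x y = a at *
  interval_cases a <;> simp_all [mval]

theorem mem_nonzero (he : IsCode e) {x y : S} (h0 : signed e x y ≠ 0) : e x y ∈ [1, 2] := by
  rw [signed_of_ne (ne_of_signed h0)] at h0
  have := he.lt x y
  generalize e x y = a at *
  interval_cases a <;> simp_all [mval]

theorem mem_one (he : IsCode e) {x y : S} (h0 : signed e x y = 1) : e x y ∈ [1] := by
  rw [signed_of_ne (ne_of_signed (e := e) (by rw [h0]; decide))] at h0
  have := he.lt x y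
  generalize e x y = a at *
  interval_cases a <;> simp_all [mval]

theorem mem_neg_one (he : IsCode e) {x y : S} (h0 : signed e x y = -1) : e x y ∈ [2] := by
  rw [signed_of_ne (ne_of_signed (e := e) (by rw [h0]; decide))] at h0
  have := he.lt x y
  generalize e x y = a at *
  interval_cases a <;> simp_all [mval]

variable [Fintype S]

/-- A good signed graph without representatives. -/
structure IsFree (e : S → S → ℕ) : Prop extends IsCode e where
  good : IsGood e
  free : ¬ ∃ m : List S, m.Nodup ∧ code e m ∈ reps

namespace IsFree

variable (h : IsFree e)
include h

theorem symm' (x y : S) : signed e x y = signed e y x := signed_symm h.toIsCode x y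

theorem symm_ne {x y : S} (hxy : signed e x y ≠ 0) : signed e y x ≠ 0 := by rwa [h.symm']

theorem elim {P : List (List (List ℕ))} (hP : P ∈ seeds) (l : List S) (hl : l.Nodup)
    (hf : Follows e P l) : False :=
  h.free (exists_rep_of_seed h.good h.toIsCode hP hl hf)

theorem neg_unique {c a b : S} (ha : signed e c a = -1) (hb : signed e c b = -1) : a = b := by
  by_contra hab
  have hca := ne_of_signed (e := e) (x := c) (y := a) (by rw [ha]; decide)
  have hcb := ne_of_signed (e := e) (x := c) (y := b) (by rw [hb]; decide)
  refine h.elim (P := seeds[0]) (List.getElem_mem _) [c, a, b] (by simp [hab, hca, hcb]) ?_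
  simpa [Follows, seeds] using ⟨⟨by simpa using mem_neg_one h.toIsCode ha,
    by simpa using mem_neg_one h.toIsCode hb⟩, mem_any h.toIsCode a b⟩

/-- Triangles are positive: the product of the signs is not -1, and two negative edges of a triangle
would meet in a vertex, against `neg_unique`. -/
theorem triangle {x y z : S} (hxy : signed e x y ≠ 0) (hyz : signed e y z ≠ 0)
    (hxz : signed e x z ≠ 0) : signed e x y = 1 := by
  have h1 := ne_of_signed hxy
  have h2 := ne_of_signed hyz
  have h3 := ne_of_signed hxz
  have ht := h.good.tri h.toIsCode h1 h2 h3
  have h4 : signed e x y * signed e y z * signed e x z ≠ -1 := by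
    rw [signed_of_ne h1, signed_of_ne h2, signed_of_ne h3]
    simp only [tri, Bool.not_eq_true', Bool.or_eq_false_iff, beq_eq_false_iff_ne] at ht
    exact ht.2
  rcases signed_cases (e := e) x y with a | a | a
  · exact absurd a hxy
  · exact a
  · rcases signed_cases (e := e) y z with b | b | b
    · exact absurd b hyz
    · rcases signed_cases (e := e) x z with c | c | c
      · exact absurd c hxz
      · simp [a, b, c] at h4
      · exact absurd (h.neg_unique a c) h2
    · exact absurd (h.neg_unique (h.symm' x y ▸ a) b) h3

theorem not_claw {c x y z : S} (hx : signed e c x ≠ 0) (hy : signed e c y ≠ 0)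
    (hz : signed e c z ≠ 0) (nxy : x ≠ y) (nxz : x ≠ z) (nyz : y ≠ z) (hxy : signed e x y = 0)
    (hxz : signed e x z = 0) (hyz : signed e y z = 0) : False := by
  have he := h.toIsCode
  refine h.elim (P := seeds[1]) (List.getElem_mem _) [c, x, y, z] ?_
    ⟨?_, ?_, ?_, ?_, trivial⟩
  · simp [ne_of_signed hx, ne_of_signed hy, ne_of_signed hz, nxy, nxz, nyz]
  · exact .cons (mem_nonzero he hx) (.cons (mem_nonzero he hy) (.cons (mem_nonzero he hz) .nil))
  · exact .cons (mem_zero he nxy hxy) (.cons (mem_zero he nxz hxz) .nil)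
  · exact .cons (mem_zero he nyz hyz) .nil
  · exact .nil

theorem not_diamond {a b c d : S} (hab : signed e a b ≠ 0) (hac : signed e a c ≠ 0)
    (hbc : signed e b c ≠ 0) (hbd : signed e b d ≠ 0) (hcd : signed e c d ≠ 0) (nad : a ≠ d)
    (had : signed e a d = 0) : False := by
  have he := h.toIsCode
  refine h.elim (P := seeds[2]) (List.getElem_mem _) [a, b, c, d] ?_
    ⟨?_, ?_, ?_, ?_, trivial⟩
  · simp [ne_of_signed hab, ne_of_signed hac, ne_of_signed hbc, ne_of_signed hbd,
      ne_of_signed hcd, nad]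
  · exact .cons (mem_one he (h.triangle hab hbc hac))
      (.cons (mem_one he (h.triangle hac (h.symm_ne hbc) hab)) (.cons (mem_zero he nad had) .nil))
  · exact .cons (mem_one he (h.triangle hbc hcd hbd))
      (.cons (mem_one he (h.triangle hbd (h.symm_ne hcd) hbc)) .nil)
  · exact .cons (mem_one he (h.triangle hcd (h.symm_ne hbd) (h.symm_ne hbc))) .nil
  · exact .nil

/-- A negative edge lies in no triangle, so the chords `xb` and `ay` are absent automatically. The
pair `xy` is free, which also covers the four-cycle. -/
theorem not_path_neg {x a b y : S} (hxa : signed e x a ≠ 0) (hab : signed e a b = -1)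
    (hby : signed e b y ≠ 0) (nxb : x ≠ b) (nay : a ≠ y) (nxy : x ≠ y) : False := by
  have he := h.toIsCode
  have hab' : signed e a b ≠ 0 := by rw [hab]; decide
  have hxb : signed e x b = 0 := by
    by_contra hxb
    have := h.triangle hab' (h.symm_ne hxb) (h.symm_ne hxa)
    omega
  have hay : signed e a y = 0 := by
    by_contra hay
    have := h.triangle hab' hby hay
    omega
  refine h.elim (P := seeds[3]) (List.getElem_mem _) [x, a, b, y] ?_
    ⟨?_, ?_, ?_, ?_, trivial⟩
  · simp [ne_of_signed hxa, ne_of_signed hab', ne_of_signed hby, nxb, nay, nxy]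
  · exact .cons (mem_nonzero he hxa) (.cons (mem_zero he nxb hxb) (.cons (mem_any he _ _) .nil))
  · exact .cons (mem_neg_one he hab) (.cons (mem_zero he nay hay) .nil)
  · exact .cons (mem_nonzero he hby) .nil
  · exact .nil

theorem not_cycle {w x y z : S} (hwx : signed e w x ≠ 0) (hxy : signed e x y ≠ 0)
    (hyz : signed e y z ≠ 0) (hwz : signed e w z ≠ 0) (nwy : w ≠ y) (nxz : x ≠ z)
    (hwy : signed e w y = 0) (hxz : signed e x z = 0) : False := by
  have he := h.toIsCode
  refine h.elim (P := seeds[4]) (List.getElem_mem _) [w, x, y, z] ?_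
    ⟨?_, ?_, ?_, ?_, trivial⟩
  · simp [ne_of_signed hwx, ne_of_signed hxy, ne_of_signed hyz, ne_of_signed hwz, nwy, nxz]
  · exact .cons (mem_nonzero he hwx) (.cons (mem_zero he nwy hwy)
      (.cons (mem_nonzero he hwz) .nil))
  · exact .cons (mem_nonzero he hxy) (.cons (mem_zero he nxz hxz) .nil)
  · exact .cons (mem_nonzero he hyz) .nil
  · exact .nil

/-- The pair of ends is unrestricted in the seed, so that five-cycles are excluded together with
paths. -/
theorem not_path {x a b c y : S} (hxa : signed e x a ≠ 0) (hab : signed e a b ≠ 0)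
    (hbc : signed e b c ≠ 0) (hcy : signed e c y ≠ 0) (nxb : x ≠ b) (nxc : x ≠ c) (nxy : x ≠ y)
    (nac : a ≠ c) (nay : a ≠ y) (nby : b ≠ y) (hxb : signed e x b = 0) (hxc : signed e x c = 0)
    (hac : signed e a c = 0) (hay : signed e a y = 0) (hby : signed e b y = 0) : False := by
  have he := h.toIsCode
  refine h.elim (P := seeds[5]) (List.getElem_mem _) [x, a, b, c, y] ?_
    ⟨?_, ?_, ?_, ?_, ?_, trivial⟩
  · simp [ne_of_signed hxa, ne_of_signed hab, ne_of_signed hbc, ne_of_signed hcy, nxb, nxc, nxy,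
      nac, nay, nby]
  · exact .cons (mem_nonzero he hxa) (.cons (mem_zero he nxb hxb) (.cons (mem_zero he nxc hxc)
      (.cons (mem_any he _ _) .nil)))
  · exact .cons (mem_nonzero he hab) (.cons (mem_zero he nac hac) (.cons (mem_zero he nay hay)
      .nil))
  · exact .cons (mem_nonzero he hbc) (.cons (mem_zero he nby hby) .nil)
  · exact .cons (mem_nonzero he hcy) .nil
  · exact .nil

theorem not_butterfly {a b c x y : S} (hab : signed e a b ≠ 0) (hac : signed e a c ≠ 0)
    (hbc : signed e b c ≠ 0) (hax : signed e a x ≠ 0) (hay : signed e a y ≠ 0)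
    (hxy : signed e x y ≠ 0) (nbx : b ≠ x) (nby : b ≠ y) (ncx : c ≠ x) (ncy : c ≠ y)
    (hbx : signed e b x = 0) (hby : signed e b y = 0) (hcx : signed e c x = 0)
    (hcy : signed e c y = 0) : False := by
  have he := h.toIsCode
  refine h.elim (P := seeds[6]) (List.getElem_mem _) [a, b, c, x, y] ?_
    ⟨?_, ?_, ?_, ?_, ?_, trivial⟩
  · simp [ne_of_signed hab, ne_of_signed hac, ne_of_signed hbc, ne_of_signed hax,
      ne_of_signed hay, ne_of_signed hxy, nbx, nby, ncx, ncy]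
  · exact .cons (mem_one he (h.triangle hab hbc hac))
      (.cons (mem_one he (h.triangle hac (h.symm_ne hbc) hab))
      (.cons (mem_one he (h.triangle hax hxy hay))
      (.cons (mem_one he (h.triangle hay (h.symm_ne hxy) hax)) .nil)))
  · exact .cons (mem_one he (h.triangle hbc (h.symm_ne hac) (h.symm_ne hab)))
      (.cons (mem_zero he nbx hbx) (.cons (mem_zero he nby hby) .nil))
  · exact .cons (mem_zero he ncx hcx) (.cons (mem_zero he ncy hcy) .nil)
  · exact .cons (mem_one he (h.triangle hxy (h.symm_ne hay) (h.symm_ne hax))) .nil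
  · exact .nil

theorem not_lollipop {a b c x y : S} (hab : signed e a b ≠ 0) (hac : signed e a c ≠ 0)
    (hbc : signed e b c ≠ 0) (hax : signed e a x ≠ 0) (hxy : signed e x y ≠ 0)
    (nbx : b ≠ x) (nby : b ≠ y) (ncx : c ≠ x) (ncy : c ≠ y) (nay : a ≠ y)
    (hbx : signed e b x = 0) (hby : signed e b y = 0) (hcx : signed e c x = 0)
    (hcy : signed e c y = 0) (hay : signed e a y = 0) : False := by
  have he := h.toIsCode
  refine h.elim (P := seeds[7]) (List.getElem_mem _) [b, c, a, x, y] ?_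
    ⟨?_, ?_, ?_, ?_, ?_, trivial⟩
  · simp [(ne_of_signed hab).symm, (ne_of_signed hac).symm, ne_of_signed hbc, ne_of_signed hax,
      ne_of_signed hxy, nbx, nby, ncx, ncy, nay]
  · exact .cons (mem_one he (h.triangle hbc (h.symm_ne hac) (h.symm_ne hab)))
      (.cons (mem_one he (h.triangle (h.symm_ne hab) hac hbc))
      (.cons (mem_zero he nbx hbx) (.cons (mem_zero he nby hby) .nil)))
  · exact .cons (mem_one he (h.triangle (h.symm_ne hac) hab (h.symm_ne hbc)))
      (.cons (mem_zero he ncx hcx) (.cons (mem_zero he ncy hcy) .nil))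
  · exact .cons (mem_nonzero he hax) (.cons (mem_zero he nay hay) .nil)
  · exact .cons (mem_nonzero he hxy) .nil
  · exact .nil

/-- The clique spanned by an edge `ab`: the vertices `a`, `b` and their common neighbours. -/
def span (e : S → S → ℕ) (a b : S) : Set S :=
  {z | z = a ∨ z = b ∨ (signed e a z ≠ 0 ∧ signed e b z ≠ 0)}

/-- Two non-adjacent common neighbours of `a` and `b` would form a diamond with them. -/
theorem span_adj {a b : S} (hab : signed e a b ≠ 0) {u v : S} (hu : u ∈ span e a b)
    (hv : v ∈ span e a b) (huv : u ≠ v) : signed e u v ≠ 0 := by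
  rcases hu with rfl | rfl | ⟨h1, h2⟩ <;> rcases hv with rfl | rfl | ⟨h3, h4⟩
  · exact absurd rfl huv
  · exact hab
  · exact h3
  · exact h.symm_ne hab
  · exact absurd rfl huv
  · exact h4
  · exact h.symm_ne h1
  · exact h.symm_ne h2
  · intro h0
    exact h.not_diamond (h.symm_ne h1) (h.symm_ne h2) hab h3 h4 huv h0

/-- An outside vertex misses `a` or `b`. If it had two neighbours in the clique, it would form a
diamond with two of its neighbours there and a missed vertex. -/
theorem span_unique {a b : S} (hab : signed e a b ≠ 0) {x u v : S} (hx : x ∉ span e a b)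
    (hu : u ∈ span e a b) (hv : v ∈ span e a b) (hxu : signed e x u ≠ 0)
    (hxv : signed e x v ≠ 0) : u = v := by
  by_contra huv
  have key : ∀ {a b : S}, signed e a b ≠ 0 → x ∉ span e a b → ∀ z ∈ span e a b, z ≠ a →
      signed e x a ≠ 0 → signed e x z ≠ 0 → False := by
    intro a b hab hx z hz hza hxa hxz
    simp only [span, Set.mem_ofPred_eq, not_or, not_and, not_not] at hx
    have hxb : signed e x b = 0 := by
      rw [h.symm']; exact hx.2.2 (h.symm_ne hxa)
    rcases hz with rfl | rfl | ⟨h3, h4⟩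
    · exact hza rfl
    · exact hxz hxb
    · exact h.not_diamond hxa hxz h3 hab (h.symm_ne h4) hx.2.1 hxb
  have hxa : signed e x a = 0 := by
    by_contra hxa
    by_cases hua : u = a
    · exact key hab hx v hv (fun hva => huv (hua.trans hva.symm)) hxa hxv
    · exact key hab hx u hu hua hxa hxu
  have hau : a ≠ u := by rintro rfl; exact hxu hxa
  have hav : a ≠ v := by rintro rfl; exact hxv hxa
  have ha : a ∈ span e a b := Or.inl rfl
  exact h.not_diamond hxu hxv (h.span_adj hab hu hv huv) (h.span_adj hab hu ha hau.symm)
    (h.span_adj hab hv ha hav.symm) (by rintro rfl; exact hx ha) hxa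

/-- The two local hypotheses say that the outside neighbours of the clique are pendant. By
connectedness nothing lies further away. -/
theorem isPendantClique_span
    (hconn : ∀ T : Set S, T.Nonempty → (∀ x ∉ T, ∀ y ∈ T, mval (e x y) = 0) → T = Set.univ)
    {a b : S} (hab : signed e a b = 1)
    (h1 : ∀ u ∈ span e a b, ∀ x ∉ span e a b, ∀ y ∉ span e a b, signed e u x ≠ 0 →
      signed e u y ≠ 0 → x = y)
    (h2 : ∀ u ∈ span e a b, ∀ x ∉ span e a b, ∀ y ∉ span e a b, signed e u x ≠ 0 →
      signed e x y = 0) :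
    IsPendantClique (signed e) (span e a b) := by
  have hab' : signed e a b ≠ 0 := by rw [hab]; decide
  have hcov : ∀ x, x ∈ span e a b ∨ ∃ u ∈ span e a b, signed e u x ≠ 0 := by
    have := hconn {x | x ∈ span e a b ∨ ∃ u ∈ span e a b, signed e u x ≠ 0}
      ⟨a, Or.inl (Or.inl rfl)⟩ ?_
    · exact Set.eq_univ_iff_forall.1 this
    · intro x hx y hy
      simp only [Set.mem_ofPred_eq, not_or, not_exists, not_and, not_not] at hx
      have hxy : x ≠ y := by
        rintro rfl
        rcases hy with hy | ⟨u, hu, hy⟩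
        · exact hx.1 hy
        · exact hy (hx.2 u hu)
      rw [← signed_of_ne hxy]
      by_cases hyU : y ∈ span e a b
      · rw [h.symm']; exact hx.2 y hyU
      · rcases hy with hy | ⟨u, hu, hy⟩
        · exact absurd hy hyU
        · rw [h.symm']; exact h2 u hu y hyU x hx.1 hy
  refine ⟨⟨a, Or.inl rfl, b, Or.inr (Or.inl rfl), ne_of_signed hab'⟩, ?_, h1, ?_, ?_⟩
  · intro u hu v hv huv
    -- A third clique vertex makes `uv` an edge of a positive triangle. Otherwise the clique is just
    -- the edge `ab`, which is positive by hypothesis.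
    by_cases hw : ∃ w ∈ span e a b, w ≠ u ∧ w ≠ v
    · obtain ⟨w, hw, hwu, hwv⟩ := hw
      exact h.triangle (h.span_adj hab' hu hv huv) (h.span_adj hab' hv hw hwv.symm)
        (h.span_adj hab' hu hw hwu.symm)
    · push Not at hw
      have ha := hw a (Or.inl rfl)
      have hb := hw b (Or.inr (Or.inl rfl))
      have hn := ne_of_signed hab'
      by_cases hau : a = u
      · subst hau
        rw [← hb hn.symm]; exact hab
      · rw [h.symm', ← ha hau, show u = b by
          by_contra hbu
          exact hn ((ha hau).trans (hb (Ne.symm hbu)).symm)]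
        exact hab
  · intro x hx y hy hxy
    rcases hcov x with hx' | ⟨u, hu, hx'⟩
    · exact absurd hx' hx
    · exact h2 u hu x hx y hy hx'
  · intro x hx u hu v hv
    exact h.span_unique hab' hx hu hv

end IsFree

/-- A connected good signed graph without representatives is obtained from a positive clique by
attaching pendant vertices, or has at most two vertices. -/
theorem IsFree.classify (h : IsFree e)
    (hconn : ∀ T : Set S, T.Nonempty → (∀ x ∉ T, ∀ y ∈ T, mval (e x y) = 0) → T = Set.univ) :
    (∃ U, IsPendantClique (signed e) U) ∨ Subsingleton S ∨
      ∃ x y, signed e x y = -1 ∧ ∀ z, z = x ∨ z = y := by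
  by_cases hpos : ∃ a b, signed e a b = 1
  · left
    by_cases htri : ∃ a b c, signed e a b ≠ 0 ∧ signed e b c ≠ 0 ∧ signed e a c ≠ 0
    · obtain ⟨a, b, c, hab, hbc, hac⟩ := htri
      -- Every clique vertex lies in a triangle of the clique. Two outside neighbours would then
      -- give a claw or a butterfly, and a path of length two leaving the clique a lollipop or a
      -- four-cycle.
      have hcard : ∀ u ∈ IsFree.span e a b, ∃ v ∈ IsFree.span e a b, ∃ w ∈ IsFree.span e a b,
          signed e u v ≠ 0 ∧ signed e u w ≠ 0 ∧ signed e v w ≠ 0 := by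
        have ha : a ∈ IsFree.span e a b := Or.inl rfl
        have hb : b ∈ IsFree.span e a b := Or.inr (Or.inl rfl)
        have hc : c ∈ IsFree.span e a b := Or.inr (Or.inr ⟨hac, hbc⟩)
        intro u hu
        by_cases hua : u = a
        · subst hua; exact ⟨b, hb, c, hc, hab, hac, hbc⟩
        by_cases hub : u = b
        · subst hub; exact ⟨a, ha, c, hc, h.symm_ne hab, hbc, hac⟩
        exact ⟨a, ha, b, hb, h.span_adj hab hu ha hua, h.span_adj hab hu hb hub, hab⟩
      have hz : ∀ u ∈ IsFree.span e a b, ∀ x ∉ IsFree.span e a b, signed e u x ≠ 0 →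
          ∀ v ∈ IsFree.span e a b, u ≠ v → signed e v x = 0 := by
        intro u hu x hx hux v hv huv
        by_contra hvx
        exact huv (h.span_unique hab hx hu hv (h.symm_ne hux) (h.symm_ne hvx))
      have hne : ∀ {v x}, v ∈ IsFree.span e a b → x ∉ IsFree.span e a b → v ≠ x := by
        rintro v x hv hx rfl; exact hx hv
      have h1 : ∀ u ∈ IsFree.span e a b, ∀ x ∉ IsFree.span e a b, ∀ y ∉ IsFree.span e a b,
          signed e u x ≠ 0 → signed e u y ≠ 0 → x = y := by
        intro u hu x hx y hy hux huy
        by_contra hxy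
        obtain ⟨v, hv, w, hw, huv, huw, hvw⟩ := hcard u hu
        have h1 := hz u hu x hx hux v hv (ne_of_signed huv)
        have h2 := hz u hu x hx hux w hw (ne_of_signed huw)
        have h3 := hz u hu y hy huy v hv (ne_of_signed huv)
        have h4 := hz u hu y hy huy w hw (ne_of_signed huw)
        by_cases h0 : signed e x y = 0
        · exact h.not_claw huv hux huy (hne hv hx) (hne hv hy) hxy h1 h3 h0
        · exact h.not_butterfly huv huw hvw hux huy h0 (hne hv hx) (hne hv hy) (hne hw hx)
            (hne hw hy) h1 h3 h2 h4
      refine ⟨_, h.isPendantClique_span hconn (h.triangle hab hbc hac) h1 ?_⟩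
      intro u hu x hx y hy hux
      by_contra hxy
      obtain ⟨v, hv, w, hw, huv, huw, hvw⟩ := hcard u hu
      have hn : ∀ t ∈ IsFree.span e a b, signed e t y = 0 := by
        intro t ht
        by_contra hty
        by_cases hut : u = t
        · subst hut
          exact ne_of_signed hxy (h1 u hu x hx y hy hux hty)
        · refine h.not_cycle (h.span_adj hab hu ht hut) hty (h.symm_ne hxy) hux (hne hu hy)
            (hne ht hx) ?_ (hz u hu x hx hux t ht hut)
          exact hz t ht y hy hty u hu (Ne.symm hut)
      exact h.not_lollipop huv huw hvw hux hxy (hne hv hx) (hne hv hy) (hne hw hx)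
        (hne hw hy) (hne hu hy) (hz u hu x hx hux v hv (ne_of_signed huv)) (hn v hv)
        (hz u hu x hx hux w hw (ne_of_signed huw)) (hn w hw) (hn u hu)
    · push Not at htri
      -- Without triangles and claws all degrees are at most two.
      have hdeg : ∀ {c x y z}, signed e c x ≠ 0 → signed e c y ≠ 0 → signed e c z ≠ 0 →
          x ≠ y → x ≠ z → y = z := by
        intro c x y z hx hy hz hxy hxz
        by_contra hyz
        have t : ∀ {x y}, signed e c x ≠ 0 → signed e c y ≠ 0 → signed e x y = 0 := by
          intro x y hx hy
          exact htri x c y (h.symm_ne hx) hy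
        exact h.not_claw hx hy hz hxy hxz hyz (t hx hy) (t hx hz) (t hy hz)
      have hspan : ∀ {a b z}, signed e a b ≠ 0 → z ∈ IsFree.span e a b → z = a ∨ z = b := by
        rintro a b z hab (rfl | rfl | ⟨h1, h2⟩)
        · exact Or.inl rfl
        · exact Or.inr rfl
        · exact absurd (htri a b z hab h2) h1
      have hout : ∀ {a b x y}, signed e a b = 1 → x ≠ b → signed e a x ≠ 0 → signed e x y ≠ 0 →
          y ≠ a → signed e y b = 0 := by
        intro a b x y hab hxb hax hxy hya
        by_contra hyb
        have hab' : signed e a b ≠ 0 := by rw [hab]; decide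
        exact h.not_cycle hab' (h.symm_ne hyb) (h.symm_ne hxy) hax hya.symm hxb.symm
          (htri a x y hax hxy) (htri b a x (h.symm_ne hab') hax)
      have final : ∀ a b, signed e a b = 1 →
          (∀ x y, signed e a x ≠ 0 → signed e x y ≠ 0 → x ≠ b → y ≠ a → y ≠ b → False) →
          (∀ x y, signed e b x ≠ 0 → signed e x y ≠ 0 → x ≠ a → y ≠ b → y ≠ a → False) →
          ∃ U, IsPendantClique (signed e) U := by
        intro a b hab ha hb
        have hab' : signed e a b ≠ 0 := by rw [hab]; decide
        have hn : ∀ {x}, x ∉ IsFree.span e a b → x ≠ a ∧ x ≠ b := by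
          intro x hx
          exact ⟨fun h => hx (Or.inl h), fun h => hx (Or.inr (Or.inl h))⟩
        refine ⟨_, h.isPendantClique_span hconn hab ?_ ?_⟩
        · intro u hu x hx y hy hux huy
          rcases hspan hab' hu with rfl | rfl
          · exact hdeg hab' hux huy (hn hx).2.symm (hn hy).2.symm
          · exact hdeg (h.symm_ne hab') hux huy (hn hx).1.symm (hn hy).1.symm
        · intro u hu x hx y hy hux
          by_contra hxy
          rcases hspan hab' hu with rfl | rfl
          · exact ha x y hux hxy (hn hx).2 (hn hy).1 (hn hy).2
          · exact hb x y hux hxy (hn hx).1 (hn hy).2 (hn hy).1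
      -- A positive edge with further neighbours at both ends is the right clique, since going two
      -- steps away from it would give a path or a cycle on five vertices.
      by_cases hgood : ∃ a b x z, signed e a b = 1 ∧ x ≠ b ∧ signed e a x ≠ 0 ∧ z ≠ a ∧
          signed e b z ≠ 0
      · obtain ⟨a, b, x, z, hab, hxb, hax, hza, hbz⟩ := hgood
        have key : ∀ {a b x z : S}, signed e a b = 1 → x ≠ b → signed e a x ≠ 0 → z ≠ a →
            signed e b z ≠ 0 → ∀ x y, signed e a x ≠ 0 → signed e x y ≠ 0 → x ≠ b → y ≠ a →
            y ≠ b → False := by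
          intro a b _ z hab _ _ hza hbz x y hax hxy hxb hya hyb
          have hab' : signed e a b ≠ 0 := by rw [hab]; decide
          have hxb0 : signed e x b = 0 := htri x a b (h.symm_ne hax) hab'
          have hxz : x ≠ z := by
            rintro rfl; exact hbz ((h.symm' _ _).trans hxb0)
          have hxz0 : signed e x z = 0 := by
            by_contra hxz0
            exact h.not_cycle (h.symm_ne hax) hab' hbz hxz0 hxb hza.symm hxb0
              (htri a b z hab' hbz)
          exact h.not_path (h.symm_ne hxy) (h.symm_ne hax) hab' hbz hya hyb
            (by rintro rfl; exact hxy hxz0) hxb hxz hza.symm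
            (h.symm' y a ▸ htri a x y hax hxy) (hout hab hxb hax hxy hya) hxb0 hxz0
            (htri a b z hab' hbz)
        exact final a b hab (key hab hxb hax hza hbz)
          (key (h.symm' a b ▸ hab) hza hbz hxb hax)
      · push Not at hgood
        obtain ⟨a, b, hab⟩ := hpos
        -- Now any positive edge serves. If `y`, `x`, `a`, `b` is a path, then `xa` would be a
        -- positive edge with further neighbours at both ends, or the negative middle edge of a
        -- forbidden path.
        have key : ∀ {a b : S}, signed e a b = 1 →
            ∀ x y, signed e a x ≠ 0 → signed e x y ≠ 0 → x ≠ b → y ≠ a → y ≠ b → False := by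
          intro a b hab x y hax hxy hxb hya hyb
          have hab' : signed e a b ≠ 0 := by rw [hab]; decide
          rcases signed_cases (e := e) x a with h0 | h0 | h0
          · exact hax ((h.symm' _ _).trans h0)
          · exact hab' (hgood x a y b h0 hya hxy hxb.symm)
          · exact h.not_path_neg (h.symm_ne hxy) h0 hab' hya hxb hyb
        exact final a b hab (key hab) (key (h.symm' a b ▸ hab))
  · right
    push Not at hpos
    have hneg : ∀ {x y}, signed e x y ≠ 0 → signed e x y = -1 := by
      intro x y hxy
      rcases signed_cases (e := e) x y with h0 | h0 | h0
      · exact absurd h0 hxy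
      · exact absurd h0 (hpos x y)
      · exact h0
    by_cases hx : ∃ x y, signed e x y = -1
    · right
      obtain ⟨x, y, hxy⟩ := hx
      refine ⟨x, y, hxy, ?_⟩
      have := hconn {z | z = x ∨ z = y} ⟨x, Or.inl rfl⟩ ?_
      · exact Set.eq_univ_iff_forall.1 this
      · intro z hz w hw
        simp only [Set.mem_ofPred_eq, not_or] at hz
        by_contra hzw
        rcases hw with rfl | rfl
        · rw [← signed_of_ne hz.1, h.symm'] at hzw
          exact hz.2 (h.neg_unique (hneg hzw) hxy)
        · rw [← signed_of_ne hz.2, h.symm'] at hzw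
          exact hz.1 (h.neg_unique (hneg hzw) (h.symm' x w ▸ hxy))
    · left
      push Not at hx
      refine ⟨fun x y => ?_⟩
      by_contra hxy
      have := hconn {x} ⟨x, rfl⟩ ?_
      · exact hxy (Set.eq_univ_iff_forall.1 this y).symm
      · rintro z hz w rfl
        rw [← signed_of_ne hz]
        by_contra h0
        exact hx _ _ (hneg h0)

end

end SignedCode

/-! ### The target codes -/

namespace SignedCode

/-- The codes of the maximal irreducible graphs with at least four slim vertices. -/
def targets : List (List (List ℕ)) :=
  [[[3, 3, 2], [2, 3], [2], []],
   [[1, 3, 0], [0, 2], [1], []],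
   [[1, 0, 2, 0], [1, 0, 0], [0, 2], [1], []],
   [[1, 0, 3, 2], [1, 0, 0], [1, 0], [2], []],
   [[1, 1, 0, 2], [1, 1, 0], [1, 0], [1], []],
   [[1, 1, 1, 1, 1], [1, 0, 0, 1], [1, 0, 0], [1, 0], [1], []],
   [[1, 1, 1, 1, 1], [1, 3, 0, 1], [1, 0, 0], [1, 0], [1], []],
   [[1, 1, 1, 1, 1], [1, 3, 0, 1], [1, 3, 0], [1, 0], [1], []],
   [[0, 1, 1, 1, 1], [0, 1, 1, 0], [1, 0, 0], [1, 0], [1], []],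
   [[3, 1, 1, 1, 1], [0, 1, 1, 0], [1, 0, 0], [1, 0], [1], []],
   [[3, 1, 1, 1, 1], [0, 1, 1, 0], [1, 3, 0], [1, 0], [1], []],
   [[3, 1, 1, 1, 1], [0, 1, 1, 0], [1, 3, 0], [1, 3], [1], []],
   [[0, 1, 1, 1, 1], [3, 1, 1, 0], [1, 0, 0], [1, 0], [1], []],
   [[0, 1, 1, 1, 1], [3, 1, 1, 0], [1, 0, 0], [1, 3], [1], []],
   [[0, 1, 1, 1, 1], [3, 1, 1, 3], [1, 0, 3], [1, 0], [1], []],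
   [[1, 1, 0, 0, 0], [1, 0, 0, 0], [1, 1, 1], [1, 1], [1], []],
   [[1, 1, 3, 0, 0], [1, 0, 0, 0], [1, 1, 1], [1, 1], [1], []],
   [[1, 1, 3, 0, 0], [1, 0, 3, 0], [1, 1, 1], [1, 1], [1], []]]

def embeds (C R : List (List ℕ)) : Bool := !(isos C.length (look C) R).isEmpty

/-- The three codes put in front are the small exceptions of `IsFree.classify`: no vertex, one
vertex, and a negative edge. -/
theorem reps_embed :
    (([[], [[]], [[2], []]] ++ reps).all fun R => targets.any fun C => embeds C R) = true := by
  decide +kernel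

/-- The targets form an antichain, which gives both their maximality and their non-isomorphism. -/
theorem targets_not_embed :
    ((List.range 18).all fun i => (List.range 18).all fun j => Nat.beq i j ||
      !embeds (targets.getD j []) (targets.getD i [])) = true := by
  decide +kernel

def entryAt (C : List (List ℕ)) (i j : ℕ) : ℤ := if Nat.beq i j then 0 else mval (look C i j)

/-- The clique of a pendant clique is recovered from any two of its vertices: it consists of them
and their common positive neighbours. Hence one candidate per positive edge has to be tested. -/
def inSpan (C : List (List ℕ)) (i j k : ℕ) : Bool :=
  Nat.beq k i || Nat.beq k j || (entryAt C i k == 1 && entryAt C j k == 1)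

/-- Whether the vertices satisfying `U` do not form a clique with pendant vertices. -/
def notPendantClique (C : List (List ℕ)) (U : ℕ → Bool) : Bool :=
  (List.range C.length).any fun x => (List.range C.length).any fun y => !Nat.beq x y &&
    ((U x && U y && !(entryAt C x y == 1)) || (!U x && !U y && !(entryAt C x y == 0)) ||
      (List.range C.length).any fun z =>
        (U z && !U x && !U y && !(entryAt C z x == 0) && !(entryAt C z y == 0)) ||
        (!U z && U x && U y && !(entryAt C z x == 0) && !(entryAt C z y == 0)))

/-- Whether the signed graph is not obtained from a positive clique by attaching pendant
vertices. -/
def noPendantClique (C : List (List ℕ)) : Bool :=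
  (List.range C.length).all fun i => (List.range C.length).all fun j =>
    !(entryAt C i j == 1) || notPendantClique C (inSpan C i j)

/-- Whether every vertex but the last one is adjacent to a later one. -/
def linked : List (List ℕ) → Bool
  | v :: R => (R.isEmpty || !allZero v) && linked R
  | [] => true

theorem targets_noPendantClique : (targets.all fun C => noPendantClique C && linked C) = true := by
  decide +kernel

end SignedCode

/-! ### The matrix B and its smallest eigenvalue -/

namespace HoffmanGraph

variable {V : Type*} {W : Type*}

theorem mem_fatNbrs {H : HoffmanGraph V} {x f : V} :
    f ∈ H.fatNbrs x ↔ f ∈ H.fat ∧ H.graph.Adj x f := Iff.rfl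

theorem mem_slim {H : HoffmanGraph V} {x : V} : x ∈ H.slim ↔ x ∉ H.fat := Iff.rfl

open Classical in
/-- The entries of `B(H)`. -/
noncomputable def entry (H : HoffmanGraph V) (x y : V) : ℤ :=
  (if H.graph.Adj x y then 1 else 0) - (H.fatNbrs x ∩ H.fatNbrs y).ncard

theorem entry_symm (H : HoffmanGraph V) (x y : V) : H.entry x y = H.entry y x := by
  unfold entry; rw [Set.inter_comm, H.graph.adj_comm]

theorem entry_self (H : HoffmanGraph V) (x : V) : H.entry x x = -(H.fatNbrs x).ncard := by
  simp [entry]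

open Classical in
theorem B_apply [Fintype V] (H : HoffmanGraph V) (x y : H.slim) : H.B x y = H.entry x y := by
  have : (H.fatNbrs x ∩ H.fatNbrs y).ncard =
      (Finset.univ.filter fun f : H.fat => H.graph.Adj x f ∧ H.graph.Adj y f).card := by
    rw [← Set.ncard_coe_finset, ← Set.ncard_image_of_injective _ Subtype.val_injective]
    congr 1
    ext f
    constructor
    · rintro ⟨⟨h1, h2⟩, -, h3⟩
      exact ⟨⟨f, h1⟩, by simp [h2, h3], rfl⟩
    · rintro ⟨⟨f, h1⟩, h2, rfl⟩
      obtain ⟨h2, h3⟩ : H.graph.Adj x f ∧ H.graph.Adj y f := by simpa using h2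
      exact ⟨⟨h1, h2⟩, h1, h3⟩
  simp only [B, Matrix.sub_apply, slimAdj, Matrix.submatrix_apply, SimpleGraph.adjMatrix_apply,
    entry, this, Matrix.mul_apply, slimFatAdj, Matrix.transpose_apply]
  push_cast
  congr 1
  rw [Finset.card_filter]
  push_cast
  refine Finset.sum_congr rfl fun f _ => ?_
  by_cases h1 : H.graph.Adj x f <;> by_cases h2 : H.graph.Adj y f <;> simp [h1, h2]

/-- `B(H) + (1 + τ) I` is positive semidefinite. -/
def IsGood (H : HoffmanGraph V) [Fintype H.slim] : Prop :=
  IsPsd fun x y : H.slim => H.entry x y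

open Classical in
-- B is symmetric, and subtracting the scalar -1-τ shifts its spectrum; a symmetric matrix is
-- positive semidefinite iff its spectrum is nonnegative.
theorem le_lambdaMin_iff [Fintype V] (H : HoffmanGraph V) [inst : Fintype H.slim] :
    -1 - Real.goldenRatio ≤ H.lambdaMin ↔ H.IsGood := by
  obtain rfl : inst = Subtype.fintype (Membership.mem H.slim) := Subsingleton.elim _ _
  have hH : H.B.IsHermitian := by
    refine Matrix.IsHermitian.ext fun x y => ?_
    simp [B_apply, H.entry_symm x y]
  have hfin : (spectrum ℝ H.B).Finite := Matrix.finite_real_spectrum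
  have hpsd : (H.B - algebraMap ℝ _ (-1 - Real.goldenRatio)).PosSemidef ↔ H.IsGood := by
    rw [Matrix.posSemidef_iff_dotProduct_mulVec]
    have h1 : (H.B - algebraMap ℝ _ (-1 - Real.goldenRatio)).IsHermitian := by
      refine hH.sub ?_
      rw [Matrix.algebraMap_eq_diagonal]
      exact Matrix.isHermitian_diagonal _
    simp only [h1, true_and, IsGood, IsPsd]
    refine forall_congr' fun c => ?_
    have : star c ⬝ᵥ (H.B - algebraMap ℝ _ (-1 - Real.goldenRatio)).mulVec c =
        ∑ x, ∑ y, c x * c y * (H.entry x y : ℝ) + (1 + Real.goldenRatio) * ∑ x, c x ^ 2 := by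
      rw [Matrix.sub_mulVec, dotProduct_sub]
      have h2 : (star c ⬝ᵥ (algebraMap ℝ (Matrix H.slim H.slim ℝ)
          (-1 - Real.goldenRatio)).mulVec c) = (-1 - Real.goldenRatio) * ∑ x, c x ^ 2 := by
        rw [Matrix.algebraMap_eq_diagonal]
        simp only [dotProduct, Matrix.mulVec_diagonal, Finset.mul_sum]
        refine Finset.sum_congr rfl fun x _ => ?_
        simp; ring
      have h3 : star c ⬝ᵥ H.B.mulVec c = ∑ x, ∑ y, c x * c y * (H.entry x y : ℝ) := by
        simp only [dotProduct, Matrix.mulVec, Finset.mul_sum, B_apply]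
        refine Finset.sum_congr rfl fun x _ => Finset.sum_congr rfl fun y _ => ?_
        simp; ring
      rw [h2, h3]; ring
    rw [this]
  rw [← hpsd, lambdaMin, Matrix.posSemidef_iff_isHermitian_and_spectrum_nonneg,
    ← spectrum.sub_singleton_eq]
  have h1 : (H.B - algebraMap ℝ _ (-1 - Real.goldenRatio)).IsHermitian := by
    refine hH.sub ?_
    rw [Matrix.algebraMap_eq_diagonal]
    exact Matrix.isHermitian_diagonal _
  simp only [h1, true_and]
  constructor
  · rintro h _ ⟨s, hs, _, rfl, rfl⟩
    have := csInf_le hfin.bddBelow hs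
    simp only [Set.mem_ofPred_eq]
    linarith
  · intro h
    -- The spectrum may be empty, and then the infimum is 0, which exceeds -1-τ.
    rcases (spectrum ℝ H.B).eq_empty_or_nonempty with h0 | h0
    · rw [h0, Real.sInf_empty]
      linarith [Real.goldenRatio_pos]
    · refine le_csInf h0 fun s hs => ?_
      have : 0 ≤ s - (-1 - Real.goldenRatio) := h ⟨s, hs, _, rfl, rfl⟩
      linarith

end HoffmanGraph

/-! ### Semidefinite integer matrices shifted by 1+τ -/

section Psd

variable {S : Type*} {T : Type*} [Fintype S] [Fintype T]

open Real

/-- The quadratic form of `b + (1 + τ) I`. -/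
noncomputable def psdForm (b : S → S → ℤ) (c : S → ℝ) : ℝ :=
  ∑ x, ∑ y, c x * c y * b x y + (1 + goldenRatio) * ∑ x, c x ^ 2

theorem psdForm_extend (b : S → S → ℤ) {f : T → S} (hf : Function.Injective f) (c : T → ℝ) :
    psdForm b (Function.extend f c 0) = psdForm (fun x y => b (f x) (f y)) c := by
  have key : ∀ (F : S → ℝ) (G : T → ℝ), (∀ x, (∀ t, f t ≠ x) → F x = 0) →
      (∀ t, G t = F (f t)) → ∑ x, F x = ∑ t, G t := by
    intro F G h0 h1
    refine (Fintype.sum_of_injective f hf G F (fun x hx => h0 x fun t ht => hx ⟨t, ht⟩) h1).symm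
  have h0 : ∀ x, (∀ t, f t ≠ x) → Function.extend f c 0 x = 0 := fun x hx =>
    Function.extend_apply' _ _ _ fun ⟨t, ht⟩ => hx t ht
  unfold psdForm
  congr 1
  · refine key _ _ (fun x hx => by simp [h0 x hx]) fun t => ?_
    refine (key _ _ (fun x hx => by simp [h0 x hx]) fun s => ?_).symm
    simp [hf.extend_apply]
  · congr 1
    exact key _ _ (fun x hx => by simp [h0 x hx]) fun t => by simp [hf.extend_apply]

theorem IsPsd.comp {b : S → S → ℤ} (hb : IsPsd b) {f : T → S} (hf : Function.Injective f) :
    IsPsd fun x y => b (f x) (f y) := fun c => by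
  rw [← psdForm, ← psdForm_extend b hf]
  exact hb _

theorem IsPsd.congr {b b' : S → S → ℤ} (hb : IsPsd b) (h : ∀ x y, b x y = b' x y) : IsPsd b' := by
  have : b = b' := funext fun x => funext (h x)
  rwa [← this]

/-- A block diagonal form is nonnegative if its blocks are. -/
theorem isPsd_of_fibers {ι : Type*} [Fintype ι] [DecidableEq ι] {b : S → S → ℤ} (g : S → ι)
    (hg : ∀ x y, g x ≠ g y → b x y = 0)
    (h : ∀ i, ∀ c : S → ℝ, (∀ x, g x ≠ i → c x = 0) → 0 ≤ psdForm b c) : IsPsd b := by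
  intro c
  have key : psdForm b c = ∑ i, psdForm b fun x => if g x = i then c x else 0 := by
    have h1 : ∑ i, ∑ x, ∑ y, (if g x = i then c x else 0) * (if g y = i then c y else 0) * b x y
        = ∑ x, ∑ y, c x * c y * (b x y : ℝ) := by
      rw [Finset.sum_comm]
      refine Finset.sum_congr rfl fun x _ => ?_
      rw [Finset.sum_comm]
      refine Finset.sum_congr rfl fun y _ => ?_
      by_cases hxy : g x = g y
      · simp [hxy]
      · simp [hg x y hxy]
    have h2 : ∑ i, ∑ x, (if g x = i then c x else 0) ^ 2 = ∑ x, c x ^ 2 := by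
      rw [Finset.sum_comm]
      refine Finset.sum_congr rfl fun x _ => ?_
      simp
    simp only [psdForm, Finset.sum_add_distrib, ← Finset.mul_sum, h1, h2]
  rw [← psdForm, key]
  exact Finset.sum_nonneg fun i _ => h i _ fun x hx => by simp [hx]

/-- A block diagonal form is nonnegative if its blocks, given by injective maps, are. -/
theorem isPsd_of_cover {ι : Type*} [Fintype ι] [DecidableEq ι] {b : S → S → ℤ} (g : S → ι)
    (hg : ∀ x y, g x ≠ g y → b x y = 0) {T : ι → Type*} [∀ i, Fintype (T i)] (f : ∀ i, T i → S)
    (hf : ∀ i, Function.Injective (f i)) (hr : ∀ x, ∃ t, f (g x) t = x)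
    (h : ∀ i, IsPsd fun x y => b (f i x) (f i y)) : IsPsd b := by
  refine isPsd_of_fibers g hg fun i c hc => ?_
  have : c = Function.extend (f i) (c ∘ f i) 0 := by
    funext x
    by_cases hx : ∃ t, f i t = x
    · obtain ⟨t, rfl⟩ := hx
      rw [(hf i).extend_apply]; rfl
    · rw [Function.extend_apply' _ _ _ hx]
      refine hc x ?_
      rintro rfl
      exact hx (hr x)
  rw [this, psdForm_extend b (hf i)]
  exact h i _

/-- A diagonal entry -3 would become τ - 2 < 0. This bounds the number of fat neighbours of a slim
vertex by two. -/
theorem IsPsd.neg_two_le {b : S → S → ℤ} (hb : IsPsd b) (x : S) : -2 ≤ b x x := by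
  have h := hb.comp (f := fun _ : Fin 1 => x) (fun _ _ _ => Subsingleton.elim _ _) 1
  simp at h
  have := goldenRatio_lt
  by_contra hlt
  have : (b x x : ℝ) ≤ -3 := by exact_mod_cast (by omega : b x x ≤ -3)
  linarith

variable {b : S → S → ℤ}

theorem IsPsd.two (hb : IsPsd b) {x y : S} (hxy : x ≠ y) (s t : ℝ) :
    0 ≤ s ^ 2 * (b x x + 1 + goldenRatio) + t ^ 2 * (b y y + 1 + goldenRatio) +
      s * t * (b x y + b y x) := by
  have h := hb.comp (f := ![x, y]) (by
    intro i j; fin_cases i <;> fin_cases j <;> simp [hxy, hxy.symm]) ![s, t]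
  simp [Fin.sum_univ_two] at h
  linarith

theorem IsPsd.three (hb : IsPsd b) {x y z : S} (hxy : x ≠ y) (hxz : x ≠ z) (hyz : y ≠ z)
    (s t u : ℝ) :
    0 ≤ s ^ 2 * (b x x + 1 + goldenRatio) + t ^ 2 * (b y y + 1 + goldenRatio) +
      u ^ 2 * (b z z + 1 + goldenRatio) + s * t * (b x y + b y x) + s * u * (b x z + b z x) +
      t * u * (b y z + b z y) := by
  have h := hb.comp (f := ![x, y, z]) (by
    intro i j; fin_cases i <;> fin_cases j <;>
      simp [hxy, hxy.symm, hxz, hxz.symm, hyz, hyz.symm]) ![s, t, u]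
  simp [Fin.sum_univ_three] at h
  linarith

/-- Both shifted diagonal entries are τ - 1 < 1, so the integer `b x y` has absolute value less than
one. -/
theorem IsPsd.eq_zero_of_two_two (hb : IsPsd b) (hs : ∀ x y, b x y = b y x) {x y : S}
    (hxy : x ≠ y) (hx : b x x = -2) (hy : b y y = -2) : b x y = 0 := by
  have h1 := hb.two hxy 1 1
  have h2 := hb.two hxy 1 (-1)
  rw [hx, hy, hs y x] at h1 h2
  have := goldenRatio_lt
  push_cast at h1 h2
  have h3 : (b x y : ℝ) < 1 := by linarith
  have h4 : (-1 : ℝ) < b x y := by linarith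
  have h5 : b x y < 1 := by exact_mod_cast h3
  have h6 : -1 < b x y := by exact_mod_cast h4
  omega

theorem eq_zero_of_add_mul_goldenRatio {p q : ℤ} (h : (p : ℝ) + q * goldenRatio = 0) :
    p = 0 ∧ q = 0 := by
  have hq : q = 0 := by
    by_contra hq
    refine goldenRatio_irrational.ne_rational (-p) q ?_
    have : (q : ℝ) ≠ 0 := by exact_mod_cast hq
    rw [eq_div_iff this]
    push_cast
    linarith
  subst hq
  simpa using h

/-- With ε = `b x y`, the block of `x` and `y` is [[τ-1, ε], [ε, τ]], of determinant τ² - τ - 1 = 0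
and with kernel vector (τ, -ε). Semidefiniteness forces τ `b x z` = ε `b y z`, and irrationality
makes both integers vanish. -/
theorem IsPsd.isolated (hb : IsPsd b) (hs : ∀ x y, b x y = b y x) {x y z : S} (hxy : x ≠ y)
    (hxz : x ≠ z) (hyz : y ≠ z) (hx : b x x = -2) (hy : b y y = -1)
    (h : b x y = 1 ∨ b x y = -1) : b x z = 0 ∧ b y z = 0 := by
  have hsq : (b x y : ℝ) * b x y = 1 := by
    rcases h with h | h <;> rw [h] <;> norm_num
  have hg := goldenRatio_sq
  have key : (-(b x y * b y z : ℤ) : ℝ) + (b x z : ℤ) * goldenRatio = 0 := by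
    have h1 : ∀ u : ℝ, 0 ≤ u ^ 2 * (b z z + 1 + goldenRatio) +
        2 * u * (-(b x y * b y z) + b x z * goldenRatio) := by
      intro u
      have := hb.three hxy hxz hyz goldenRatio (-(b x y)) u
      rw [hx, hy, hs y x, hs z x, hs z y] at this
      push_cast at this
      have e : goldenRatio ^ 2 * (-2 + 1 + goldenRatio) + (-(b x y : ℝ)) ^ 2 *
        (-1 + 1 + goldenRatio) + goldenRatio * -(b x y) * (b x y + b x y) = 0 := by
        linear_combination (goldenRatio - 2 * goldenRatio) * hsq + goldenRatio * hg
      linarith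
    set w : ℝ := -(b x y * b y z) + b x z * goldenRatio with hw
    set k : ℝ := b z z + 1 + goldenRatio with hk
    have hk0 : 0 < k := by
      have : (-2 : ℝ) ≤ b z z := by exact_mod_cast hb.neg_two_le z
      have := one_lt_goldenRatio
      linarith
    -- This value minimises u²k + 2uw; the minimum -w²/k is nonnegative only for w = 0.
    have h2 := h1 (-w / k)
    have h3 : (-w / k) ^ 2 * k + 2 * (-w / k) * w = -(w ^ 2 / k) := by field_simp; ring
    rw [h3] at h2
    have h4 : w ^ 2 / k = 0 := le_antisymm (by linarith) (by positivity)
    have h5 : w = 0 := by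
      rcases div_eq_zero_iff.1 h4 with h5 | h5
      · exact pow_eq_zero_iff (two_ne_zero) |>.1 h5
      · exact absurd h5 hk0.ne'
    rw [← h5, hw]; push_cast; ring
  have := eq_zero_of_add_mul_goldenRatio (p := -(b x y * b y z)) (q := b x z) (by
    push_cast at key ⊢; linarith)
  refine ⟨this.2, ?_⟩
  rcases h with h | h <;> rw [h] at this <;> omega

end Psd

theorem lt_goldenRatio : (1.618 : ℝ) < Real.goldenRatio := by
  have : (2.236 : ℝ) < √5 := by
    rw [Real.lt_sqrt (by norm_num)]; norm_num
  unfold Real.goldenRatio; linarith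

/-! ### Sum-of-squares certificates for the special graphs of the targets -/

section SumsOfSquares

open Real

local notation "τ" => goldenRatio

theorem isPsd_matrix₀ : IsPsd (S := Fin 4) ![![-1, 0, 0, -1], ![0, -1, -1, 0], ![0, -1, -1, -1],
  ![-1, 0, -1, -1]] := by
  intro c
  have hτ := goldenRatio_sq
  have h0 := goldenRatio_pos
  have h1 : (1.618 : ℝ) < τ := lt_goldenRatio
  have h2 := goldenRatio_lt
  -- Completing squares over ℚ(τ), after the shift has made every diagonal entry τ. The two sides
  -- agree modulo τ² = τ + 1, and the final combination supplies the multiple of this relation.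
  -- Fewer squares than variables mean that the form is degenerate. The other certificates are of
  -- the same kind.
  refine le_of_le_of_eq (b := τ * (c 0 + (1 - τ) * c 3) ^ 2 + τ * (c 1 + (1 - τ) * c 2) ^ 2 + 1 *
    (c 2 + (-1) * c 3) ^ 2) (by positivity) ?_
  simp [Fin.sum_univ_succ]
  linear_combination -(2 * (c 0 * c 3) + 2 * (c 1 * c 2) + (1 + (-1) * τ) * (c 2 * c 2) + (1 +
    (-1) * τ) * (c 3 * c 3)) * hτ

theorem isPsd_matrix₁ : IsPsd (S := Fin 4) ![![-1, 1, 0, 0], ![1, -1, 0, -1], ![0, 0, -1, 1], ![0,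
  -1, 1, -1]] := by
  intro c
  have hτ := goldenRatio_sq
  have h0 := goldenRatio_pos
  have h1 : (1.618 : ℝ) < τ := lt_goldenRatio
  have h2 := goldenRatio_lt
  refine le_of_le_of_eq (b := τ * (c 0 + (-1 + τ) * c 1) ^ 2 + 1 * (c 1 + (-1) * c 3) ^ 2 + τ * (c
    2 + (-1 + τ) * c 3) ^ 2) (by positivity) ?_
  simp [Fin.sum_univ_succ]
  linear_combination -(((-2)) * (c 0 * c 1) + (1 + (-1) * τ) * (c 1 * c 1) + ((-2)) * (c 2 * c 3)
    + (1 + (-1) * τ) * (c 3 * c 3)) * hτ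

theorem isPsd_matrix₂ : IsPsd (S := Fin 5) ![![-1, 1, 0, -1, 0], ![1, -1, 1, 0, 0], ![0, 1, -1, 0,
  -1], ![-1, 0, 0, -1, 1], ![0, 0, -1, 1, -1]] := by
  intro c
  have hτ := goldenRatio_sq
  have h0 := goldenRatio_pos
  have h1 : (1.618 : ℝ) < τ := lt_goldenRatio
  have h2 := goldenRatio_lt
  have d0 : 0 ≤ -1 + τ := by linarith
  refine le_of_le_of_eq (b := τ * (c 0 + (-1 + τ) * c 1 + (1 - τ) * c 3) ^ 2 + 1 * (c 1 + c 2 +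
    (-1 + τ) * c 3) ^ 2 + (-1 + τ) * (c 2 + (-1) * c 3 + (-τ) * c 4) ^ 2) (by positivity) ?_
  simp [Fin.sum_univ_succ]
  linear_combination -(((-2)) * (c 0 * c 1) + 2 * (c 0 * c 3) + (1 + (-1) * τ) * (c 1 * c 1) +
    ((-2) + 2 * τ) * (c 1 * c 3) + 2 * (c 2 * c 4) + ((-1) * τ) * (c 3 * c 3) + ((-2)) * (c 3 * c
    4) + ((-1) * τ) * (c 4 * c 4)) * hτ

theorem isPsd_matrix₃ : IsPsd (S := Fin 5) ![![-1, 1, 0, 0, -1], ![1, -1, 1, 0, 0], ![0, 1, -1, 1,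
  0], ![0, 0, 1, -1, -1], ![-1, 0, 0, -1, -1]] := by
  intro c
  have hτ := goldenRatio_sq
  have h0 := goldenRatio_pos
  have h1 : (1.618 : ℝ) < τ := lt_goldenRatio
  have h2 := goldenRatio_lt
  have d0 : 0 ≤ -1 + τ := by linarith
  refine le_of_le_of_eq (b := τ * (c 0 + (-1 + τ) * c 1 + (1 - τ) * c 4) ^ 2 + 1 * (c 1 + c 2 +
    (-1 + τ) * c 4) ^ 2 + (-1 + τ) * (c 2 + τ * c 3 + (-1) * c 4) ^ 2) (by positivity) ?_
  simp [Fin.sum_univ_succ]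
  linear_combination -(((-2)) * (c 0 * c 1) + 2 * (c 0 * c 4) + (1 + (-1) * τ) * (c 1 * c 1) +
    ((-2) + 2 * τ) * (c 1 * c 4) + ((-2)) * (c 2 * c 3) + ((-1) * τ) * (c 3 * c 3) + 2 * (c 3 * c
    4) + ((-1) * τ) * (c 4 * c 4)) * hτ

theorem isPsd_matrix₄ : IsPsd (S := Fin 5) ![![-1, 1, 1, 0, -1], ![1, -1, 1, 1, 0], ![1, 1, -1, 1,
  0], ![0, 1, 1, -1, 1], ![-1, 0, 0, 1, -1]] := by
  intro c
  have hτ := goldenRatio_sq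
  have h0 := goldenRatio_pos
  have h1 : (1.618 : ℝ) < τ := lt_goldenRatio
  have h2 := goldenRatio_lt
  have d0 : 0 ≤ -4 + 3 * τ := by linarith
  have d1 : 0 ≤ -4/5 + 3/5 * τ := by linarith
  have d2 : 0 ≤ 2 - τ := by linarith
  refine le_of_le_of_eq (b := τ * (c 0 + (-1 + τ) * c 1 + (-1 + τ) * c 2 + (1 - τ) * c 4) ^ 2 + 1
    * (c 1 + (2 - τ) * c 2 + c 3 + (-1 + τ) * c 4) ^ 2 + (-4 + 3 * τ) * (c 2 + (2/5 + 1/5 * τ) * c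
    3 + (-1/5 + 2/5 * τ) * c 4) ^ 2 + (-4/5 + 3/5 * τ) * (c 3 + (-1 + τ) * c 4) ^ 2 + (2 - τ) * (c
    4) ^ 2) (by positivity) ?_
  simp [Fin.sum_univ_succ]
  linear_combination -(((-2)) * (c 0 * c 1) + ((-2)) * (c 0 * c 2) + 2 * (c 0 * c 4) + (1 + (-1) *
    τ) * (c 1 * c 1) + (2 + (-2) * τ) * (c 1 * c 2) + ((-2) + 2 * τ) * (c 1 * c 4) + ((-1) * τ) *
    (c 2 * c 2) + ((-6/5)) * (c 2 * c 3) + ((-12/5) + 2 * τ) * (c 2 * c 4) + ((-11/25) + (-3/25) *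
    τ) * (c 3 * c 3) + ((-44/25) + (-12/25) * τ) * (c 3 * c 4) + (51/25 + (-52/25) * τ) * (c 4 * c
    4)) * hτ

theorem isPsd_matrix₅ : IsPsd (S := Fin 6) ![![-1, 1, 1, 1, 1, 1], ![1, -1, 1, 0, 0, 1], ![1, 1,
  -1, 1, 0, 0], ![1, 0, 1, -1, 1, 0], ![1, 0, 0, 1, -1, 1], ![1, 1, 0, 0, 1, -1]] := by
  intro c
  have hτ := goldenRatio_sq
  have h0 := goldenRatio_pos
  have h1 : (1.618 : ℝ) < τ := lt_goldenRatio
  have h2 := goldenRatio_lt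
  have d0 : 0 ≤ -4 + 3 * τ := by linarith
  have d1 : 0 ≤ -4/5 + 3/5 * τ := by linarith
  refine le_of_le_of_eq (b := τ * (c 0 + (-1 + τ) * c 1 + (-1 + τ) * c 2 + (-1 + τ) * c 3 + (-1 +
    τ) * c 4 + (-1 + τ) * c 5) ^ 2 + 1 * (c 1 + (2 - τ) * c 2 + (1 - τ) * c 3 + (1 - τ) * c 4 + (2
    - τ) * c 5) ^ 2 + (-4 + 3 * τ) * (c 2 + (2/5 + 1/5 * τ) * c 3 + (1/5 - 2/5 * τ) * c 4 + (2/5 -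
    4/5 * τ) * c 5) ^ 2 + (-4/5 + 3/5 * τ) * (c 3 + τ * c 4 + c 5) ^ 2) (by positivity) ?_
  simp [Fin.sum_univ_succ]
  linear_combination -(((-2)) * (c 0 * c 1) + ((-2)) * (c 0 * c 2) + ((-2)) * (c 0 * c 3) + ((-2))
    * (c 0 * c 4) + ((-2)) * (c 0 * c 5) + (1 + (-1) * τ) * (c 1 * c 1) + (2 + (-2) * τ) * (c 1 *
    c 2) + (2 + (-2) * τ) * (c 1 * c 3) + (2 + (-2) * τ) * (c 1 * c 4) + (2 + (-2) * τ) * (c 1 * c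
    5) + ((-1) * τ) * (c 2 * c 2) + ((-6/5) + (-2) * τ) * (c 2 * c 3) + (12/5 + (-2) * τ) * (c 2 *
    c 4) + (24/5 + (-2) * τ) * (c 2 * c 5) + ((-11/25) + (-28/25) * τ) * (c 3 * c 3) + ((-16/25) +
    (-38/25) * τ) * (c 3 * c 4) + (28/25 + (-26/25) * τ) * (c 3 * c 5) + (21/25 + (-52/25) * τ) *
    (c 4 * c 4) + (34/25 + (-98/25) * τ) * (c 4 * c 5) + (64/25 + (-73/25) * τ) * (c 5 * c 5)) *
    hτ

theorem isPsd_matrix₆ : IsPsd (S := Fin 6) ![![-1, 0, 1, 1, 1, 1], ![0, -1, 0, 1, 1, 0], ![1, 0,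
  -1, 1, 0, 0], ![1, 1, 1, -1, 1, 0], ![1, 1, 0, 1, -1, 1], ![1, 0, 0, 0, 1, -1]] := by
  intro c
  have hτ := goldenRatio_sq
  have h0 := goldenRatio_pos
  have h1 : (1.618 : ℝ) < τ := lt_goldenRatio
  have h2 := goldenRatio_lt
  have d0 : 0 ≤ -3 + 2 * τ := by linarith
  refine le_of_le_of_eq (b := τ * (c 0 + (-1 + τ) * c 2 + (-1 + τ) * c 3 + (-1 + τ) * c 4 + (-1 +
    τ) * c 5) ^ 2 + τ * (c 1 + (-1 + τ) * c 3 + (-1 + τ) * c 4) ^ 2 + 1 * (c 2 + (2 - τ) * c 3 +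
    (1 - τ) * c 4 + (1 - τ) * c 5) ^ 2 + (-3 + 2 * τ) * (c 3 + (-τ) * c 5) ^ 2) (by positivity) ?_
  simp [Fin.sum_univ_succ]
  linear_combination -(((-2)) * (c 0 * c 2) + ((-2)) * (c 0 * c 3) + ((-2)) * (c 0 * c 4) + ((-2))
    * (c 0 * c 5) + ((-2)) * (c 1 * c 3) + ((-2)) * (c 1 * c 4) + (1 + (-1) * τ) * (c 2 * c 2) +
    (2 + (-2) * τ) * (c 2 * c 3) + (2 + (-2) * τ) * (c 2 * c 4) + (2 + (-2) * τ) * (c 2 * c 5) +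
    (1 + (-2) * τ) * (c 3 * c 3) + (2 + (-4) * τ) * (c 3 * c 4) + (4 + (-2) * τ) * (c 3 * c 5) +
    (1 + (-2) * τ) * (c 4 * c 4) + ((-2) * τ) * (c 4 * c 5) + (1 + (-3) * τ) * (c 5 * c 5)) * hτ

theorem isPsd_matrix₇ : IsPsd (S := Fin 6) ![![-1, 1, 1, 0, 0, 0], ![1, -1, 1, 0, 0, 0], ![1, 1,
  -1, 1, 1, 1], ![0, 0, 1, -1, 1, 1], ![0, 0, 1, 1, -1, 1], ![0, 0, 1, 1, 1, -1]] := by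
  intro c
  have hτ := goldenRatio_sq
  have h0 := goldenRatio_pos
  have h1 : (1.618 : ℝ) < τ := lt_goldenRatio
  have h2 := goldenRatio_lt
  have d0 : 0 ≤ -4 + 3 * τ := by linarith
  have d1 : 0 ≤ -1/5 + 2/5 * τ := by linarith
  have d2 : 0 ≤ 2 - τ := by linarith
  have d3 : 0 ≤ -3 + 2 * τ := by linarith
  refine le_of_le_of_eq (b := τ * (c 0 + (-1 + τ) * c 1 + (-1 + τ) * c 2) ^ 2 + 1 * (c 1 + (2 - τ)
    * c 2) ^ 2 + (-4 + 3 * τ) * (c 2 + (1/5 + 3/5 * τ) * c 3 + (1/5 + 3/5 * τ) * c 4 + (1/5 + 3/5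
    * τ) * c 5) ^ 2 + (-1/5 + 2/5 * τ) * (c 3 + (-2 + τ) * c 4 + (-2 + τ) * c 5) ^ 2 + (2 - τ) *
    (c 4 + (1 - τ) * c 5) ^ 2 + (-3 + 2 * τ) * (c 5) ^ 2) (by positivity) ?_
  simp [Fin.sum_univ_succ]
  linear_combination -(((-2)) * (c 0 * c 1) + ((-2)) * (c 0 * c 2) + (1 + (-1) * τ) * (c 1 * c 1)
    + (2 + (-2) * τ) * (c 1 * c 2) + ((-1) * τ) * (c 2 * c 2) + ((-18/5)) * (c 2 * c 3) +
    ((-18/5)) * (c 2 * c 4) + ((-18/5)) * (c 2 * c 5) + ((-9/25) + (-27/25) * τ) * (c 3 * c 3) +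
    ((-38/25) + (-54/25) * τ) * (c 3 * c 4) + ((-38/25) + (-54/25) * τ) * (c 3 * c 5) + (26/25 +
    (-37/25) * τ) * (c 4 * c 4) + (2/25 + (-74/25) * τ) * (c 4 * c 5) + ((-49/25) + (-12/25) * τ)
    * (c 5 * c 5)) * hτ

end SumsOfSquares

/-! ### Embedding connected good signed graphs into targets -/

namespace SignedCode

/-- The matrix `B` of the graph with code `C`. -/
def matrixOf (C : List (List ℕ)) (i j : Fin C.length) : ℤ :=
  if i = j then -1 else mval (look C i j)

theorem isPsd_matrixOf {n : ℕ} {M : Fin n → Fin n → ℤ} (hM : IsPsd M) {C : List (List ℕ)}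
    (hn : C.length = n)
    (h : ∀ i j : Fin n, M i j = if i = j then -1 else mval (look C i j)) :
    IsPsd (matrixOf C) := by
  subst hn
  exact hM.congr h

/-- Eight matrices suffice for 18 targets, because the codes 0 and 3 give the same entry: the
targets from the wheel share one matrix, and so do those from the 3-sun and those from the two
cliques. -/
theorem isPsd_target : ∀ C ∈ targets, IsPsd (matrixOf C) := by
  intro C hC
  simp only [targets, List.mem_cons, List.not_mem_nil, or_false] at hC
  rcases hC with rfl | rfl | rfl | rfl | rfl | rfl | rfl | rfl | rfl | rfl | rfl | rfl | rfl |
    rfl | rfl | rfl | rfl | rfl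
  · exact isPsd_matrixOf isPsd_matrix₀ rfl (by decide)
  · exact isPsd_matrixOf isPsd_matrix₁ rfl (by decide)
  · exact isPsd_matrixOf isPsd_matrix₂ rfl (by decide)
  · exact isPsd_matrixOf isPsd_matrix₃ rfl (by decide)
  · exact isPsd_matrixOf isPsd_matrix₄ rfl (by decide)
  iterate 3 · exact isPsd_matrixOf isPsd_matrix₅ rfl (by decide)
  iterate 7 · exact isPsd_matrixOf isPsd_matrix₆ rfl (by decide)
  iterate 3 · exact isPsd_matrixOf isPsd_matrix₇ rfl (by decide)

theorem code_eq_code {α β : Type*} {e : α → α → ℕ} {e' : β → β → ℕ} (d : α) (d' : β)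
    {l : List α} {m : List β} (h : code e l = code e' m) {i j : ℕ} (hij : i < j)
    (hj : j < l.length) :
    e (l.getD i d) (l.getD j d) = e' (m.getD i d') (m.getD j d') := by
  have hlen : l.length = m.length := by rw [← length_code e, h, length_code]
  rw [← getD_code e d l i j hij hj, h, getD_code e' d' m i j hij (hlen ▸ hj)]

theorem look_comm (C : List (List ℕ)) {i j : ℕ} (hij : i ≠ j) : look C i j = look C j i := by
  unfold look
  by_cases h : i < j
  · rw [if_pos (by simpa using h), if_neg (by simpa using h.le)]
  · rw [if_neg (by simpa using h), if_pos (by simpa using by omega)]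

section

variable {S : Type*} {e : S → S → ℕ}

/-- Induction from the end of the list: each vertex is attached to the connected graph on the later
ones. -/
theorem connected_of_linked (he : IsCode e) : ∀ {l : List S}, l.Nodup →
    linked (code e l) = true → ∀ T : Set S, (∃ x ∈ l, x ∈ T) →
      (∀ x ∈ l, x ∉ T → ∀ y ∈ l, y ∈ T → mval (e x y) = 0) → ∀ x ∈ l, x ∈ T
  | [], _, _, _, _, _, x, hx => by simp at hx
  | a :: l, hl, h, T, ⟨t, ht, htT⟩, hT, x, hx => by
      rw [List.nodup_cons] at hl
      simp only [code, linked, Bool.and_eq_true, Bool.or_eq_true, List.isEmpty_iff] at h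
      rcases h.1 with h0 | h0
      · have : l = [] := by
          cases l with
          | nil => rfl
          | cons => simp [code] at h0
        subst this
        simp only [List.mem_singleton] at hx ht
        rwa [hx, ← ht]
      · simp only [Bool.not_eq_true', ← Bool.not_eq_true, allZero_iff] at h0
        push Not at h0
        obtain ⟨c, hc, hc0, hc3⟩ := h0
        obtain ⟨b, hb, rfl⟩ := List.mem_map.1 hc
        have hab : mval (e a b) ≠ 0 := by
          have := he.lt a b
          generalize e a b = c at *
          interval_cases c <;> simp_all [mval]
        have ih : ∀ T : Set S, (∃ x ∈ l, x ∈ T) →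
            (∀ x ∈ l, x ∉ T → ∀ y ∈ l, y ∈ T → mval (e x y) = 0) → ∀ x ∈ l, x ∈ T :=
          connected_of_linked he hl.2 h.2
        have hl' : (∃ x ∈ l, x ∈ T) → ∀ x ∈ l, x ∈ T := fun hex =>
          ih T hex fun x hx hxT y hy => hT x (by simp [hx]) hxT y (by simp [hy])
        by_cases ha : a ∈ T
        · have hbT : b ∈ T := by
            by_contra hbT
            refine hab ?_
            rw [he.symm]
            exact hT b (by simp [hb]) hbT a (by simp) ha
          rcases List.mem_cons.1 hx with rfl | hx
          · exact ha
          · exact hl' ⟨b, hb, hbT⟩ x hx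
        · exfalso
          have htl : t ∈ l := by
            rcases List.mem_cons.1 ht with rfl | ht
            · exact absurd htT ha
            · exact ht
          exact hab (hT a (by simp) ha b (by simp [hb]) (hl' ⟨t, htl, htT⟩ b hb))

variable [DecidableEq S]

/-- A graph with a code whose matrix embeds into a code `C` is an induced subgraph. -/
theorem exists_embedding_of_embeds (he : IsCode e) {l : List S}
    (hmem : ∀ x, x ∈ l) {C : List (List ℕ)} (h : embeds C (code e l) = true) :
    ∃ φ : S → ℕ, Function.Injective φ ∧ (∀ x, φ x < C.length) ∧
      ∀ x y, x ≠ y → e x y = look C (φ x) (φ y) := by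
  simp only [embeds, Bool.not_eq_true', List.isEmpty_eq_false_iff_exists_mem, mem_isos] at h
  obtain ⟨idx, hnd, hlt, hc⟩ := h
  have hlen : idx.length = l.length := by rw [← length_code (look C), hc, length_code]
  have hpos : ∀ x, l.idxOf x < idx.length := fun x => by
    rw [hlen]; exact List.idxOf_lt_length_of_mem (hmem x)
  have hget : ∀ x, l.getD (l.idxOf x) x = x := fun x => by
    rw [List.getD_eq_getElem _ _ (hlen ▸ hpos x), List.getElem_idxOf]
  have hinj : Function.Injective l.idxOf := fun x y hxy =>
    (List.idxOf_inj (hmem x)).1 hxy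
  have key : ∀ x y, l.idxOf x < l.idxOf y →
      e x y = look C (idx.getD (l.idxOf x) 0) (idx.getD (l.idxOf y) 0) := fun x y hxy => by
    have := code_eq_code 0 x hc hxy (hpos y)
    rw [this, hget x]
    congr 1
    rw [List.getD_eq_getElem _ _ (hlen ▸ hpos y), List.getElem_idxOf]
  have hφ : Function.Injective fun x => idx.getD (l.idxOf x) 0 := fun x y hxy => by
    simp only [List.getD_eq_getElem _ _ (hpos _)] at hxy
    exact hinj (hnd.getElem_inj_iff.1 hxy)
  refine ⟨_, hφ, fun x => ?_, fun x y hxy => ?_⟩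
  · simp only [List.getD_eq_getElem _ _ (hpos x)]
    exact hlt _ (List.getElem_mem _)
  · rcases lt_trichotomy (l.idxOf x) (l.idxOf y) with h1 | h1 | h1
    · exact key x y h1
    · exact absurd (hinj h1) hxy
    · rw [he.symm, look_comm C fun h2 => hxy (hφ h2)]
      exact key y x h1

/-- A connected good signed graph not obtained from a positive clique by attaching pendant
vertices embeds into one of the target graphs. -/
theorem exists_target [Fintype S] (he : IsCode e) (hg : IsGood e)
    (hconn : ∀ T : Set S, T.Nonempty → (∀ x ∉ T, ∀ y ∈ T, mval (e x y) = 0) → T = Set.univ) :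
    (∃ U, IsPendantClique (signed e) U) ∨ ∃ C ∈ targets, ∃ φ : S → ℕ, Function.Injective φ ∧
      (∀ x, φ x < C.length) ∧ ∀ x y, x ≠ y → e x y = look C (φ x) (φ y) := by
  have key : ∀ l : List S, l.Nodup → (∀ x, x ∈ l) →
      code e l ∈ [[], [[]], [[2], []]] ++ reps → ∃ C ∈ targets, ∃ φ : S → ℕ,
      Function.Injective φ ∧ (∀ x, φ x < C.length) ∧
        ∀ x y, x ≠ y → e x y = look C (φ x) (φ y) := by
    intro l hl hmem h
    obtain ⟨C, hC, h⟩ := List.any_eq_true.1 (List.all_eq_true.1 reps_embed _ h)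
    exact ⟨C, hC, exists_embedding_of_embeds he hmem h⟩
  by_cases hf : ∃ m : List S, m.Nodup ∧ code e m ∈ reps
  · obtain ⟨m, h1, h2, h3⟩ := exists_rep_forall_mem hg he hconn hf
    exact Or.inr (key m h1 h3 (List.mem_append_right _ h2))
  · have hfree : IsFree e := { he with good := hg, free := hf }
    rcases hfree.classify hconn with h | h | ⟨x, y, hxy, h⟩
    · exact Or.inl h
    · right
      cases isEmpty_or_nonempty S with
      | inl _ => exact key [] List.nodup_nil (fun x => isEmptyElim x) (by simp [code])
      | inr hS =>
        obtain ⟨x⟩ := hS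
        exact key [x] (List.nodup_singleton x) (fun y => by simp [Subsingleton.elim y x])
          (by simp [code])
    · right
      have hne := ne_of_signed (e := e) (x := x) (y := y) (by rw [hxy]; decide)
      refine key [x, y] (by simp [hne]) (by simpa using h) ?_
      have := mem_neg_one he hxy
      simp only [List.mem_singleton] at this
      simp [code, this]

theorem entryAt_code (he : IsCode e) {l : List S} (hl : l.Nodup) (d : S) {i j : ℕ}
    (hi : i < l.length) (hj : j < l.length) :
    entryAt (code e l) i j = signed e (l.getD i d) (l.getD j d) := by
  unfold entryAt
  by_cases hij : i = j
  · subst hij; simp [signed_self]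
  · have hne : l.getD i d ≠ l.getD j d := by
      rw [List.getD_eq_getElem _ _ hi, List.getD_eq_getElem _ _ hj]
      exact fun h => hij (hl.getElem_inj_iff.1 h)
    rw [if_neg (by simpa using hij), signed_of_ne hne, look_code he d l hi hj hij]

theorem not_isPendantClique (he : IsCode e) {l : List S} (hl : l.Nodup) (hmem : ∀ x, x ∈ l)
    (h : noPendantClique (code e l) = true) (U : Set S) : ¬ IsPendantClique (signed e) U := by
  intro hU
  obtain ⟨u, hu, v, hv, huv⟩ := hU.nontrivial
  have hpos : ∀ x, l.idxOf x < l.length := fun x => List.idxOf_lt_length_of_mem (hmem x)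
  have hget : ∀ x, l.getD (l.idxOf x) u = x := fun x => by
    rw [List.getD_eq_getElem _ _ (hpos x), List.getElem_idxOf]
  set C := code e l with hC
  have hlen : C.length = l.length := length_code e l
  have hent : ∀ i j, i < l.length → j < l.length →
      entryAt C i j = signed e (l.getD i u) (l.getD j u) := fun i j hi hj =>
    entryAt_code he hl u hi hj
  -- The span of two clique vertices is the clique: `clique` gives one inclusion, and `unique`
  -- excludes common neighbours outside.
  have hspan : ∀ k, k < l.length →
      (inSpan C (l.idxOf u) (l.idxOf v) k = true ↔ l.getD k u ∈ U) := by
    intro k hk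
    have hk' : l.idxOf (l.getD k u) = k := by
      rw [List.getD_eq_getElem _ _ hk]; exact hl.idxOf_getElem k hk
    simp only [inSpan, Bool.or_eq_true, Bool.and_eq_true, beq_iff_eq,
      hent _ _ (hpos _) hk, hget, Nat.beq_eq]
    constructor
    · rintro ((h | h) | ⟨h1, h2⟩)
      · rw [h, hget]; exact hu
      · rw [h, hget]; exact hv
      · by_contra hn
        refine huv (hU.unique _ hn u hu v hv ?_ ?_)
        · rw [signed_symm he, h1]; decide
        · rw [signed_symm he, h2]; decide
    · intro h
      by_cases h1 : u = l.getD k u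
      · left; left; rw [← hk', ← h1]
      by_cases h2 : v = l.getD k u
      · left; right; rw [← hk', ← h2]
      exact Or.inr ⟨hU.clique _ hu _ h h1, hU.clique _ hv _ h h2⟩
  have h1 := List.all_eq_true.1 (List.all_eq_true.1 h (l.idxOf u) (by simp [hlen, hpos]))
    (l.idxOf v) (by simp [hlen, hpos])
  rw [hent _ _ (hpos _) (hpos _), hget, hget, hU.clique u hu v hv huv] at h1
  simp only [notPendantClique, beq_self_eq_true, Bool.not_true, Bool.false_or, List.any_eq_true,
    List.mem_range, hlen, Bool.and_eq_true, Bool.or_eq_true, Bool.not_eq_true',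
    beq_eq_false_iff_ne, ne_eq] at h1
  obtain ⟨x, hx, y, hy, hxy, h1⟩ := h1
  have hne : l.getD x u ≠ l.getD y u := by
    rw [List.getD_eq_getElem _ _ hx, List.getD_eq_getElem _ _ hy]
    intro h
    simp [hl.getElem_inj_iff.1 h] at hxy
  rcases h1 with (⟨⟨h1, h2⟩, h3⟩ | ⟨⟨h1, h2⟩, h3⟩) | ⟨z, hz, (⟨⟨⟨⟨h1, h2⟩, h3⟩, h4⟩, h5⟩ |
    ⟨⟨⟨⟨h1, h2⟩, h3⟩, h4⟩, h5⟩)⟩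
  · rw [hspan _ hx] at h1
    rw [hspan _ hy] at h2
    rw [hent _ _ hx hy] at h3
    exact h3 (hU.clique _ h1 _ h2 hne)
  · rw [← Bool.not_eq_true, hspan _ hx] at h1
    rw [← Bool.not_eq_true, hspan _ hy] at h2
    rw [hent _ _ hx hy] at h3
    exact h3 (hU.indep _ h1 _ h2 hne)
  · rw [hspan _ hz] at h1
    rw [← Bool.not_eq_true, hspan _ hx] at h2
    rw [← Bool.not_eq_true, hspan _ hy] at h3
    rw [hent _ _ hz hx] at h4
    rw [hent _ _ hz hy] at h5
    exact hne (hU.pendant _ h1 _ h2 _ h3 h4 h5)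
  · rw [← Bool.not_eq_true, hspan _ hz] at h1
    rw [hspan _ hx] at h2
    rw [hspan _ hy] at h3
    rw [hent _ _ hz hx] at h4
    rw [hent _ _ hz hy] at h5
    exact hne (hU.unique _ h1 _ h2 _ h3 h4 h5)

end

end SignedCode

/-! ### Codes of Hoffman graphs -/

namespace HoffmanGraph

open SignedCode

variable {V : Type*} {H : HoffmanGraph V}

open Classical in
/-- The code of a pair of vertices. -/
noncomputable def enc (H : HoffmanGraph V) (x y : V) : ℕ :=
  (if H.graph.Adj x y then 1 else 0) + (if (H.fatNbrs x ∩ H.fatNbrs y).Nonempty then 2 else 0)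

theorem enc_symm (H : HoffmanGraph V) (x y : V) : H.enc x y = H.enc y x := by
  unfold enc; rw [Set.inter_comm, H.graph.adj_comm]

theorem enc_lt (H : HoffmanGraph V) (x y : V) : H.enc x y < 4 := by
  unfold enc; split_ifs <;> decide

theorem two_le_enc {x y : V} : 2 ≤ H.enc x y ↔ (H.fatNbrs x ∩ H.fatNbrs y).Nonempty := by
  unfold enc; split_ifs <;> simp_all

theorem enc_mod {x y : V} : H.enc x y % 2 = 1 ↔ H.graph.Adj x y := by
  unfold enc; split_ifs <;> simp_all

theorem enc_eq_enc {W : Type*} {K : HoffmanGraph W} {x y : V} {x' y' : W}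
    (h1 : H.graph.Adj x y ↔ K.graph.Adj x' y')
    (h2 : (H.fatNbrs x ∩ H.fatNbrs y).Nonempty ↔ (K.fatNbrs x' ∩ K.fatNbrs y').Nonempty) :
    H.enc x y = K.enc x' y' := by
  unfold enc
  split_ifs <;> simp_all

theorem adj_iff_of_enc {W : Type*} {K : HoffmanGraph W} {x y : V} {x' y' : W}
    (h : H.enc x y = K.enc x' y') : H.graph.Adj x y ↔ K.graph.Adj x' y' := by
  rw [← enc_mod, h, enc_mod]

/-- If one of the two vertices has a single fat neighbour, the number of common ones is 0 or 1, so
that the code determines the entry. -/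
theorem entry_eq_mval {x y : V} (hx : (H.fatNbrs x).ncard = 1) :
    H.entry x y = mval (H.enc x y) := by
  obtain ⟨f, hf⟩ := Set.ncard_eq_one.1 hx
  unfold entry enc
  rw [hf]
  by_cases h : f ∈ H.fatNbrs y
  · have : {f} ∩ H.fatNbrs y = {f} := by simpa using h
    rw [this]
    split_ifs <;> simp_all [mval]
  · have : {f} ∩ H.fatNbrs y = ∅ := by simpa using h
    rw [this]
    split_ifs <;> simp_all [mval]

theorem isCode_enc {S : Type*} (f : S → V) (hf : ∀ s, (H.fatNbrs (f s)).Subsingleton) :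
    IsCode fun x y => H.enc (f x) (f y) where
  lt x y := H.enc_lt _ _
  symm x y := H.enc_symm _ _
  trans x y z _ _ _ hxy hyz := by
    rw [two_le_enc] at hxy hyz ⊢
    obtain ⟨a, ha, ha'⟩ := hxy
    obtain ⟨b, hb, hb'⟩ := hyz
    obtain rfl := hf y ha' hb
    exact ⟨_, ha, hb'⟩

theorem subsingleton_fatNbrs {x : V} (h : (H.fatNbrs x).ncard = 1) :
    (H.fatNbrs x).Subsingleton := by
  obtain ⟨f, hf⟩ := Set.ncard_eq_one.1 h
  rw [hf]
  exact Set.subsingleton_singleton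

theorem fatNbrs_of_fat {x : V} (h : x ∈ H.fat) : H.fatNbrs x = ∅ :=
  Set.eq_empty_of_forall_notMem fun f hf => H.fat_not_adj x h f hf.1 hf.2

/-- One fat neighbour per vertex means diagonal -1, so that the shift 1+τ leaves τ on the zero
diagonal of the signed matrix. -/
theorem isGood_of_isPsd {S : Type*} [Fintype S] [DecidableEq S] {e : S → S → ℕ}
    (h : IsPsd fun x y : S => if x = y then -1 else mval (e x y)) : SignedCode.IsGood e := by
  intro c
  have := h c
  have e1 : ∀ x, ∑ y, c x * c y * ((if x = y then -1 else mval (e x y) : ℤ) : ℝ) =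
      c x * ∑ y, signed e x y * c y - c x ^ 2 := by
    intro x
    rw [Finset.mul_sum, eq_sub_iff_add_eq]
    have : c x ^ 2 = ∑ y, if x = y then c y ^ 2 else 0 := by simp
    rw [this, ← Finset.sum_add_distrib]
    refine Finset.sum_congr rfl fun y _ => ?_
    by_cases hxy : x = y
    · subst hxy; simp [signed]; ring
    · simp [signed, hxy]; ring
  simp only [e1, Finset.sum_sub_distrib] at this
  linarith

open Classical in
theorem IsGood.isPsd_restrict [Fintype V] (hg : H.IsGood) {T : Set V} (hs : T ⊆ H.slim) :
    IsPsd fun x y : T => H.entry x y :=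
  hg.comp (f := fun x : T => ⟨x, hs x.2⟩) fun x y h => by
    simpa [Subtype.ext_iff] using h

open Classical in
theorem IsGood.isGood_enc [Fintype V] (hg : H.IsGood) {T : Set V} (hs : T ⊆ H.slim)
    (hT : ∀ x ∈ T, (H.fatNbrs x).ncard = 1) : SignedCode.IsGood fun x y : T => H.enc x y := by
  refine isGood_of_isPsd ((hg.isPsd_restrict hs).congr fun x y => ?_)
  split_ifs with hxy
  · subst hxy
    rw [entry_self, hT x x.2]; rfl
  · exact entry_eq_mval (hT x x.2)

open Classical in
theorem IsGood.ncard_fatNbrs [Fintype V] (hg : H.IsGood) (hf : H.IsFat) {x : V}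
    (hx : x ∈ H.slim) : (H.fatNbrs x).ncard = 1 ∨ (H.fatNbrs x).ncard = 2 := by
  have h1 := hg.neg_two_le ⟨x, hx⟩
  simp only [entry_self] at h1
  have h2 : (H.fatNbrs x).ncard ≠ 0 := by
    exact (Set.ncard_pos (Set.toFinite _)).2 (hf x hx) |>.ne'
  omega

end HoffmanGraph

/-! ### Codes of the listed graphs -/

namespace FinHoffmanGraph

open HoffmanGraph SignedCode

/-- All slim vertices of `G` have exactly one fat neighbour, and the slim vertices are ordered so
that `G` has code `C`. -/
structure HasCode (G : FinHoffmanGraph) (C : List (List ℕ)) : Prop where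
  ncard : ∀ x ∈ G.toHoffman.slim, (G.toHoffman.fatNbrs x).ncard = 1
  list : ∃ l : List G.V, l.Nodup ∧ (∀ x, x ∈ l ↔ x ∈ G.toHoffman.slim) ∧
    code G.toHoffman.enc l = C

section OfLists

variable {n m : ℕ} {E : List (Fin n × Fin n)} {F : Fin m → List (Fin n)} {hF : ∀ k, F k ≠ []}

theorem ofLists_adj_inl {i j : Fin n} : (HoffmanGraph.ofLists E F hF).graph.Adj (Sum.inl i)
    (Sum.inl j) ↔ i ≠ j ∧ ((i, j) ∈ E ∨ (j, i) ∈ E) := by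
  simp [HoffmanGraph.ofLists, SimpleGraph.fromRel_adj]

theorem ofLists_adj_inr {i : Fin n} {k : Fin m} : (HoffmanGraph.ofLists E F hF).graph.Adj
    (Sum.inl i) (Sum.inr k) ↔ i ∈ F k := by
  simp [HoffmanGraph.ofLists, SimpleGraph.fromRel_adj]

theorem ofLists_slim {x : Fin n ⊕ Fin m} :
    x ∈ (HoffmanGraph.ofLists E F hF).slim ↔ ∃ i, x = Sum.inl i := by
  cases x <;> simp [HoffmanGraph.ofLists, HoffmanGraph.slim]

theorem ofLists_fatNbrs {i : Fin n} : (HoffmanGraph.ofLists E F hF).fatNbrs (Sum.inl i) =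
    Sum.inr '' {k | i ∈ F k} := by
  ext x
  cases x with
  | inl j => simp [HoffmanGraph.fatNbrs, HoffmanGraph.ofLists]
  | inr k =>
    rw [mem_fatNbrs, ofLists_adj_inr]
    simp [HoffmanGraph.ofLists]

def listCode (E : List (Fin n × Fin n)) (F : Fin m → List (Fin n)) (i j : Fin n) : ℕ :=
  (if (i, j) ∈ E ∨ (j, i) ∈ E then 1 else 0) + (if ∃ k, i ∈ F k ∧ j ∈ F k then 2 else 0)

theorem hasCode_ofLists {C : List (List ℕ)} (l : List (Fin n)) (hl : l.Nodup) (hmem : ∀ i, i ∈ l)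
    (h1 : ∀ i, ∃ k, i ∈ F k ∧ ∀ k', i ∈ F k' → k' = k) (hC : code (listCode E F) l = C) :
    HasCode (ofLists E F hF) C where
  ncard := by
    intro x hx
    obtain ⟨i, rfl⟩ := (ofLists_slim (E := E) (F := F) (hF := hF)).1 hx
    obtain ⟨k, hk, hk'⟩ := h1 i
    change ((HoffmanGraph.ofLists E F hF).fatNbrs (Sum.inl i)).ncard = 1
    rw [ofLists_fatNbrs, show {k | i ∈ F k} = {k} from Set.ext fun k' => ⟨hk' k', by
      rintro rfl; exact hk⟩]
    simp
  list := by
    change ∃ l : List (Fin n ⊕ Fin m), l.Nodup ∧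
      (∀ x, x ∈ l ↔ x ∈ (HoffmanGraph.ofLists E F hF).slim) ∧
      code (HoffmanGraph.ofLists E F hF).enc l = C
    refine ⟨l.map Sum.inl, hl.map Sum.inl_injective, fun x => ?_, ?_⟩
    · rw [ofLists_slim]
      simp [hmem, eq_comm]
    · rw [← hC]
      refine code_map hl fun i _ j _ hij => ?_
      have : ((HoffmanGraph.ofLists E F hF).fatNbrs (Sum.inl i) ∩
          (HoffmanGraph.ofLists E F hF).fatNbrs (Sum.inl j)).Nonempty ↔
          ∃ k, i ∈ F k ∧ j ∈ F k := by
        rw [ofLists_fatNbrs, ofLists_fatNbrs, ← Set.image_inter Sum.inr_injective,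
          Set.image_nonempty]
        rfl
      unfold listCode enc
      classical
      rw [if_congr this rfl rfl, if_congr ofLists_adj_inl rfl rfl]
      simp [hij]

end OfLists

theorem HasCode.isCode {G : FinHoffmanGraph} {C : List (List ℕ)} (h : HasCode G C) :
    IsCode G.toHoffman.enc :=
  isCode_enc id fun x => by
    by_cases hx : x ∈ G.toHoffman.fat
    · rw [id, fatNbrs_of_fat hx]; exact Set.subsingleton_empty
    · exact subsingleton_fatNbrs (h.ncard x hx)

/-- Each list orders the slim vertices so that the code is literally the target. The index is
shifted by two because the first two graphs contain a vertex with two fat neighbours and have no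
code. -/
theorem hasCode_maximalList : ∀ i : Fin 18,
    HasCode (maximalList (Fin.natAdd 2 i)) (targets.getD i []) := by
  intro i
  fin_cases i
  · exact hasCode_ofLists [1, 2, 0, 3] (by decide) (by decide) (by decide) (by decide)
  · exact hasCode_ofLists [1, 0, 2, 3] (by decide) (by decide) (by decide) (by decide)
  · exact hasCode_ofLists [0, 1, 2, 3, 4] (by decide) (by decide) (by decide) (by decide)
  · exact hasCode_ofLists [0, 3, 2, 1, 4] (by decide) (by decide) (by decide) (by decide)
  · exact hasCode_ofLists [0, 1, 2, 3, 4] (by decide) (by decide) (by decide) (by decide)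
  · exact hasCode_ofLists [0, 1, 2, 3, 4, 5] (by decide) (by decide) (by decide) (by decide)
  · exact hasCode_ofLists [0, 1, 2, 3, 4, 5] (by decide) (by decide) (by decide) (by decide)
  · exact hasCode_ofLists [0, 1, 2, 3, 4, 5] (by decide) (by decide) (by decide) (by decide)
  · exact hasCode_ofLists [0, 3, 4, 2, 1, 5] (by decide) (by decide) (by decide) (by decide)
  · exact hasCode_ofLists [0, 3, 4, 2, 1, 5] (by decide) (by decide) (by decide) (by decide)
  · exact hasCode_ofLists [0, 3, 4, 2, 1, 5] (by decide) (by decide) (by decide) (by decide)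
  · exact hasCode_ofLists [0, 3, 4, 2, 1, 5] (by decide) (by decide) (by decide) (by decide)
  · exact hasCode_ofLists [0, 3, 4, 2, 1, 5] (by decide) (by decide) (by decide) (by decide)
  · exact hasCode_ofLists [0, 3, 4, 2, 1, 5] (by decide) (by decide) (by decide) (by decide)
  · exact hasCode_ofLists [0, 3, 4, 2, 1, 5] (by decide) (by decide) (by decide) (by decide)
  · exact hasCode_ofLists [1, 2, 0, 3, 4, 5] (by decide) (by decide) (by decide) (by decide)
  · exact hasCode_ofLists [1, 2, 0, 3, 4, 5] (by decide) (by decide) (by decide) (by decide)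
  · exact hasCode_ofLists [1, 2, 0, 3, 4, 5] (by decide) (by decide) (by decide) (by decide)

end FinHoffmanGraph

/-! ### Local embeddings of components into listed graphs -/

namespace HoffmanGraph

open SignedCode

variable {V : Type*} {X : Type*}

/-- A set of slim vertices together with their fat neighbours. -/
def hull (H : HoffmanGraph V) (T : Set V) : Set V := {v | v ∈ T ∨ ∃ x ∈ T, v ∈ H.fatNbrs x}

/-- An isomorphism of the subgraph spanned by the slim vertices in `T` and their fat neighbours
onto an induced subgraph of `L`, such that the other slim vertices of `L` have at most one fat
neighbour in this subgraph. -/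
structure LocalEmbedding (H : HoffmanGraph V) (T : Set V) (L : HoffmanGraph X) where
  toFun : V → X
  inj : Set.InjOn toFun (H.hull T)
  fat : ∀ v ∈ H.hull T, toFun v ∈ L.fat ↔ v ∈ H.fat
  adj : ∀ v ∈ H.hull T, ∀ w ∈ H.hull T, L.graph.Adj (toFun v) (toFun w) ↔ H.graph.Adj v w
  unique : ∀ a ∈ L.slim, a ∉ toFun '' T → ∀ f ∈ H.hull T, ∀ g ∈ H.hull T,
    toFun f ∈ L.fatNbrs a → toFun g ∈ L.fatNbrs a → f = g

variable {H : HoffmanGraph V}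

/-- With one fat neighbour per slim vertex, the fat vertices are the classes of the relation of
having a common fat neighbour, so the code determines the graph. The condition `unique` is then
automatic. -/
theorem nonempty_localEmbedding_of_hasCode {G : FinHoffmanGraph} {C : List (List ℕ)}
    [Nonempty G.V] (hC : G.HasCode C) {T : Set V} (hs : T ⊆ H.slim)
    (hT : ∀ x ∈ T, (H.fatNbrs x).ncard = 1) (φ : T → ℕ) (hφ : Function.Injective φ)
    (hlt : ∀ x, φ x < C.length)
    (henc : ∀ x y : T, x ≠ y → H.enc x y = look C (φ x) (φ y)) :
    Nonempty (LocalEmbedding H T G.toHoffman) := by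
  classical
  obtain ⟨l, hl, hmem, rfl⟩ := hC.list
  set L := G.toHoffman
  simp only [length_code] at hlt
  set ψ : T → G.V := fun x => l[φ x]'(hlt x) with hψ
  have hψinj : Function.Injective ψ := fun x y h => hφ (hl.getElem_inj_iff.1 h)
  have hψs : ∀ x, ψ x ∉ L.fat := fun x => (hmem _).1 (List.getElem_mem _)
  have hψe : ∀ x y : T, x ≠ y → H.enc x y = L.enc (ψ x) (ψ y) := fun x y hxy => by
    rw [henc x y hxy, look_code hC.isCode (ψ x) l (hlt x) (hlt y) fun h => hxy (hφ h),
      List.getD_eq_getElem _ _ (hlt x), List.getD_eq_getElem _ _ (hlt y)]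
  choose F hF using fun a : G.V => fun h : a ∉ L.fat => Set.ncard_eq_one.1 (hC.ncard a h)
  let F' : T → G.V := fun x => F (ψ x) (hψs x)
  have hF' : ∀ x, L.fatNbrs (ψ x) = {F' x} := fun x => hF _ _
  have hcommon : ∀ x y : T, ∀ v ∈ H.fatNbrs x, (v ∈ H.fatNbrs y ↔ F' x = F' y) := by
    intro x y v hv
    by_cases hxy : x = y
    · subst hxy; simp [hv]
    have h1 : (H.fatNbrs x ∩ H.fatNbrs y).Nonempty ↔
        (L.fatNbrs (ψ x) ∩ L.fatNbrs (ψ y)).Nonempty := by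
      rw [← two_le_enc, hψe x y hxy, two_le_enc]
    rw [hF', hF', Set.singleton_inter_nonempty, Set.mem_singleton_iff] at h1
    rw [← h1]
    exact ⟨fun h => ⟨v, hv, h⟩, fun ⟨w, hw, hw'⟩ =>
      subsingleton_fatNbrs (hT x x.2) hw hv ▸ hw'⟩
  -- A fat vertex is sent to the fat neighbour of the image of any of its neighbours in `T`;
  -- `hcommon` makes this independent of the choice. The value outside the hull is irrelevant.
  let θ : V → G.V := fun v => if h : v ∈ T then ψ ⟨v, h⟩ else
    if h : ∃ x : T, v ∈ H.fatNbrs x then F' h.choose else Classical.arbitrary _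
  have hθT : ∀ x : T, θ x = ψ x := fun x => by simp [θ]
  have hθF : ∀ (x : T) (v : V), v ∈ H.fatNbrs x → θ v = F' x := by
    intro x v hv
    have h1 : v ∉ T := fun h => hs h hv.1
    have h2 : ∃ x : T, v ∈ H.fatNbrs x := ⟨x, hv⟩
    simp only [θ, h1, dif_neg, h2, dif_pos, not_false_eq_true]
    exact (hcommon _ _ v h2.choose_spec).1 hv
  have hcases : ∀ v ∈ H.hull T, (∃ x : T, v = x) ∨ ∃ x : T, v ∈ H.fatNbrs x := by
    rintro v (h | ⟨x, hx, h⟩)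
    · exact Or.inl ⟨⟨v, h⟩, rfl⟩
    · exact Or.inr ⟨⟨x, hx⟩, h⟩
  have hFfat : ∀ x, F' x ∈ L.fatNbrs (ψ x) := fun x => by rw [hF']; rfl
  have hadj : ∀ (x y : T) (v : V), v ∈ H.fatNbrs y →
      (L.graph.Adj (ψ x) (F' y) ↔ H.graph.Adj x v) := by
    intro x y v hv
    have h1 : L.graph.Adj (ψ x) (F' y) ↔ F' y ∈ L.fatNbrs (ψ x) :=
      ⟨fun h => ⟨(hFfat y).1, h⟩, fun h => h.2⟩
    have h2 : H.graph.Adj x v ↔ v ∈ H.fatNbrs x := ⟨fun h => ⟨hv.1, h⟩, fun h => h.2⟩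
    rw [h1, h2, hF', Set.mem_singleton_iff, hcommon y x v hv]
  refine ⟨θ, ?_, ?_, ?_, ?_⟩
  · intro v hv w hw h
    rcases hcases v hv with ⟨x, rfl⟩ | ⟨x, hx⟩ <;> rcases hcases w hw with ⟨y, rfl⟩ | ⟨y, hy⟩
    · rw [hθT, hθT] at h
      rw [hψinj h]
    · rw [hθT, hθF y w hy] at h
      exact absurd (h ▸ (hFfat y).1) (hψs x)
    · rw [hθT, hθF x v hx] at h
      exact absurd (h ▸ (hFfat x).1) (hψs y)
    · rw [hθF x v hx, hθF y w hy] at h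
      exact subsingleton_fatNbrs (hT y y.2) ((hcommon x y v hx).2 h) hy
  · intro v hv
    rcases hcases v hv with ⟨x, rfl⟩ | ⟨x, hx⟩
    · rw [hθT]
      exact iff_of_false (hψs x) (hs x.2)
    · rw [hθF x v hx]
      exact iff_of_true (hFfat x).1 hx.1
  · intro v hv w hw
    rcases hcases v hv with ⟨x, rfl⟩ | ⟨x, hx⟩ <;> rcases hcases w hw with ⟨y, rfl⟩ | ⟨y, hy⟩
    · rw [hθT, hθT]
      by_cases hxy : x = y
      · subst hxy; simp
      · exact (adj_iff_of_enc (hψe x y hxy)).symm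
    · rw [hθT, hθF y w hy]
      exact hadj x y w hy
    · rw [hθT, hθF x v hx, L.graph.adj_comm, H.graph.adj_comm]
      exact hadj y x v hx
    · rw [hθF x v hx, hθF y w hy]
      exact iff_of_false (L.fat_not_adj _ (hFfat x).1 _ (hFfat y).1)
        (H.fat_not_adj _ hx.1 _ hy.1)
  · intro a ha _ f hf g hg hfa hga
    have h := subsingleton_fatNbrs (hC.ncard a ha) hfa hga
    rcases hcases f hf with ⟨x, rfl⟩ | ⟨x, hx⟩
    · exact absurd (hθT x ▸ hfa.1) (hψs x)
    rcases hcases g hg with ⟨y, rfl⟩ | ⟨y, hy⟩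
    · exact absurd (hθT y ▸ hga.1) (hψs y)
    · rw [hθF x f hx, hθF y g hy] at h
      exact subsingleton_fatNbrs (hT y y.2) ((hcommon x y f hx).2 h) hy

theorem mem_hull_singleton {x v : V} : v ∈ H.hull {x} ↔ v = x ∨ v ∈ H.fatNbrs x := by
  simp [hull]

theorem mem_hull_pair {x y v : V} :
    v ∈ H.hull {x, y} ↔ v = x ∨ v = y ∨ v ∈ H.fatNbrs x ∨ v ∈ H.fatNbrs y := by
  simp only [hull, Set.mem_insert_iff, Set.mem_singleton_iff, Set.mem_ofPred_eq, exists_eq_or_imp,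
    exists_eq_left]
  tauto

open Classical in
-- The vertex `x` becomes the slim vertex 1. The slim vertex 0 stays outside the image, but its only
-- fat neighbour does too, which gives `unique`.
theorem nonempty_localEmbedding_singleton {x : V} (hx : x ∈ H.slim)
    (h2 : (H.fatNbrs x).ncard = 2) :
    Nonempty (LocalEmbedding H {x} (maximalList 0).toHoffman) := by
  obtain ⟨f, g, hfg, h⟩ := Set.ncard_eq_two.1 h2
  have hf : f ∈ H.fatNbrs x := by simp [h]
  have hg : g ∈ H.fatNbrs x := by simp [h]
  have hxf : f ≠ x := by rintro rfl; exact hx hf.1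
  have hxg : g ≠ x := by rintro rfl; exact hx hg.1
  have hgf := hfg.symm
  have hfg' := H.fat_not_adj f hf.1 g hg.1
  have hfat := hf.1
  have hgat := hg.1
  have hadj := hf.2
  have hadj' := hg.2
  have hx' : x ∉ H.fat := hx
  have hhull : ∀ v, v ∈ H.hull {x} ↔ v = x ∨ v = f ∨ v = g := by
    intro v; rw [mem_hull_singleton, h]; simp
  change Nonempty (LocalEmbedding H {x} (HoffmanGraph.ofLists (n := 2) (m := 3) [(0, 1)]
    ![[0], [1], [1]] (by decide)))
  refine ⟨fun v => if v = x then Sum.inl 1 else if v = f then Sum.inr 1 else Sum.inr 2,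
    ?_, ?_, ?_, ?_⟩
  · intro v hv w hw
    rw [hhull] at hv hw
    rcases hv with rfl | rfl | rfl <;> rcases hw with rfl | rfl | rfl <;> simp_all [eq_comm]
  · intro v hv
    rw [hhull] at hv
    rcases hv with rfl | rfl | rfl <;> simp_all [HoffmanGraph.ofLists]
  · intro v hv w hw
    rw [hhull] at hv hw
    rcases hv with rfl | rfl | rfl <;> rcases hw with rfl | rfl | rfl <;>
      simp_all [HoffmanGraph.ofLists, SimpleGraph.fromRel_adj, H.graph.adj_comm]
  · intro a ha ha' v hv w hw hva hwa
    rw [hhull] at hv hw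
    obtain ⟨i, rfl⟩ := FinHoffmanGraph.ofLists_slim.1 ha
    rcases hv with rfl | rfl | rfl <;> rcases hw with rfl | rfl | rfl <;> fin_cases i <;>
      simp_all [FinHoffmanGraph.ofLists_fatNbrs]

open Classical in
theorem nonempty_localEmbedding_pair_adj {x y : V} (hx : x ∈ H.slim) (hy : y ∈ H.slim)
    (h2 : (H.fatNbrs x).ncard = 2) (h1 : (H.fatNbrs y).ncard = 1) (hxy : H.graph.Adj x y)
    (hdisj : H.fatNbrs x ∩ H.fatNbrs y = ∅) :
    Nonempty (LocalEmbedding H {x, y} (maximalList 0).toHoffman) := by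
  obtain ⟨f, g, hfg, h⟩ := Set.ncard_eq_two.1 h2
  obtain ⟨k, hk⟩ := Set.ncard_eq_one.1 h1
  have hf : f ∈ H.fatNbrs x := by simp [h]
  have hg : g ∈ H.fatNbrs x := by simp [h]
  have hk' : k ∈ H.fatNbrs y := by simp [hk]
  have hfy : f ∉ H.fatNbrs y := fun h => (hdisj ▸ ⟨hf, h⟩ : f ∈ (∅ : Set V))
  have hgy : g ∉ H.fatNbrs y := fun h => (hdisj ▸ ⟨hg, h⟩ : g ∈ (∅ : Set V))
  have hkx : k ∉ H.fatNbrs x := fun h => (hdisj ▸ ⟨h, hk'⟩ : k ∈ (∅ : Set V))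
  have hxy' : y ≠ x := hxy.ne'
  have hgf := hfg.symm
  have hxf : f ≠ x := by rintro rfl; exact hx hf.1
  have hxg : g ≠ x := by rintro rfl; exact hx hg.1
  have hxk : k ≠ x := by rintro rfl; exact hx hk'.1
  have hyf : f ≠ y := by rintro rfl; exact hy hf.1
  have hyg : g ≠ y := by rintro rfl; exact hy hg.1
  have hyk : k ≠ y := by rintro rfl; exact hy hk'.1
  have hkf : k ≠ f := by rintro rfl; exact hkx hf
  have hkg : k ≠ g := by rintro rfl; exact hkx hg
  have a1 := H.fat_not_adj f hf.1 g hg.1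
  have a2 := H.fat_not_adj f hf.1 k hk'.1
  have a3 := H.fat_not_adj g hg.1 k hk'.1
  have b1 := hf.2
  have b2 := hg.2
  have b3 := hk'.2
  have b4 : ¬ H.graph.Adj y f := fun h => hfy ⟨hf.1, h⟩
  have b5 : ¬ H.graph.Adj y g := fun h => hgy ⟨hg.1, h⟩
  have b6 : ¬ H.graph.Adj x k := fun h => hkx ⟨hk'.1, h⟩
  have c1 := hf.1
  have c2 := hg.1
  have c3 := hk'.1
  have hhull : ∀ v, v ∈ H.hull {x, y} ↔ v = x ∨ v = y ∨ (v = f ∨ v = g) ∨ v = k := by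
    intro v; rw [mem_hull_pair, h, hk]; simp
  clear hf hg hk' hfy hgy hkx h hk h1 h2 hdisj
  change Nonempty (LocalEmbedding H {x, y} (HoffmanGraph.ofLists (n := 2) (m := 3) [(0, 1)]
    ![[0], [1], [1]] (by decide)))
  let θ : V → Fin 2 ⊕ Fin 3 := fun v => if v = x then Sum.inl 1 else if v = y then Sum.inl 0 else
    if v = f then Sum.inr 1 else if v = g then Sum.inr 2 else Sum.inr 0
  have t1 : θ x = Sum.inl 1 := by simp [θ]
  have t2 : θ y = Sum.inl 0 := by simp [θ, hxy']
  have t3 : θ f = Sum.inr 1 := by simp [θ, hxf, hyf]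
  have t4 : θ g = Sum.inr 2 := by simp [θ, hxg, hyg, hgf]
  have t5 : θ k = Sum.inr 0 := by simp [θ, hxk, hyk, hkf, hkg]
  refine ⟨θ, ?_, ?_, ?_, ?_⟩
  · intro v hv w hw hvw
    rw [hhull] at hv hw
    rcases hv with rfl | rfl | (rfl | rfl) | rfl <;>
      rcases hw with rfl | rfl | (rfl | rfl) | rfl <;> first | rfl | simp_all
  · intro v hv
    rw [hhull] at hv
    rcases hv with rfl | rfl | (rfl | rfl) | rfl <;>
      simp only [t1, t2, t3, t4, t5] <;> simp [HoffmanGraph.ofLists, *] <;> assumption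
  · intro v hv w hw
    rw [hhull] at hv hw
    rcases hv with rfl | rfl | (rfl | rfl) | rfl <;>
      rcases hw with rfl | rfl | (rfl | rfl) | rfl <;>
      simp only [t1, t2, t3, t4, t5] <;>
      simp [HoffmanGraph.ofLists, SimpleGraph.fromRel_adj] <;>
      first | assumption | (rw [H.graph.adj_comm]; assumption)
  · intro a ha ha'
    obtain ⟨i, rfl⟩ := FinHoffmanGraph.ofLists_slim.1 ha
    refine absurd ?_ ha'
    fin_cases i
    · exact ⟨y, by simp, t2⟩
    · exact ⟨x, by simp, t1⟩

theorem nonempty_localEmbedding_pair_not_adj {x y : V} (hx : x ∈ H.slim) (hy : y ∈ H.slim)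
    (hne : x ≠ y) (h2 : (H.fatNbrs x).ncard = 2) (h1 : (H.fatNbrs y).ncard = 1)
    (hxy : ¬ H.graph.Adj x y) (hmeet : (H.fatNbrs x ∩ H.fatNbrs y).Nonempty) :
    Nonempty (LocalEmbedding H {x, y} (maximalList 1).toHoffman) := by
  classical
  obtain ⟨f, hf, hfy⟩ := hmeet
  obtain ⟨g, hg, hgf⟩ := Set.exists_ne_of_one_lt_ncard (by omega : 1 < (H.fatNbrs x).ncard) f
  have h : H.fatNbrs x = {f, g} := by
    refine (Set.eq_of_subset_of_ncard_le ?_ ?_ (Set.finite_of_ncard_ne_zero (by omega))).symm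
    · rintro v (rfl | rfl)
      · exact hf
      · exact hg
    · rw [h2, Set.ncard_pair hgf.symm]
  have hk : H.fatNbrs y = {f} := by
    obtain ⟨k, hk⟩ := Set.ncard_eq_one.1 h1
    rw [hk] at hfy ⊢
    rw [Set.mem_singleton_iff.1 hfy]
  have hgy : g ∉ H.fatNbrs y := by rw [hk]; exact hgf
  have hxf : f ≠ x := by rintro rfl; exact hx hf.1
  have hxg : g ≠ x := by rintro rfl; exact hx hg.1
  have hyf : f ≠ y := by rintro rfl; exact hy hf.1
  have hyg : g ≠ y := by rintro rfl; exact hy hg.1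
  have a1 := H.fat_not_adj f hf.1 g hg.1
  have b1 := hf.2
  have b2 := hg.2
  have b4 := hfy.2
  have b5 : ¬ H.graph.Adj y g := fun h => hgy ⟨hg.1, h⟩
  have c1 := hf.1
  have c2 := hg.1
  have hhull : ∀ v, v ∈ H.hull {x, y} ↔ v = x ∨ v = y ∨ v = f ∨ v = g := by
    intro v; rw [mem_hull_pair, h, hk]; simp; tauto
  change Nonempty (LocalEmbedding H {x, y} (HoffmanGraph.ofLists (n := 2) (m := 2) []
    ![[0, 1], [1]] (by decide)))
  let θ : V → Fin 2 ⊕ Fin 2 := fun v => if v = x then Sum.inl 1 else if v = y then Sum.inl 0 else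
    if v = f then Sum.inr 0 else Sum.inr 1
  have t1 : θ x = Sum.inl 1 := by simp [θ]
  have t2 : θ y = Sum.inl 0 := by simp [θ, hne.symm]
  have t3 : θ f = Sum.inr 0 := by simp [θ, hxf, hyf]
  have t4 : θ g = Sum.inr 1 := by simp [θ, hxg, hyg, hgf]
  refine ⟨θ, ?_, ?_, ?_, ?_⟩
  · intro v hv w hw hvw
    rw [hhull] at hv hw
    rcases hv with rfl | rfl | rfl | rfl <;>
      rcases hw with rfl | rfl | rfl | rfl <;> first | rfl | simp_all
  · intro v hv
    rw [hhull] at hv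
    rcases hv with rfl | rfl | rfl | rfl <;>
      simp only [t1, t2, t3, t4] <;> simp [HoffmanGraph.ofLists] <;> assumption
  · intro v hv w hw
    rw [hhull] at hv hw
    rcases hv with rfl | rfl | rfl | rfl <;>
      rcases hw with rfl | rfl | rfl | rfl <;>
      simp only [t1, t2, t3, t4] <;>
      simp [HoffmanGraph.ofLists, SimpleGraph.fromRel_adj] <;>
      first | assumption | (rw [H.graph.adj_comm]; assumption)
  · intro a ha ha'
    obtain ⟨i, rfl⟩ := FinHoffmanGraph.ofLists_slim.1 ha
    refine absurd ?_ ha'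
    fin_cases i
    · exact ⟨y, by simp, t2⟩
    · exact ⟨x, by simp, t1⟩

end HoffmanGraph

/-! ### Decompositions and reducibility in terms of the entries -/

namespace HoffmanGraph

section

variable {V : Type*} {W : Type*} {H : HoffmanGraph V} {K : HoffmanGraph W}

theorem mem_slim_of_mem_hull {T : Set V} {x : V} (hx : x ∈ H.slim) (h : x ∈ H.hull T) : x ∈ T := by
  rcases h with h | ⟨y, -, h⟩
  · exact h
  · exact absurd h.1 hx

/-- The entry is the adjacency minus the number of common fat neighbours; it vanishes iff both are 0
or both are 1. This turns the axioms of decompositions into a statement on the special graph. -/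
theorem entry_eq_zero_iff [Finite V] {x y : V} : H.entry x y = 0 ↔
    (H.fatNbrs x ∩ H.fatNbrs y).encard ≤ 1 ∧
      ((H.fatNbrs x ∩ H.fatNbrs y).encard = 1 ↔ H.graph.Adj x y) := by
  rw [← (Set.toFinite _).cast_ncard_eq]
  unfold entry
  generalize (H.fatNbrs x ∩ H.fatNbrs y).ncard = n
  norm_cast
  by_cases h : H.graph.Adj x y <;> simp [h] <;> omega

theorem image_fatNbrs_induce {s : Set V}
    {hs : ∀ f ∈ s, f ∈ H.fat → ∃ x ∈ s, x ∉ H.fat ∧ H.graph.Adj f x} (x : s) :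
    Subtype.val '' (H.induce s hs).fatNbrs x = H.fatNbrs x ∩ s := by
  ext f
  constructor
  · rintro ⟨g, hg, rfl⟩
    exact ⟨hg, g.2⟩
  · rintro ⟨h1, h2⟩
    exact ⟨⟨f, h2⟩, h1, rfl⟩

theorem entry_induce {s : Set V}
    {hs : ∀ f ∈ s, f ∈ H.fat → ∃ x ∈ s, x ∉ H.fat ∧ H.graph.Adj f x} (x y : s)
    (hx : H.fatNbrs x ⊆ s) : (H.induce s hs).entry x y = H.entry x y := by
  unfold entry
  congr 2
  rw [← Set.ncard_image_of_injective _ Subtype.val_injective,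
    Set.image_inter Subtype.val_injective, image_fatNbrs_induce, image_fatNbrs_induce]
  congr 1
  ext f
  simp only [Set.mem_inter_iff]
  have := @hx f
  tauto

/-- The decomposition given by a partition of the slim vertices. -/
def decomposition [Finite V] (H : HoffmanGraph V) {n : ℕ} (cls : V → Fin n)
    (h : ∀ x ∈ H.slim, ∀ y ∈ H.slim, cls x ≠ cls y → H.entry x y = 0) : H.Decomposition n where
  part i := H.hull {x | x ∈ H.slim ∧ cls x = i}
  part_fat := by
    rintro i f (h | ⟨x, hx, h⟩) hf
    · exact absurd hf h.1
    · exact ⟨x, Or.inl hx, hx.1, h.2.symm⟩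
  cover := by
    refine Set.eq_univ_iff_forall.2 fun v => Set.mem_iUnion.2 ?_
    by_cases hv : v ∈ H.fat
    · obtain ⟨x, hx, hvx⟩ := H.fat_adj_slim v hv
      exact ⟨cls x, Or.inr ⟨x, ⟨hx, rfl⟩, hv, hvx.symm⟩⟩
    · exact ⟨cls v, Or.inl ⟨hv, rfl⟩⟩
  slim_disjoint := by
    rintro i j hij
    refine Set.eq_empty_of_forall_notMem ?_
    rintro x ⟨⟨h1, h2⟩, h3, -⟩
    exact hij ((mem_slim_of_mem_hull h2 h1).2.symm.trans (mem_slim_of_mem_hull h2 h3).2)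
  fat_mem := by
    rintro i x ⟨h1, h2⟩ y hy hxy
    exact Or.inr ⟨x, mem_slim_of_mem_hull h2 h1, hy, hxy⟩
  common_le := by
    rintro i j hij x ⟨hx, hxs⟩ y ⟨hy, hys⟩
    have hx' := (mem_slim_of_mem_hull hxs hx).2
    have hy' := (mem_slim_of_mem_hull hys hy).2
    exact (entry_eq_zero_iff.1 (h x hxs y hys (by rwa [hx', hy']))).1
  common_iff := by
    rintro i j hij x ⟨hx, hxs⟩ y ⟨hy, hys⟩
    have hx' := (mem_slim_of_mem_hull hxs hx).2
    have hy' := (mem_slim_of_mem_hull hys hy).2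
    exact (entry_eq_zero_iff.1 (h x hxs y hys (by rwa [hx', hy']))).2

namespace Decomposition

variable {n : ℕ} (D : H.Decomposition n)

theorem entry_eq_zero [Finite V] {i j : Fin n} (hij : i ≠ j) {x y : V} (hx : x ∈ H.slim)
    (hy : y ∈ H.slim) (hxi : x ∈ D.part i) (hyj : y ∈ D.part j) : H.entry x y = 0 :=
  entry_eq_zero_iff.2 ⟨D.common_le i j hij x ⟨hxi, hx⟩ y ⟨hyj, hy⟩,
    D.common_iff i j hij x ⟨hxi, hx⟩ y ⟨hyj, hy⟩⟩

theorem entry_piece {i : Fin n} {x : D.part i} (hx : (x : V) ∈ H.slim) (y : D.part i) :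
    (D.piece i).entry x y = H.entry x y :=
  entry_induce x y fun f hf => D.fat_mem i x ⟨x.2, hx⟩ f hf.1 hf.2

theorem exists_mem (x : V) : ∃ i, x ∈ D.part i :=
  Set.mem_iUnion.1 (D.cover ▸ Set.mem_univ x)

open Classical in
theorem isGood_piece [Fintype V] (hg : H.IsGood) (i : Fin n) : (D.piece i).IsGood :=
  (hg.comp (f := fun x : (D.piece i).slim => ⟨x.1.1, x.2⟩) fun x y h => by
    simpa [Subtype.ext_iff] using h).congr fun x y => (D.entry_piece x.2 y).symm

open Classical in
theorem isGood_of_pieces [Fintype V] (hg : ∀ i, (D.piece i).IsGood) : H.IsGood := by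
  choose g hg' using D.exists_mem
  refine isPsd_of_cover (T := fun i => (D.piece i).slim) (fun x : H.slim => g x)
    (fun x y hxy => D.entry_eq_zero hxy x.2 y.2 (hg' x) (hg' y))
    (fun i x => ⟨x.1.1, x.2⟩) (fun i x y h => by simpa [Subtype.ext_iff] using h)
    (fun x => ⟨⟨⟨x, hg' x⟩, x.2⟩, rfl⟩) fun i => ?_
  exact (hg i).congr fun x y => D.entry_piece x.2 y

end Decomposition

end

open Classical in
theorem isReducible_of_entry {V W : Type u} [Fintype W] {H : HoffmanGraph V} {K : HoffmanGraph W}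
    (e : Embedding H K) (hg : K.IsGood) (T : Set W)
    (hT : ∀ x ∈ K.slim, ∀ y ∈ K.slim, x ∉ T → y ∈ T → K.entry x y = 0) {x y : V}
    (hx : x ∈ H.slim) (hy : y ∈ H.slim) (hxT : e.toEmbedding x ∈ T)
    (hyT : e.toEmbedding y ∉ T) : H.IsReducible (-1 - Real.goldenRatio) := by
  have hs : ∀ z ∈ H.slim, e.toEmbedding z ∈ K.slim := fun z hz h => hz ((e.map_fat z).1 h)
  let D := K.decomposition (n := 2) (fun z => if z ∈ T then 0 else 1) (by
    intro a ha b hb hab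
    by_cases h1 : a ∈ T <;> by_cases h2 : b ∈ T <;> simp [h1, h2] at hab
    · rw [entry_symm]; exact hT b hb a ha h2 h1
    · exact hT a ha b hb h1 h2)
  refine ⟨W, inferInstance, K, e, D, fun i => ⟨(le_lambdaMin_iff _).2 (D.isGood_piece hg i), ?_⟩⟩
  fin_cases i
  · exact ⟨x, hx, Or.inl ⟨hs x hx, by simp [hxT]⟩⟩
  · exact ⟨y, hy, Or.inl ⟨hs y hy, by simp [hyT]⟩⟩

open Classical in
-- The matrix of a decomposed graph is block diagonal, so both parts are good iff the whole graph
-- is. What remains is a separation of the special graph of K.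
theorem isReducible_iff {V : Type u} {H : HoffmanGraph V} :
    H.IsReducible (-1 - Real.goldenRatio) ↔ ∃ (W : Type u) (_ : Fintype W) (K : HoffmanGraph W)
      (e : Embedding H K) (T : Set W), K.IsGood ∧
      (∀ x ∈ K.slim, ∀ y ∈ K.slim, x ∉ T → y ∈ T → K.entry x y = 0) ∧
      (∃ x ∈ H.slim, e.toEmbedding x ∈ T) ∧ ∃ x ∈ H.slim, e.toEmbedding x ∉ T := by
  constructor
  · rintro ⟨W, _, K, e, D, h⟩
    have hs : ∀ z ∈ H.slim, e.toEmbedding z ∈ K.slim := fun z hz h => hz ((e.map_fat z).1 h)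
    obtain ⟨x, hx, hx0⟩ := (h 0).2
    obtain ⟨y, hy, hy1⟩ := (h 1).2
    refine ⟨W, inferInstance, K, e, D.part 0,
      D.isGood_of_pieces fun i => (le_lambdaMin_iff _).1 (h i).1, ?_, ⟨x, hx, hx0⟩, y, hy, ?_⟩
    · intro a ha b hb ha0 hb0
      obtain ⟨i, hi⟩ := D.exists_mem a
      exact D.entry_eq_zero (i := i) (j := 0) (by rintro rfl; exact ha0 hi) ha hb hi hb0
    · intro hy0
      have := D.slim_disjoint 0 1 (by decide)
      exact (this ▸ ⟨⟨hy0, hs y hy⟩, hy1, hs y hy⟩ : e.toEmbedding y ∈ (∅ : Set W))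
  · rintro ⟨W, _, K, e, T, hg, hT, ⟨x, hx, hxT⟩, y, hy, hyT⟩
    exact isReducible_of_entry e hg T hT hx hy hxT hyT

end HoffmanGraph

open Real in
theorem psdForm_of_support_singleton {S : Type*} [Fintype S] (b : S → S → ℤ) {c : S → ℝ} {x : S}
    (hc : ∀ z, z ≠ x → c z = 0) : psdForm b c = c x ^ 2 * (b x x + 1 + goldenRatio) := by
  classical
  have hc' : Function.extend (fun _ : Fin 1 => x) (fun _ => c x) 0 = c := by
    have hf : Function.Injective (fun _ : Fin 1 => x) := fun _ _ _ => Subsingleton.elim _ _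
    funext z
    by_cases hz : z = x
    · subst hz
      exact hf.extend_apply _ _ 0
    · rw [hc z hz, Function.extend_apply' _ _ _ fun ⟨_, h⟩ => hz h.symm]; rfl
  rw [← hc', psdForm_extend b fun _ _ _ => Subsingleton.elim _ _, hc']
  simp [psdForm]
  ring

open Real in
theorem psdForm_of_support_pair {S : Type*} [Fintype S] (b : S → S → ℤ) {c : S → ℝ} {x y : S}
    (hxy : x ≠ y) (hc : ∀ z, z ≠ x → z ≠ y → c z = 0) :
    psdForm b c = c x ^ 2 * (b x x + 1 + goldenRatio) + c y ^ 2 * (b y y + 1 + goldenRatio) +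
      c x * c y * (b x y + b y x) := by
  have hf : Function.Injective ![x, y] := by
    intro i j; fin_cases i <;> fin_cases j <;> simp [hxy, hxy.symm]
  have hc' : Function.extend ![x, y] ![c x, c y] 0 = c := by
    funext z
    by_cases hz : z = x
    · subst hz
      exact hf.extend_apply _ _ 0
    by_cases hz' : z = y
    · subst hz'
      exact hf.extend_apply _ _ 1
    · rw [hc z hz hz', Function.extend_apply']; · rfl
      rintro ⟨i, rfl⟩
      fin_cases i
      · exact hz rfl
      · exact hz' rfl
  rw [← hc', psdForm_extend b hf, hc']
  simp [psdForm, Fin.sum_univ_two]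
  ring

/-! ### Attaching a fat vertex to a clique of the special graph -/

namespace HoffmanGraph

variable {V : Type*} {H : HoffmanGraph V} {U : Set V}

/-- The Hoffman graph with a further fat vertex, adjacent to the members of `U`. -/
def addFat (H : HoffmanGraph V) (U : Set V) (hs : U ⊆ H.slim) (hne : U.Nonempty) :
    HoffmanGraph (Option V) where
  graph :=
    { Adj := fun a b => match a, b with
        | some x, some y => H.graph.Adj x y
        | some x, none => x ∈ U
        | none, some y => y ∈ U
        | none, none => False
      symm := ⟨fun a b h => by
        rcases a with _ | x <;> rcases b with _ | y
        · exact h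
        · exact h
        · exact h
        · exact H.graph.symm.symm _ _ h⟩
      loopless := ⟨fun a h => by
        rcases a with _ | x
        · exact h
        · exact H.graph.irrefl h⟩ }
  fat := {a | ∀ x, a = some x → x ∈ H.fat}
  fat_adj_slim := by
    rintro (_ | f) hf
    · obtain ⟨u, hu⟩ := hne
      exact ⟨some u, fun h => hs hu (h u rfl), hu⟩
    · obtain ⟨x, hx, hfx⟩ := H.fat_adj_slim f (hf f rfl)
      exact ⟨some x, fun h => hx (h x rfl), hfx⟩
  fat_not_adj := by
    rintro (_ | f) hf (_ | g) hg h
    · exact h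
    · exact hs h (hg g rfl)
    · exact hs h (hf f rfl)
    · exact H.fat_not_adj f (hf f rfl) g (hg g rfl) h

section AddFat

variable {hs : U ⊆ H.slim} {hne : U.Nonempty}

theorem addFat_adj {x y : V} :
    (H.addFat U hs hne).graph.Adj (some x) (some y) ↔ H.graph.Adj x y := Iff.rfl

theorem addFat_adj_none {x : V} :
    (H.addFat U hs hne).graph.Adj (some x) none ↔ x ∈ U := Iff.rfl

theorem some_mem_addFat_fat {x : V} : some x ∈ (H.addFat U hs hne).fat ↔ x ∈ H.fat := by
  simp [addFat]

theorem none_mem_addFat_fat : none ∈ (H.addFat U hs hne).fat := by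
  simp [addFat]

theorem some_mem_addFat_slim {x : V} : some x ∈ (H.addFat U hs hne).slim ↔ x ∈ H.slim :=
  not_congr some_mem_addFat_fat

theorem mem_addFat_slim {a : Option V} :
    a ∈ (H.addFat U hs hne).slim ↔ ∃ x ∈ H.slim, a = some x := by
  rcases a with _ | x
  · simp [mem_slim, none_mem_addFat_fat]
  · simp [some_mem_addFat_slim]

theorem some_mem_addFat_fatNbrs {x f : V} :
    some f ∈ (H.addFat U hs hne).fatNbrs (some x) ↔ f ∈ H.fatNbrs x := by
  rw [mem_fatNbrs, mem_fatNbrs, some_mem_addFat_fat, addFat_adj]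

theorem none_mem_addFat_fatNbrs {x : V} :
    none ∈ (H.addFat U hs hne).fatNbrs (some x) ↔ x ∈ U := by
  simp [mem_fatNbrs, none_mem_addFat_fat, addFat_adj_none]

/-- The original graph is an induced subgraph of the extended graph. -/
def addFatEmbedding : Embedding H (H.addFat U hs hne) :=
  ⟨⟨Function.Embedding.some, addFat_adj⟩, fun _ => some_mem_addFat_fat⟩

open Classical in
theorem addFat_entry [Finite V] (x y : V) : (H.addFat U hs hne).entry (some x) (some y) =
    H.entry x y - if x ∈ U ∧ y ∈ U then 1 else 0 := by
  have h : (H.addFat U hs hne).fatNbrs (some x) ∩ (H.addFat U hs hne).fatNbrs (some y) =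
      some '' (H.fatNbrs x ∩ H.fatNbrs y) ∪ if x ∈ U ∧ y ∈ U then {none} else ∅ := by
    ext a
    rcases a with _ | f
    · by_cases hxy : x ∈ U ∧ y ∈ U <;> simp [hxy, none_mem_addFat_fatNbrs]
    · by_cases hxy : x ∈ U ∧ y ∈ U <;> simp [hxy, some_mem_addFat_fatNbrs]
  unfold entry
  rw [h, Set.ncard_union_eq (by split_ifs <;> simp) (Set.toFinite _) (Set.toFinite _),
    Set.ncard_image_of_injective _ (Option.some_injective V), addFat_adj]
  push_cast
  split_ifs <;> simp
  ring

theorem addFat_isFat (hf : H.IsFat) : (H.addFat U hs hne).IsFat := by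
  intro a ha
  obtain ⟨x, hx, rfl⟩ := mem_addFat_slim.1 ha
  obtain ⟨f, h⟩ := hf x hx
  exact ⟨some f, some_mem_addFat_fatNbrs.2 h⟩

end AddFat

/-- `U` is a clique of the special graph, of slim vertices with exactly one fat neighbour, to
each vertex of which at most one pendant vertex is attached, which also has exactly one fat
neighbour. -/
structure IsExtendable (H : HoffmanGraph V) (U : Set V) : Prop where
  slim : U ⊆ H.slim
  nontrivial : U.Nontrivial
  ncard : ∀ u ∈ U, (H.fatNbrs u).ncard = 1
  clique : ∀ u ∈ U, ∀ v ∈ U, u ≠ v → H.entry u v = 1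
  ncard_pendant : ∀ u ∈ U, ∀ x ∈ H.slim, x ∉ U → H.entry u x ≠ 0 → (H.fatNbrs x).ncard = 1
  pendant : ∀ u ∈ U, ∀ x ∈ H.slim, x ∉ U → ∀ y ∈ H.slim, y ∉ U → H.entry u x ≠ 0 →
    H.entry u y ≠ 0 → x = y
  indep : ∀ u ∈ U, ∀ x ∈ H.slim, x ∉ U → H.entry u x ≠ 0 → ∀ y ∈ H.slim, y ∉ U → x ≠ y →
    H.entry x y = 0
  unique : ∀ x ∈ H.slim, x ∉ U → ∀ u ∈ U, ∀ v ∈ U, H.entry u x ≠ 0 → H.entry v x ≠ 0 → u = v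

/-- The pairs of adjacent vertices of the special graph. -/
def special (H : HoffmanGraph V) : Set (V × V) :=
  {p | p.1 ∈ H.slim ∧ p.2 ∈ H.slim ∧ p.1 ≠ p.2 ∧ H.entry p.1 p.2 ≠ 0}

namespace IsExtendable

variable (hU : H.IsExtendable U)

include hU in
-- The edges inside the clique `U` disappear, all other off-diagonal entries are unchanged, and `U`
-- has at least one edge.
theorem ncard_special_lt [Finite V] :
    (H.addFat U hU.slim hU.nontrivial.nonempty).special.ncard < H.special.ncard := by
  classical
  obtain ⟨u, hu, v, hv, huv⟩ := hU.nontrivial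
  rw [← Set.ncard_image_of_injective H.special
    ((Option.some_injective V).prodMap (Option.some_injective V))]
  refine Set.ncard_lt_ncard (Set.ssubset_iff_of_subset ?_ |>.2 ⟨(some u, some v), ?_, ?_⟩)
    (Set.toFinite _)
  · rintro ⟨a, b⟩ ⟨ha, hb, hab, h⟩
    obtain ⟨x, hx, rfl⟩ := mem_addFat_slim.1 ha
    obtain ⟨y, hy, rfl⟩ := mem_addFat_slim.1 hb
    have hxy : x ≠ y := fun h => hab (by rw [h])
    refine ⟨(x, y), ⟨hx, hy, hxy, ?_⟩, rfl⟩
    rw [addFat_entry] at h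
    intro h0
    simp only [h0] at h
    split_ifs at h with hxyU
    · simp [hU.clique x hxyU.1 y hxyU.2 hxy] at h0
    · simp at h
  · exact ⟨(u, v), ⟨hU.slim hu, hU.slim hv, huv, by simp [hU.clique u hu v hv huv]⟩, rfl⟩
  · rintro ⟨-, -, -, h⟩
    simp [addFat_entry, hu, hv, hU.clique u hu v hv huv] at h

include hU in
theorem entry_pendant [Finite V] {u : V} (hu : u ∈ U) (x : V) :
    H.entry u x = 0 ∨ H.entry u x = 1 ∨ H.entry u x = -1 := by
  rw [entry_eq_mval (hU.ncard u hu)]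
  exact SignedCode.mval_cases _

open Classical Real in
include hU in
-- The new matrix is block diagonal: each clique vertex forms a block with its pendant vertex, if
-- there is one, and the remaining vertices keep their old entries.
theorem isGood_addFat [Fintype V] (hg : H.IsGood) :
    (H.addFat U hU.slim hU.nontrivial.nonempty).IsGood := by
  set K := H.addFat U hU.slim hU.nontrivial.nonempty
  let s : H.slim → K.slim := fun x => ⟨some x, some_mem_addFat_slim.2 x.2⟩
  have hsinj : Function.Injective s := fun x y h => by simpa [s, Subtype.ext_iff] using h
  have hsurj : Function.Surjective s := by
    rintro ⟨a, ha⟩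
    obtain ⟨x, hx, rfl⟩ := mem_addFat_slim.1 ha
    exact ⟨⟨x, hx⟩, rfl⟩
  let b : H.slim → H.slim → ℤ := fun x y => H.entry x y - if (x : V) ∈ U ∧ (y : V) ∈ U then 1 else 0
  have hbij : Function.Bijective s := ⟨hsinj, hsurj⟩
  suffices h : IsPsd b by
    have h' := h.comp (f := (Equiv.ofBijective s hbij).symm) (Equiv.injective _)
    refine h'.congr fun x y => ?_
    obtain ⟨x, rfl⟩ := hsurj x
    obtain ⟨y, rfl⟩ := hsurj y
    rw [Equiv.ofBijective_symm_apply_apply, Equiv.ofBijective_symm_apply_apply]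
    exact (addFat_entry x.1 y.1).symm
  -- The name of the block of `x`: the clique vertex that `x` equals or is attached to, and `none`
  -- for all other vertices.
  let r : H.slim → Option V := fun x => if (x : V) ∈ U then some x else
    if h : ∃ u ∈ U, H.entry u x ≠ 0 then some h.choose else none
  have hrU : ∀ x : H.slim, (x : V) ∈ U → r x = some (x : V) := fun x hx => by simp [r, hx]
  have hrP : ∀ x : H.slim, (x : V) ∉ U → ∀ u ∈ U, H.entry u x ≠ 0 → r x = some u := by
    intro x hx u hu h
    have h' : ∃ u ∈ U, H.entry u x ≠ 0 := ⟨u, hu, h⟩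
    simp only [r, hx, if_false, h', dif_pos]
    rw [hU.unique x x.2 hx _ h'.choose_spec.1 u hu h'.choose_spec.2 h]
  have hrN : ∀ x : H.slim, (x : V) ∉ U → (∀ u ∈ U, H.entry u x = 0) → r x = none := by
    intro x hx h
    have h' : ¬ ∃ u ∈ U, H.entry u x ≠ 0 := by push Not; exact h
    simp only [r, hx, if_false, h', dif_neg, not_false_eq_true]
  have hcase : ∀ x : H.slim, (x : V) ∉ U → (∃ u ∈ U, H.entry u x ≠ 0) ∨ ∀ u ∈ U, H.entry u x = 0 :=
    fun x _ => by
      by_cases h : ∃ u ∈ U, H.entry u x ≠ 0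
      · exact Or.inl h
      · push Not at h; exact Or.inr h
  have hbs : ∀ x y, b x y = b y x := fun x y => by
    simp only [b, H.entry_symm x y, and_comm]
  refine isPsd_of_fibers r ?_ ?_
  · intro x y hxy
    have hne : (x : V) ≠ y := fun h => hxy (by rw [Subtype.ext h])
    have mixed : ∀ x y : H.slim, r x ≠ r y → (x : V) ∈ U → (y : V) ∉ U → b x y = 0 := by
      intro x y hxy hx hy
      simp only [b, hy, and_false, if_false, sub_zero]
      by_contra h
      exact hxy ((hrU x hx).trans (hrP y hy x hx h).symm)
    by_cases hx : (x : V) ∈ U <;> by_cases hy : (y : V) ∈ U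
    · simp [b, hx, hy, hU.clique x hx y hy hne]
    · exact mixed x y hxy hx hy
    · rw [hbs]; exact mixed y x hxy.symm hy hx
    · simp only [b, hx, false_and, if_false, sub_zero]
      rcases hcase x hx with ⟨u, hu, h⟩ | h
      · exact hU.indep u hu x x.2 hx h y y.2 hy hne
      rcases hcase y hy with ⟨u, hu, h'⟩ | h'
      · rw [entry_symm]
        exact hU.indep u hu y y.2 hy h' x x.2 hx hne.symm
      · exact absurd ((hrN x hx h).trans (hrN y hy h').symm) hxy
  · rintro (_ | u) c hc
    · have h0 : ∀ x : H.slim, (x : V) ∈ U → c x = 0 := fun x hx => hc x (by rw [hrU x hx]; simp)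
      have : psdForm b c = psdForm (fun x y : H.slim => H.entry x y) c := by
        unfold psdForm
        congr 1
        refine Finset.sum_congr rfl fun x _ => Finset.sum_congr rfl fun y _ => ?_
        by_cases hx : (x : V) ∈ U
        · simp [h0 x hx]
        · simp [b, hx]
      rw [this]
      exact hg c
    · by_cases hu : u ∈ U
      · let u' : H.slim := ⟨u, hU.slim hu⟩
        have hbu : b u' u' = -2 := by
          simp only [b, u', entry_self, hU.ncard u hu]; simp [hu]
        have hτ := lt_goldenRatio
        by_cases hp : ∃ p ∈ H.slim, p ∉ U ∧ H.entry u p ≠ 0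
        · obtain ⟨p, hps, hpU, hp⟩ := hp
          let p' : H.slim := ⟨p, hps⟩
          have hbp : b p' p' = -1 := by
            simp only [b, p', entry_self, hU.ncard_pendant u hu p hps hpU hp]; simp [hpU]
          have hbup : b u' p' = H.entry u p := by simp [b, u', p', hpU]
          have hne : u' ≠ p' := fun h => hpU (by
            rw [← show u = p from Subtype.ext_iff.1 h]; exact hu)
          rw [psdForm_of_support_pair b hne, hbs p' u', hbu, hbp, hbup]
          · have h1 : (H.entry u p : ℝ) * H.entry u p = 1 := by
              rcases hU.entry_pendant hu p with h | h | h
              · exact absurd h hp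
              · rw [h]; norm_num
              · rw [h]; norm_num
            have h2 := goldenRatio_sq
            -- Since (τ-1)τ = 1, the singular block [[τ-1, ε], [ε, τ]] is this multiple of a single
            -- square.
            have h3 : 0 ≤ (goldenRatio - 1) * (c u' + goldenRatio * H.entry u p * c p') ^ 2 :=
              mul_nonneg (by linarith) (sq_nonneg _)
            push_cast
            generalize (H.entry u p : ℝ) = ε at *
            have h4 : (goldenRatio - 1) * goldenRatio = 1 := by linear_combination h2
            linear_combination h3 + (2 * ε * c u' * c p' + goldenRatio * c p' ^ 2 * ε ^ 2) * h4 +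
              (c p' ^ 2 * goldenRatio) * h1
          · intro z hzu hzp
            refine hc z fun h => ?_
            by_cases hz : (z : V) ∈ U
            · rw [hrU z hz] at h
              exact hzu (Subtype.ext (Option.some_injective _ h))
            · rcases hcase z hz with ⟨v, hv, h'⟩ | h'
              · rw [hrP z hz v hv h'] at h
                obtain rfl := Option.some_injective _ h
                exact hzp (Subtype.ext (hU.pendant v hv z z.2 hz p hps hpU h' hp))
              · rw [hrN z hz h'] at h
                simp at h
        · push Not at hp
          rw [psdForm_of_support_singleton b (x := u'), hbu]
          · have : 0 ≤ c u' ^ 2 * (goldenRatio - 1) := mul_nonneg (sq_nonneg _) (by linarith)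
            push_cast
            linarith
          · intro z hzu
            refine hc z fun h => ?_
            by_cases hz : (z : V) ∈ U
            · rw [hrU z hz] at h
              exact hzu (Subtype.ext (Option.some_injective _ h))
            · rcases hcase z hz with ⟨v, hv, h'⟩ | h'
              · rw [hrP z hz v hv h'] at h
                obtain rfl := Option.some_injective _ h
                exact h' (hp z z.2 hz)
              · rw [hrN z hz h'] at h
                simp at h
      · have h0 : c = 0 := by
          funext z
          refine hc z fun h => ?_
          by_cases hz : (z : V) ∈ U
          · rw [hrU z hz] at h
            exact hu (Option.some_injective _ h ▸ hz)
          · rcases hcase z hz with ⟨v, hv, h'⟩ | h'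
            · rw [hrP z hz v hv h'] at h
              exact hu (Option.some_injective _ h ▸ hv)
            · rw [hrN z hz h'] at h
              simp at h
        simp [h0, psdForm]

end IsExtendable

end HoffmanGraph

/-! ### Components of the special graph -/

namespace HoffmanGraph

open SignedCode

variable {V : Type*} {H : HoffmanGraph V}

/-- `T` is the vertex set of a connected component of the special graph. -/
structure IsComponent (H : HoffmanGraph V) (T : Set V) : Prop where
  slim : T ⊆ H.slim
  nonempty : T.Nonempty
  closed : ∀ x ∈ H.slim, x ∉ T → ∀ y ∈ T, H.entry x y = 0
  connected : ∀ T' ⊆ T, T'.Nonempty → (∀ x ∈ T, x ∉ T' → ∀ y ∈ T', H.entry x y = 0) → T' = T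

theorem signed_enc {T : Set V} (hT : ∀ x ∈ T, (H.fatNbrs x).ncard = 1) [DecidableEq T] {x y : T}
    (hxy : x ≠ y) : signed (fun x y : T => H.enc x y) x y = H.entry x y := by
  rw [signed_of_ne hxy, entry_eq_mval (hT x x.2)]

/-- Entries between a component and its complement vanish, so the conditions on the component hold
in the whole graph. -/
theorem IsComponent.isExtendable {T : Set V} (h : H.IsComponent T)
    (hT : ∀ x ∈ T, (H.fatNbrs x).ncard = 1) [DecidableEq T] {U : Set T}
    (hU : IsPendantClique (signed fun x y : T => H.enc x y) U) :
    H.IsExtendable (Subtype.val '' U) := by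
  have mem : ∀ u ∈ Subtype.val '' U, ∀ x ∈ H.slim, x ∉ Subtype.val '' U → H.entry u x ≠ 0 →
      ∃ (u' x' : T), (u' : V) = u ∧ (x' : V) = x ∧ u' ∈ U ∧ x' ∉ U ∧
        signed (fun x y : T => H.enc x y) u' x' ≠ 0 := by
    rintro _ ⟨u, hu, rfl⟩ x hx hxU hux
    have hxT : x ∈ T := by
      by_contra hxT
      rw [entry_symm] at hux
      exact hux (h.closed x hx hxT u u.2)
    have hxU' : (⟨x, hxT⟩ : T) ∉ U := fun h => hxU ⟨_, h, rfl⟩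
    refine ⟨u, ⟨x, hxT⟩, rfl, rfl, hu, hxU', ?_⟩
    have hne : u ≠ ⟨x, hxT⟩ := fun h => hxU' (h ▸ hu)
    rwa [signed_enc hT hne]
  refine ⟨?_, hU.nontrivial.image Subtype.val_injective, ?_, ?_, ?_, ?_, ?_, ?_⟩
  · rintro _ ⟨u, -, rfl⟩
    exact h.slim u.2
  · rintro _ ⟨u, -, rfl⟩
    exact hT u u.2
  · rintro _ ⟨u, hu, rfl⟩ _ ⟨v, hv, rfl⟩ huv
    have huv' : u ≠ v := fun h => huv (by rw [h])
    rw [← signed_enc hT huv']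
    exact hU.clique u hu v hv huv'
  · intro u hu x hx hxU hux
    obtain ⟨-, x, -, rfl, -⟩ := mem u hu x hx hxU hux
    exact hT x x.2
  · intro u hu x hx hxU y hy hyU hux huy
    obtain ⟨u', x, hu', rfl, hu, hxU, hux⟩ := mem u hu x hx hxU hux
    obtain ⟨u'', y, hu'', rfl, -, hyU, huy⟩ := mem u ‹_› y hy hyU huy
    obtain rfl : u' = u'' := Subtype.ext (hu'.trans hu''.symm)
    rw [hU.pendant u' hu x hxU y hyU hux huy]
  · intro u hu x hx hxU hux y hy hyU hxy
    obtain ⟨u', x, hu', rfl, hu, hxU, hux⟩ := mem u hu x hx hxU hux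
    by_cases hyT : y ∈ T
    · have hyU' : (⟨y, hyT⟩ : T) ∉ U := fun h => hyU ⟨_, h, rfl⟩
      have hxy' : x ≠ ⟨y, hyT⟩ := fun h => hxy (by rw [h])
      have := hU.indep x hxU ⟨y, hyT⟩ hyU' hxy'
      rwa [signed_enc hT hxy'] at this
    · rw [entry_symm]
      exact h.closed y hy hyT x x.2
  · intro x hx hxU u hu v hv hux hvx
    obtain ⟨u', x', hu', hx', hu1, hx1, hux⟩ := mem u hu x hx hxU hux
    obtain ⟨v', x'', hv', hx'', hv1, -, hvx⟩ := mem v hv x hx hxU hvx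
    obtain rfl : x' = x'' := Subtype.ext (hx'.trans hx''.symm)
    have he : IsCode fun x y : T => H.enc x y :=
      isCode_enc Subtype.val fun s => subsingleton_fatNbrs (hT s s.2)
    rw [← hu', ← hv', hU.unique x' hx1 u' hu1 v' hv1 (by rwa [signed_symm he])
      (by rwa [signed_symm he])]

theorem exists_maximalList_of_mem_targets {C : List (List ℕ)} (hC : C ∈ targets) :
    ∃ i : Fin 20, (maximalList i).HasCode C := by
  obtain ⟨k, hk, rfl⟩ := List.mem_iff_getElem.1 hC
  have hk' : k < 18 := hk
  have := FinHoffmanGraph.hasCode_maximalList ⟨k, hk'⟩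
  rw [List.getD_eq_getElem _ _ hk] at this
  exact ⟨_, this⟩

open Classical in
/-- The components of the special graph of a fat Hoffman graph with smallest eigenvalue at least
`-1 - τ`. -/
theorem IsComponent.exists_localEmbedding [Fintype V] (hg : H.IsGood) (hf : H.IsFat) {T : Set V}
    (h : H.IsComponent T) : (∃ U, H.IsExtendable U) ∨
      ∃ i, Nonempty (LocalEmbedding H T (maximalList i).toHoffman) := by
  have hsymm : ∀ x y : H.slim, H.entry x y = H.entry y x := fun x y => H.entry_symm x y
  by_cases h2 : ∃ x ∈ T, (H.fatNbrs x).ncard = 2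
  · right
    obtain ⟨x, hxT, hx⟩ := h2
    by_cases hTx : ({x} : Set V) = T
    · rw [← hTx]
      exact ⟨_, nonempty_localEmbedding_singleton (h.slim hxT) hx⟩
    have : ∃ y ∈ T, y ≠ x ∧ H.entry y x ≠ 0 := by
      by_contra hcon
      push Not at hcon
      exact hTx (h.connected {x} (by simpa using hxT) (Set.singleton_nonempty x)
        fun y hy hyx z hz => by rw [Set.mem_singleton_iff.1 hz]; exact hcon y hy hyx)
    obtain ⟨y, hyT, hyx, hne⟩ := this
    have hne' : (⟨x, h.slim hxT⟩ : H.slim) ≠ ⟨y, h.slim hyT⟩ := fun h => hyx (by simpa using h.symm)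
    have hbx : H.entry x x = -2 := by simp [entry_self, hx]
    have hy : (H.fatNbrs y).ncard = 1 := by
      refine (hg.ncard_fatNbrs hf (h.slim hyT)).resolve_right fun hy => hne ?_
      have hby : H.entry y y = -2 := by simp [entry_self, hy]
      rw [entry_symm]
      exact IsPsd.eq_zero_of_two_two hg hsymm hne' hbx hby
    have hby : H.entry y y = -1 := by simp [entry_self, hy]
    have hm := H.entry_symm x y
    rw [entry_eq_mval hy] at hm
    rw [entry_eq_mval hy] at hne
    -- The determinant of the block of `x` and `y` vanishes, which isolates the pair. Its code is 1
    -- or 2, and these lead to the first and the second listed graph.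
    have hpair : ({x, y} : Set V) = T := by
      refine h.connected {x, y} ?_ ⟨x, by simp⟩ ?_
      · rintro z (rfl | rfl)
        · exact hxT
        · exact hyT
      · intro z hz hzxy w hw
        simp only [Set.mem_insert_iff, Set.mem_singleton_iff, not_or] at hzxy hw
        have := IsPsd.isolated hg hsymm hne' (z := ⟨z, h.slim hz⟩)
          (fun h => hzxy.1 (by simpa using h.symm)) (fun h => hzxy.2 (by simpa using h.symm))
          hbx hby (by
            simp only [hm]
            exact (mval_cases _).resolve_left hne)
        rw [entry_symm]
        rcases hw with rfl | rfl
        · exact this.1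
        · exact this.2
    have hlt := H.enc_lt y x
    have h1 := enc_mod (H := H) (x := y) (y := x)
    have h2 := two_le_enc (H := H) (x := y) (y := x)
    rw [H.graph.adj_comm] at h1
    rw [Set.inter_comm] at h2
    rw [← hpair]
    generalize H.enc y x = a at hlt h1 h2 hne
    interval_cases a
    · exact absurd rfl hne
    · refine ⟨_, nonempty_localEmbedding_pair_adj (h.slim hxT) (h.slim hyT) hx hy (h1.1 rfl) ?_⟩
      refine Set.not_nonempty_iff_eq_empty.1 fun h => ?_
      exact absurd (h2.2 h) (by decide)
    · exact ⟨_, nonempty_localEmbedding_pair_not_adj (h.slim hxT) (h.slim hyT) hyx.symm hx hy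
        (fun h => absurd (h1.2 h) (by decide)) (h2.1 le_rfl)⟩
    · exact absurd rfl hne
  · have hT : ∀ x ∈ T, (H.fatNbrs x).ncard = 1 := fun x hx =>
      (hg.ncard_fatNbrs hf (h.slim hx)).resolve_right fun h' => h2 ⟨x, hx, h'⟩
    have he : IsCode fun x y : T => H.enc x y :=
      isCode_enc Subtype.val fun s => subsingleton_fatNbrs (hT s s.2)
    rcases exists_target he (hg.isGood_enc h.slim hT) (fun T' hT' hcl => by
      have h1 := h.connected (Subtype.val '' T') (by rintro _ ⟨x, -, rfl⟩; exact x.2)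
        (hT'.image _) (by
          rintro x hx hx' _ ⟨y, hy, rfl⟩
          rw [entry_eq_mval (hT x hx)]
          exact hcl ⟨x, hx⟩ (fun h => hx' ⟨_, h, rfl⟩) y hy)
      refine Set.eq_univ_iff_forall.2 fun x => ?_
      obtain ⟨y, hy, hyx⟩ := (Set.ext_iff.1 h1 x).2 x.2
      rwa [← Subtype.ext hyx]) with ⟨U, hU⟩ | ⟨C, hC, φ, hφ, hlt, hlook⟩
    · exact Or.inl ⟨_, h.isExtendable hT hU⟩
    · right
      obtain ⟨i, hi⟩ := exists_maximalList_of_mem_targets hC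
      obtain ⟨x, hx⟩ := h.nonempty
      have : Nonempty (maximalList i).V := by
        obtain ⟨l, -, -, hl⟩ := hi.list
        have h1 := hlt ⟨x, hx⟩
        rw [← hl, length_code] at h1
        exact ⟨l[φ ⟨x, hx⟩]⟩
      exact ⟨i, nonempty_localEmbedding_of_hasCode hi h.slim hT φ hφ hlt hlook⟩

/-- The equivalence relation whose classes are the components of the special graph. -/
def specialSetoid (H : HoffmanGraph V) : Setoid H.slim :=
  Relation.EqvGen.setoid fun x y => H.entry x y ≠ 0

/-- The vertex set of a component of the special graph. -/
def componentSet (H : HoffmanGraph V) (c : Quotient H.specialSetoid) : Set V :=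
  Subtype.val '' {x : H.slim | Quotient.mk _ x = c}

theorem mem_componentSet {c : Quotient H.specialSetoid} (x : H.slim) :
    (x : V) ∈ H.componentSet c ↔ Quotient.mk _ x = c := by
  simp [componentSet]

theorem isComponent_componentSet (c : Quotient H.specialSetoid) :
    H.IsComponent (H.componentSet c) where
  slim := by
    rintro _ ⟨x, -, rfl⟩
    exact x.2
  nonempty := by
    obtain ⟨x, rfl⟩ := Quotient.exists_rep c
    exact ⟨x, (mem_componentSet x).2 rfl⟩
  closed := by
    rintro x hx hxc _ ⟨y, rfl, rfl⟩
    by_contra h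
    exact hxc ((mem_componentSet ⟨x, hx⟩).2 (Quotient.sound (Relation.EqvGen.rel _ _ h)))
  connected := by
    rintro T' hT' ⟨a, ha⟩ hcl
    refine hT'.antisymm ?_
    obtain ⟨a, rfl, rfl⟩ := hT' ha
    rintro _ ⟨x, hx, rfl⟩
    have hrel : Relation.EqvGen (fun x y : H.slim => H.entry x y ≠ 0) a x :=
      Quotient.exact (s := H.specialSetoid) hx.symm
    have key : ∀ x y : H.slim, Relation.EqvGen (fun x y : H.slim => H.entry x y ≠ 0) x y →
        ((x : V) ∈ T' ↔ (y : V) ∈ T') := by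
      intro x y hxy
      induction hxy with
      | rel x y hxy =>
        have half : ∀ x y : H.slim, H.entry x y ≠ 0 → (x : V) ∈ T' → (y : V) ∈ T' := by
          intro x y hxy hx
          by_contra hy
          refine hxy ?_
          rw [entry_symm]
          refine hcl y ?_ hy x hx
          obtain ⟨x', hx', hxx⟩ := hT' hx
          obtain rfl := Subtype.ext hxx
          rw [← hx']
          refine (mem_componentSet y).2 (Quotient.sound (Relation.EqvGen.symm _ _
            (Relation.EqvGen.rel _ _ hxy)))
        exact ⟨half x y hxy, half y x (by rwa [entry_symm])⟩
      | refl x => exact Iff.rfl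
      | symm x y _ ih => exact ih.symm
      | trans x y z _ _ h1 h2 => exact h1.trans h2
    exact (key a x hrel).1 ha

end HoffmanGraph

/-! ### Embeddings, line graphs, and reducibility of pendant cliques -/

namespace HoffmanGraph

section

variable {V : Type u} {W : Type v} {X : Type w} {H : HoffmanGraph V} {K : HoffmanGraph W}
  {L : HoffmanGraph X}

/-- The identity embedding. -/
def Embedding.refl (H : HoffmanGraph V) : Embedding H H := ⟨RelEmbedding.refl _, fun _ => Iff.rfl⟩

/-- The composition of two embeddings. -/
def Embedding.trans (e : Embedding H K) (f : Embedding K L) : Embedding H L :=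
  ⟨e.toEmbedding.trans f.toEmbedding, fun x => (f.map_fat _).trans (e.map_fat x)⟩

theorem IsInducedIn.trans (h : H.IsInducedIn K) (h' : K.IsInducedIn L) : H.IsInducedIn L :=
  h.elim fun e => h'.elim fun f => ⟨e.trans f⟩

theorem Iso.isInducedIn (e : Iso H K) : H.IsInducedIn K := ⟨⟨e.toIso.toRelEmbedding, e.map_fat⟩⟩

theorem IsLineGraph.of_isInducedIn {𝓗 : Set FinHoffmanGraph.IsoClass} (h : H.IsInducedIn K)
    (hK : K.IsLineGraph 𝓗) : H.IsLineGraph 𝓗 := by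
  obtain ⟨W, _, M, hM, h'⟩ := hK
  exact ⟨W, _, M, h.trans hM, h'⟩

theorem LocalEmbedding.isInducedIn {T : Set V} (g : LocalEmbedding H T L) (hT : H.slim ⊆ T) :
    H.IsInducedIn L := by
  have h : ∀ v, v ∈ H.hull T := by
    intro v
    by_cases hv : v ∈ H.fat
    · obtain ⟨x, hx, hvx⟩ := H.fat_adj_slim v hv
      exact Or.inr ⟨x, hT hx, hv, hvx.symm⟩
    · exact Or.inl (hT hv)
  exact ⟨⟨⟨⟨g.toFun, fun v w hvw => g.inj (h v) (h w) hvw⟩, fun {v w} => g.adj v (h v) w (h w)⟩,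
    fun v => g.fat v (h v)⟩⟩

open Classical in
-- After the fat vertex has been attached, a clique vertex `u` and its pendant vertex split off from
-- a second clique vertex `v`.
theorem IsExtendable.isReducible [Fintype V] (hg : H.IsGood) {U : Set V}
    (hU : H.IsExtendable U) : H.IsReducible (-1 - Real.goldenRatio) := by
  obtain ⟨u, hu, v, hv, huv⟩ := hU.nontrivial
  refine isReducible_of_entry addFatEmbedding (hU.isGood_addFat hg)
    (some '' {x | x ∈ H.slim ∧ (x = u ∨ x ∉ U ∧ H.entry u x ≠ 0)}) ?_ (hU.slim hu) (hU.slim hv)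
    ⟨u, ⟨hU.slim hu, Or.inl rfl⟩, rfl⟩ ?_
  · rintro a ha _ - hx' ⟨y, ⟨hy, hy'⟩, rfl⟩
    obtain ⟨x, hx, rfl⟩ := mem_addFat_slim.1 ha
    have hxu : x ≠ u := fun h => hx' ⟨x, ⟨hx, Or.inl h⟩, rfl⟩
    have hxp : x ∈ U ∨ H.entry u x = 0 := by
      by_contra! h
      exact hx' ⟨x, ⟨hx, Or.inr h⟩, rfl⟩
    have hxy : x ≠ y := by
      rintro rfl
      exact hx' ⟨x, ⟨hx, hy'⟩, rfl⟩
    rw [addFat_entry]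
    rcases hy' with rfl | ⟨hyU, hy'⟩
    · by_cases hxU : x ∈ U
      · simp [hxU, hu, hU.clique x hxU y hu hxu]
      · rw [entry_symm, hxp.resolve_left hxU]
        simp [hxU]
    · simp only [hyU, and_false, if_false, sub_zero]
      by_cases hxU : x ∈ U
      · by_contra h
        exact hxu (hU.unique y hy hyU x hxU u hu h hy')
      · rw [entry_symm]
        exact hU.indep u hu y hy hyU hy' x hx hxU hxy.symm
  · rintro ⟨x, ⟨-, hx⟩, hxv⟩
    obtain rfl : x = v := Option.some_injective _ hxv
    rcases hx with rfl | hx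
    · exact huv rfl
    · exact hx.1 hv

end

end HoffmanGraph

namespace FinHoffmanGraph

open HoffmanGraph

/-- Every fat irreducible Hoffman graph is an induced subgraph of one of the listed graphs. -/
theorem IsFatIrreducible.exists_isInducedIn {G : FinHoffmanGraph}
    (h : G.IsFatIrreducible (-1 - Real.goldenRatio)) :
    ∃ i, G.toHoffman.IsInducedIn (maximalList i).toHoffman := by
  classical
  obtain ⟨hf, hl, hirr⟩ := h
  have hg := (le_lambdaMin_iff G.toHoffman).1 hl
  rcases G.toHoffman.slim.eq_empty_or_nonempty with h0 | ⟨x, hx⟩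
  · have : IsEmpty G.V := ⟨fun v => by
      by_cases hv : v ∈ G.toHoffman.fat
      · obtain ⟨x, hx, -⟩ := G.toHoffman.fat_adj_slim v hv
        exact (h0 ▸ hx : x ∈ (∅ : Set G.V))
      · exact (h0 ▸ hv : v ∈ (∅ : Set G.V))⟩
    exact ⟨0, ⟨⟨⟨⟨fun v => isEmptyElim v, fun v => isEmptyElim v⟩, fun {v} => isEmptyElim v⟩,
      fun v => isEmptyElim v⟩⟩⟩
  · set T := G.toHoffman.componentSet (Quotient.mk _ ⟨x, hx⟩) with hT
    have hc : G.toHoffman.IsComponent T := isComponent_componentSet _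
    have hxT : x ∈ T := (mem_componentSet ⟨x, hx⟩).2 rfl
    -- An irreducible graph has a connected special graph, since otherwise the graph itself splits.
    have hsub : G.toHoffman.slim ⊆ T := by
      intro y hy
      by_contra hyT
      exact hirr (isReducible_of_entry (Embedding.refl _) hg T
        (fun a ha b _ haT hbT => hc.closed a ha haT b hbT) hx hy hxT hyT)
    rcases hc.exists_localEmbedding hg hf with ⟨U, hU⟩ | ⟨i, ⟨g⟩⟩
    · exact absurd (hU.isReducible hg) hirr
    · exact ⟨i, g.isInducedIn hsub⟩

end FinHoffmanGraph

/-! ### Gluing Hoffman graphs along fat vertices -/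

namespace HoffmanGraph

open FinHoffmanGraph

/-- Maps of finite Hoffman graphs into a set, along which the Hoffman graphs can be glued. -/
structure GluingData (W : Type) {n : ℕ} (L : Fin n → FinHoffmanGraph) where
  map : ∀ c, (L c).V → W
  injective : ∀ c, Function.Injective (map c)
  surjective : ∀ w, ∃ c a, map c a = w
  fat : ∀ c d, c ≠ d → ∀ a b, map c a = map d b →
    a ∈ (L c).toHoffman.fat ∧ b ∈ (L d).toHoffman.fat
  unique : ∀ c d, c ≠ d → ∀ a ∈ (L c).toHoffman.slim, ∀ b ∈ (L d).toHoffman.slim,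
    ∀ f ∈ (L c).toHoffman.fatNbrs a, ∀ f' ∈ (L c).toHoffman.fatNbrs a,
    ∀ g ∈ (L d).toHoffman.fatNbrs b, ∀ g' ∈ (L d).toHoffman.fatNbrs b,
    map c f = map d g → map c f' = map d g' → f = f'

namespace GluingData

variable {W : Type} {n : ℕ} {L : Fin n → FinHoffmanGraph} (D : GluingData W L)

include D in
theorem eq_of_slim {c d : Fin n} {a : (L c).V} {b : (L d).V} (h : D.map c a = D.map d b)
    (ha : a ∈ (L c).toHoffman.slim) : c = d := by
  by_contra hcd
  exact ha (D.fat c d hcd a b h).1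

include D in
theorem fat_iff {c d : Fin n} {a : (L c).V} {b : (L d).V} (h : D.map c a = D.map d b) :
    a ∈ (L c).toHoffman.fat ↔ b ∈ (L d).toHoffman.fat := by
  by_cases hcd : c = d
  · subst hcd
    rw [D.injective c h]
  · exact iff_of_true (D.fat c d hcd a b h).1 (D.fat c d hcd a b h).2

/-- The relation between slim vertices of different parts with a common fat neighbour. -/
def Cross (w w' : W) : Prop :=
  ∃ c d, c ≠ d ∧ ∃ a ∈ (L c).toHoffman.slim, ∃ b ∈ (L d).toHoffman.slim, D.map c a = w ∧
    D.map d b = w' ∧ ∃ f ∈ (L c).toHoffman.fatNbrs a, ∃ g ∈ (L d).toHoffman.fatNbrs b,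
      D.map c f = D.map d g

/-- The adjacency of vertices of the same part. -/
def Inner (w w' : W) : Prop :=
  ∃ c a b, D.map c a = w ∧ D.map c b = w' ∧ (L c).toHoffman.graph.Adj a b

theorem inner_iff {c : Fin n} {a b : (L c).V} :
    D.Inner (D.map c a) (D.map c b) ↔ (L c).toHoffman.graph.Adj a b := by
  constructor
  · rintro ⟨d, a', b', ha, hb, h⟩
    by_cases hcd : d = c
    · subst hcd
      rwa [← D.injective d ha, ← D.injective d hb]
    · exact absurd h ((L d).toHoffman.fat_not_adj _ (D.fat d c hcd _ _ ha).1 _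
        (D.fat d c hcd _ _ hb).1)
  · exact fun h => ⟨c, a, b, rfl, rfl, h⟩

/-- The glued Hoffman graph. -/
def glued : HoffmanGraph W where
  graph :=
    { Adj := fun w w' => D.Inner w w' ∨ D.Cross w w'
      symm := ⟨by
        rintro w w' (⟨c, a, b, h1, h2, h⟩ | ⟨c, d, hcd, a, ha, b, hb, h1, h2, f, hf, g, hg, h⟩)
        · exact Or.inl ⟨c, b, a, h2, h1, h.symm⟩
        · exact Or.inr ⟨d, c, hcd.symm, b, hb, a, ha, h2, h1, g, hg, f, hf, h.symm⟩⟩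
      loopless := ⟨by
        rintro w (⟨c, a, b, h1, h2, h⟩ | ⟨c, d, hcd, a, ha, b, hb, h1, h2, -⟩)
        · exact h.ne (D.injective c (h1.trans h2.symm))
        · exact hcd (D.eq_of_slim (h1.trans h2.symm) ha)⟩ }
  fat := {w | ∃ c, ∃ a ∈ (L c).toHoffman.fat, D.map c a = w}
  fat_adj_slim := by
    rintro _ ⟨c, f, hf, rfl⟩
    obtain ⟨x, hx, hfx⟩ := (L c).toHoffman.fat_adj_slim f hf
    refine ⟨D.map c x, ?_, Or.inl ⟨c, f, x, rfl, rfl, hfx⟩⟩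
    rintro ⟨d, b, hb, h⟩
    exact hx ((D.fat_iff h).1 hb)
  fat_not_adj := by
    rintro _ ⟨c, f, hf, rfl⟩ _ ⟨d, g, hg, rfl⟩
      (⟨e, a, b, h1, h2, h⟩ | ⟨_, _, _, a, ha, b, hb, h1, -⟩)
    · exact (L e).toHoffman.fat_not_adj a ((D.fat_iff h1).2 hf) b ((D.fat_iff h2).2 hg) h
    · exact ha ((D.fat_iff h1).2 hf)

theorem map_mem_fat {c : Fin n} {a : (L c).V} :
    D.map c a ∈ D.glued.fat ↔ a ∈ (L c).toHoffman.fat :=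
  ⟨fun ⟨_, _, hb, h⟩ => (D.fat_iff h).1 hb, fun h => ⟨c, a, h, rfl⟩⟩

theorem map_mem_slim {c : Fin n} {a : (L c).V} :
    D.map c a ∈ D.glued.slim ↔ a ∈ (L c).toHoffman.slim :=
  not_congr D.map_mem_fat

theorem adj_map {c : Fin n} {a b : (L c).V} :
    D.glued.graph.Adj (D.map c a) (D.map c b) ↔ (L c).toHoffman.graph.Adj a b := by
  rw [← D.inner_iff]
  refine or_iff_left ?_
  rintro ⟨d, e, hde, a', ha', b', hb', h1, h2, -⟩
  exact hde ((D.eq_of_slim h1 ha').trans (D.eq_of_slim h2 hb').symm)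

theorem adj_map_of_ne {c d : Fin n} (hcd : c ≠ d) {a : (L c).V} {b : (L d).V}
    (ha : a ∈ (L c).toHoffman.slim) (hb : b ∈ (L d).toHoffman.slim) :
    D.glued.graph.Adj (D.map c a) (D.map d b) ↔ ∃ f ∈ (L c).toHoffman.fatNbrs a,
      ∃ g ∈ (L d).toHoffman.fatNbrs b, D.map c f = D.map d g := by
  constructor
  · rintro (⟨e, a', b', h1, h2, -⟩ | ⟨c', d', _, a', ha', b', hb', h1, h2, h⟩)
    · exact absurd ((D.eq_of_slim h1.symm ha).trans (D.eq_of_slim h2.symm hb).symm) hcd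
    · obtain rfl := D.eq_of_slim h1 ha'
      obtain rfl := D.eq_of_slim h2 hb'
      obtain rfl := D.injective _ h1
      obtain rfl := D.injective _ h2
      exact h
  · exact fun h => Or.inr ⟨c, d, hcd, a, ha, b, hb, rfl, rfl, h⟩

theorem fatNbrs_map {c : Fin n} {a : (L c).V} (ha : a ∈ (L c).toHoffman.slim) :
    D.glued.fatNbrs (D.map c a) = D.map c '' (L c).toHoffman.fatNbrs a := by
  ext w
  constructor
  · rintro ⟨hw, ⟨d, a', b, h1, rfl, h⟩ | ⟨_, d, _, _, _, b, hb, _, rfl, -⟩⟩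
    · obtain rfl := D.eq_of_slim h1.symm ha
      obtain rfl := D.injective _ h1
      exact ⟨b, ⟨D.map_mem_fat.1 hw, h⟩, rfl⟩
    · exact absurd hw (D.map_mem_slim.2 hb)
  · rintro ⟨f, hf, rfl⟩
    exact ⟨D.map_mem_fat.2 hf.1, D.adj_map.2 hf.2⟩

/-- Slim vertices of different parts share at most one fat neighbour by `unique`, and adjacency
between parts was defined as sharing one. -/
theorem entry_map_of_ne [Finite W] {c d : Fin n} (hcd : c ≠ d) {a : (L c).V} {b : (L d).V}
    (ha : a ∈ (L c).toHoffman.slim) (hb : b ∈ (L d).toHoffman.slim) :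
    D.glued.entry (D.map c a) (D.map d b) = 0 := by
  have hsub : (D.glued.fatNbrs (D.map c a) ∩ D.glued.fatNbrs (D.map d b)).encard ≤ 1 := by
    rw [D.fatNbrs_map ha, D.fatNbrs_map hb, Set.encard_le_one_iff]
    rintro _ _ ⟨⟨f, hf, rfl⟩, g, hg, h⟩ ⟨⟨f', hf', rfl⟩, g', hg', h'⟩
    rw [D.unique c d hcd a ha b hb f hf f' hf' g hg g' hg' h.symm h'.symm]
  refine entry_eq_zero_iff.2 ⟨hsub, ?_⟩
  have : (D.glued.fatNbrs (D.map c a) ∩ D.glued.fatNbrs (D.map d b)).encard = 1 ↔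
      (D.glued.fatNbrs (D.map c a) ∩ D.glued.fatNbrs (D.map d b)).Nonempty := by
    rw [← Set.one_le_encard_iff_nonempty]
    exact ⟨fun h => h.ge, fun h => le_antisymm hsub h⟩
  rw [this, D.adj_map_of_ne hcd ha hb, D.fatNbrs_map ha, D.fatNbrs_map hb]
  constructor
  · rintro ⟨_, ⟨f, hf, rfl⟩, g, hg, h⟩
    exact ⟨f, hf, g, hg, h.symm⟩
  · rintro ⟨f, hf, g, hg, h⟩
    exact ⟨_, ⟨f, hf, rfl⟩, g, hg, h.symm⟩

/-- The decomposition of the glued graph into the graphs it is glued from. -/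
def decomposition [Finite W] : D.glued.Decomposition n where
  part c := Set.range (D.map c)
  part_fat := by
    rintro c _ ⟨f, rfl⟩ hf
    obtain ⟨x, hx, hfx⟩ := (L c).toHoffman.fat_adj_slim f (D.map_mem_fat.1 hf)
    exact ⟨D.map c x, ⟨x, rfl⟩, D.map_mem_slim.2 hx, D.adj_map.2 hfx⟩
  cover := by
    refine Set.eq_univ_iff_forall.2 fun w => ?_
    obtain ⟨c, a, rfl⟩ := D.surjective w
    exact Set.mem_iUnion.2 ⟨c, a, rfl⟩
  slim_disjoint := by
    intro c d hcd
    refine Set.eq_empty_of_forall_notMem ?_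
    rintro _ ⟨⟨⟨a, rfl⟩, ha⟩, ⟨b, hb⟩, -⟩
    exact hcd (D.eq_of_slim hb.symm (D.map_mem_slim.1 ha))
  fat_mem := by
    rintro c _ ⟨⟨a, rfl⟩, ha⟩ y hy hay
    have : y ∈ D.glued.fatNbrs (D.map c a) := ⟨hy, hay⟩
    rw [D.fatNbrs_map (D.map_mem_slim.1 ha)] at this
    obtain ⟨f, -, rfl⟩ := this
    exact ⟨f, rfl⟩
  common_le := by
    rintro c d hcd _ ⟨⟨a, rfl⟩, ha⟩ _ ⟨⟨b, rfl⟩, hb⟩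
    exact (entry_eq_zero_iff.1
      (D.entry_map_of_ne hcd (D.map_mem_slim.1 ha) (D.map_mem_slim.1 hb))).1
  common_iff := by
    rintro c d hcd _ ⟨⟨a, rfl⟩, ha⟩ _ ⟨⟨b, rfl⟩, hb⟩
    exact (entry_eq_zero_iff.1
      (D.entry_map_of_ne hcd (D.map_mem_slim.1 ha) (D.map_mem_slim.1 hb))).2

/-- The pieces of the glued graph. -/
noncomputable def isoPiece [Finite W] (c : Fin n) :
    Iso (D.decomposition.piece c) (L c).toHoffman :=
  Iso.symm ⟨⟨Equiv.ofInjective _ (D.injective c), D.adj_map⟩, fun _ => D.map_mem_fat⟩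

open Classical in
theorem isLineGraph_glued [Fintype W] {𝓗 : Set IsoClass} (h : ∀ c, isoClass (L c) ∈ 𝓗) :
    D.glued.IsLineGraph 𝓗 := by
  refine ⟨W, inferInstance, D.glued, ⟨Embedding.refl _⟩, n, D.decomposition, fun c => ?_⟩
  have : isoClass ⟨D.decomposition.part c, inferInstance, D.decomposition.piece c⟩ =
      isoClass (L c) := Quotient.sound ⟨D.isoPiece c⟩
  rw [this]
  exact h c

end GluingData

end HoffmanGraph

/-! ### Enlarging all components at once, and part (b) -/

namespace HoffmanGraph

open FinHoffmanGraph

section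

variable {V : Type} {H : HoffmanGraph V} {n : ℕ} {T : Fin n → Set V} {L : Fin n → FinHoffmanGraph}

/-- The vertices of a Hoffman graph together with those vertices of the graphs `L c` which are
not in the image of the local embedding of `T c`. -/
abbrev GluedVertex (g : ∀ c, LocalEmbedding H (T c) (L c).toHoffman) : Type :=
  V ⊕ Σ c, {a : (L c).V // a ∉ (g c).toFun '' H.hull (T c)}

open Classical in
/-- The embedding of `L c` into the set of glued vertices. -/
noncomputable def toGlued (g : ∀ c, LocalEmbedding H (T c) (L c).toHoffman) (c : Fin n)
    (a : (L c).V) : GluedVertex g :=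
  if h : a ∈ (g c).toFun '' H.hull (T c) then Sum.inl h.choose else Sum.inr ⟨c, a, h⟩

variable (g : ∀ c, LocalEmbedding H (T c) (L c).toHoffman)

theorem toGlued_toFun {c : Fin n} {v : V} (hv : v ∈ H.hull (T c)) :
    toGlued g c ((g c).toFun v) = Sum.inl v := by
  have h : (g c).toFun v ∈ (g c).toFun '' H.hull (T c) := ⟨v, hv, rfl⟩
  rw [toGlued, dif_pos h, (g c).inj h.choose_spec.1 hv h.choose_spec.2]

theorem toGlued_eq_inl {c : Fin n} {a : (L c).V} {v : V} (h : toGlued g c a = Sum.inl v) :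
    v ∈ H.hull (T c) ∧ (g c).toFun v = a := by
  unfold toGlued at h
  split_ifs at h with h'
  · obtain rfl := Sum.inl_injective h
    exact h'.choose_spec

theorem toGlued_eq_inr {c d : Fin n} {a : (L c).V}
    {b : {b : (L d).V // b ∉ (g d).toFun '' H.hull (T d)}}
    (h : toGlued g c a = Sum.inr ⟨d, b⟩) :
    (⟨c, a⟩ : Σ c, (L c).V) = ⟨d, b.1⟩ := by
  unfold toGlued at h
  split_ifs at h with h'
  · have := Sum.inr_injective h
    cases this
    rfl

theorem toGlued_injective (c : Fin n) : Function.Injective (toGlued g c) := by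
  intro a b hab
  rcases h : toGlued g c b with v | ⟨d, x⟩
  · rw [← (toGlued_eq_inl g h).2, (toGlued_eq_inl g (hab.trans h)).2]
  · have := (toGlued_eq_inr g (hab.trans h)).trans (toGlued_eq_inr g h).symm
    simpa using this

theorem exists_of_toGlued_eq {c d : Fin n} (hcd : c ≠ d) {a : (L c).V} {b : (L d).V}
    (h : toGlued g c a = toGlued g d b) : ∃ v, v ∈ H.hull (T c) ∧ v ∈ H.hull (T d) ∧
      (g c).toFun v = a ∧ (g d).toFun v = b := by
  rcases h' : toGlued g d b with v | ⟨e, x⟩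
  · obtain ⟨h1, h2⟩ := toGlued_eq_inl g h'
    obtain ⟨h3, h4⟩ := toGlued_eq_inl g (h.trans h')
    exact ⟨v, h3, h1, h4, h2⟩
  · have := (toGlued_eq_inr g (h.trans h')).trans (toGlued_eq_inr g h').symm
    exact absurd (congrArg Sigma.fst this) hcd

variable (hdisj : ∀ c d, c ≠ d → Disjoint (T c) (T d))
  (hcover : ∀ v ∈ H.slim, ∃ c, v ∈ T c)
  (hentry : ∀ c d, c ≠ d → ∀ x ∈ T c, ∀ y ∈ T d, H.entry x y = 0)

include hcover in
theorem exists_mem_hull (v : V) : ∃ c, v ∈ H.hull (T c) := by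
  by_cases hv : v ∈ H.fat
  · obtain ⟨x, hx, hvx⟩ := H.fat_adj_slim v hv
    obtain ⟨c, hc⟩ := hcover x hx
    exact ⟨c, Or.inr ⟨x, hc, hv, hvx.symm⟩⟩
  · obtain ⟨c, hc⟩ := hcover v hv
    exact ⟨c, Or.inl hc⟩

include hdisj in
theorem mem_fat_of_mem_hull {c d : Fin n} (hcd : c ≠ d) {v : V} (hc : v ∈ H.hull (T c))
    (hd : v ∈ H.hull (T d)) : v ∈ H.fat := by
  by_contra hv
  exact Set.disjoint_left.1 (hdisj c d hcd) (mem_slim_of_mem_hull hv hc)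
    (mem_slim_of_mem_hull hv hd)

theorem LocalEmbedding.mem_fatNbrs {c : Fin n} {x v : V} (hx : x ∈ H.hull (T c))
    (hv : v ∈ H.hull (T c)) :
    (g c).toFun v ∈ (L c).toHoffman.fatNbrs ((g c).toFun x) ↔ v ∈ H.fatNbrs x :=
  and_congr ((g c).fat v hv) ((g c).adj x hx v hv)

/-- The gluing data given by local embeddings. -/
noncomputable def gluingData [Finite V] : GluingData (GluedVertex g) L where
  map := toGlued g
  injective := toGlued_injective g
  surjective := by
    rintro (v | ⟨c, a⟩)
    · obtain ⟨c, hc⟩ := exists_mem_hull hcover v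
      exact ⟨c, _, toGlued_toFun g hc⟩
    · exact ⟨c, a, by rw [toGlued, dif_neg a.2]⟩
  fat := by
    intro c d hcd a b h
    obtain ⟨v, hc, hd, rfl, rfl⟩ := exists_of_toGlued_eq g hcd h
    have hv := mem_fat_of_mem_hull hdisj hcd hc hd
    exact ⟨((g c).fat v hc).2 hv, ((g d).fat v hd).2 hv⟩
  unique := by
    intro c d hcd a ha b hb f hf f' hf' k hk k' hk' h h'
    obtain ⟨v, hc, hd, rfl, rfl⟩ := exists_of_toGlued_eq g hcd h
    obtain ⟨v', hc', hd', rfl, rfl⟩ := exists_of_toGlued_eq g hcd h'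
    suffices v = v' by rw [this]
    -- Two slim vertices of H share at most one fat neighbour because their entry is zero. A slim
    -- vertex added by a listed graph has at most one fat neighbour in H, by the condition `unique`
    -- of local embeddings.
    by_cases hac : a ∈ (g c).toFun '' T c
    · by_cases hbd : b ∈ (g d).toFun '' T d
      · obtain ⟨x, hx, rfl⟩ := hac
        obtain ⟨y, hy, rfl⟩ := hbd
        refine Set.encard_le_one_iff.1 (entry_eq_zero_iff.1 (hentry c d hcd x hx y hy)).1 v v'
          ⟨?_, ?_⟩ ⟨?_, ?_⟩
        · exact (LocalEmbedding.mem_fatNbrs g (Or.inl hx) hc).1 hf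
        · exact (LocalEmbedding.mem_fatNbrs g (Or.inl hy) hd).1 hk
        · exact (LocalEmbedding.mem_fatNbrs g (Or.inl hx) hc').1 hf'
        · exact (LocalEmbedding.mem_fatNbrs g (Or.inl hy) hd').1 hk'
      · exact (g d).unique b hb hbd v hd v' hd' hk hk'
    · exact (g c).unique a ha hac v hc v' hc' hf hf'

/-- Inside a component, adjacency is preserved by the local embedding. Slim vertices of different
components have entry zero, hence are adjacent iff they share a fat neighbour, which is the gluing
rule. -/
theorem isInducedIn_glued [Finite V] :
    H.IsInducedIn (gluingData g hdisj hcover hentry).glued := by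
  set D := gluingData g hdisj hcover hentry
  have hmap : ∀ {c v}, v ∈ H.hull (T c) → D.map c ((g c).toFun v) = Sum.inl v :=
    fun h => toGlued_toFun g h
  have hfat : ∀ v, (Sum.inl v : GluedVertex g) ∈ D.glued.fat ↔ v ∈ H.fat := by
    intro v
    obtain ⟨c, hc⟩ := exists_mem_hull hcover v
    rw [← hmap hc, D.map_mem_fat, (g c).fat v hc]
  have hsame : ∀ {c v w}, v ∈ H.hull (T c) → w ∈ H.hull (T c) →
      (D.glued.graph.Adj (Sum.inl v) (Sum.inl w) ↔ H.graph.Adj v w) := by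
    intro c v w hv hw
    rw [← hmap hv, ← hmap hw, D.adj_map, (g c).adj v hv w hw]
  have hslimfat : ∀ v ∈ H.slim, ∀ w ∈ H.fat,
      (D.glued.graph.Adj (Sum.inl v) (Sum.inl w) ↔ H.graph.Adj v w) := by
    intro v hv w hw
    obtain ⟨c, hc⟩ := hcover v hv
    have hvc : v ∈ H.hull (T c) := Or.inl hc
    by_cases hwc : w ∈ H.hull (T c)
    · exact hsame hvc hwc
    · refine iff_of_false (fun h => hwc ?_) fun h => hwc (Or.inr ⟨v, hc, hw, h⟩)
      have h1 : Sum.inl w ∈ D.glued.fatNbrs (Sum.inl v) := ⟨(hfat w).2 hw, h⟩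
      have h2 : (g c).toFun v ∈ (L c).toHoffman.slim := fun h => hv (((g c).fat v hvc).1 h)
      rw [← hmap hvc, D.fatNbrs_map h2] at h1
      obtain ⟨f, -, hf⟩ := h1
      exact (toGlued_eq_inl g hf).1
  refine ⟨⟨⟨⟨Sum.inl, Sum.inl_injective⟩, fun {v w} => ?_⟩, hfat⟩⟩
  change D.glued.graph.Adj (Sum.inl v) (Sum.inl w) ↔ H.graph.Adj v w
  by_cases hv : v ∈ H.fat <;> by_cases hw : w ∈ H.fat
  · exact iff_of_false (D.glued.fat_not_adj _ ((hfat v).2 hv) _ ((hfat w).2 hw))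
      (H.fat_not_adj _ hv _ hw)
  · rw [SimpleGraph.adj_comm, H.graph.adj_comm]
    exact hslimfat w hw v hv
  · exact hslimfat v hv w hw
  · obtain ⟨c, hc⟩ := hcover v hv
    obtain ⟨d, hd⟩ := hcover w hw
    have hvc : v ∈ H.hull (T c) := Or.inl hc
    have hwd : w ∈ H.hull (T d) := Or.inl hd
    by_cases hcd : c = d
    · subst hcd
      exact hsame hvc hwd
    · obtain ⟨h1, h2⟩ := entry_eq_zero_iff.1 (hentry c d hcd v hc w hd)
      have hv' : (g c).toFun v ∈ (L c).toHoffman.slim := fun h => hv (((g c).fat v hvc).1 h)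
      have hw' : (g d).toFun w ∈ (L d).toHoffman.slim := fun h => hw (((g d).fat w hwd).1 h)
      have h3 : (H.fatNbrs v ∩ H.fatNbrs w).encard = 1 ↔ (H.fatNbrs v ∩ H.fatNbrs w).Nonempty := by
        rw [← Set.one_le_encard_iff_nonempty]
        exact ⟨fun h => h.ge, fun h => le_antisymm h1 h⟩
      rw [← h2, h3, ← hmap hvc, ← hmap hwd, D.adj_map_of_ne hcd hv' hw']
      constructor
      · rintro ⟨f, hf, k, hk, h⟩
        obtain ⟨u, huc, hud, rfl, rfl⟩ := exists_of_toGlued_eq g hcd h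
        exact ⟨u, (LocalEmbedding.mem_fatNbrs g hvc huc).1 hf,
          (LocalEmbedding.mem_fatNbrs g hwd hud).1 hk⟩
      · rintro ⟨u, huv, huw⟩
        have huc : u ∈ H.hull (T c) := Or.inr ⟨v, hc, huv⟩
        have hud : u ∈ H.hull (T d) := Or.inr ⟨w, hd, huw⟩
        exact ⟨_, (LocalEmbedding.mem_fatNbrs g hvc huc).2 huv, _,
          (LocalEmbedding.mem_fatNbrs g hwd hud).2 huw, (hmap huc).trans (hmap hud).symm⟩

end

open Classical in
theorem isLineGraph_of_not_isExtendable {V : Type} [Fintype V] {H : HoffmanGraph V}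
    (hg : H.IsGood) (hf : H.IsFat) (hU : ∀ U, ¬ H.IsExtendable U) :
    H.IsLineGraph (Set.range fun i => isoClass (maximalList i)) := by
  have : Finite (Quotient H.specialSetoid) := Quotient.finite _
  obtain ⟨n, ⟨e⟩⟩ := Finite.exists_equiv_fin (Quotient H.specialSetoid)
  let T : Fin n → Set V := fun c => H.componentSet (e.symm c)
  have hT : ∀ c, H.IsComponent (T c) := fun c => isComponent_componentSet _
  have hdisj : ∀ c d, c ≠ d → Disjoint (T c) (T d) := by
    intro c d hcd
    rw [Set.disjoint_left]
    rintro _ ⟨x, hx, rfl⟩ hd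
    exact hcd (e.symm.injective (hx.symm.trans ((mem_componentSet x).1 hd)))
  have hcover : ∀ v ∈ H.slim, ∃ c, v ∈ T c := fun v hv =>
    ⟨e (Quotient.mk _ ⟨v, hv⟩), (mem_componentSet ⟨v, hv⟩).2 (e.symm_apply_apply _).symm⟩
  have hentry : ∀ c d, c ≠ d → ∀ x ∈ T c, ∀ y ∈ T d, H.entry x y = 0 :=
    fun c d hcd x hx y hy => (hT d).closed x ((hT c).slim hx)
      (Set.disjoint_left.1 (hdisj c d hcd) hx) y hy
  choose i hi using fun c => ((hT c).exists_localEmbedding hg hf).resolve_left fun ⟨U, h⟩ => hU U h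
  let g : ∀ c, LocalEmbedding H (T c) (maximalList (i c)).toHoffman := fun c => (hi c).some
  refine IsLineGraph.of_isInducedIn
    (isInducedIn_glued g hdisj hcover hentry) ?_
  exact GluingData.isLineGraph_glued _ fun c => ⟨i c, rfl⟩

open Classical in
-- Induction on the number of edges of the special graph: attaching a fat vertex to an extendable
-- clique keeps the graph good and fat and removes edges.
theorem isLineGraph_of_isGood {V : Type} [Fintype V] {H : HoffmanGraph V} (hg : H.IsGood)
    (hf : H.IsFat) : H.IsLineGraph (Set.range fun i => isoClass (maximalList i)) := by
  obtain ⟨k, hk⟩ : ∃ k, H.special.ncard = k := ⟨_, rfl⟩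
  induction k using Nat.strong_induction_on generalizing V with
  | _ k ih =>
    by_cases hU : ∃ U, H.IsExtendable U
    · obtain ⟨U, hU⟩ := hU
      have := ih _ (hk ▸ hU.ncard_special_lt) (hU.isGood_addFat hg) (addFat_isFat hf) rfl
      exact IsLineGraph.of_isInducedIn ⟨addFatEmbedding⟩ this
    · push Not at hU
      exact isLineGraph_of_not_isExtendable hg hf hU

/-- The copy of a Hoffman graph on an equivalent vertex set. -/
def comap {V : Type u} {W : Type v} (H : HoffmanGraph V) (e : W ≃ V) : HoffmanGraph W where
  graph := H.graph.comap e
  fat := e ⁻¹' H.fat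
  fat_adj_slim := fun f hf => by
    obtain ⟨x, hx, h⟩ := H.fat_adj_slim (e f) hf
    exact ⟨e.symm x, by simpa using hx, by simpa using h⟩
  fat_not_adj := fun f hf g hg => H.fat_not_adj _ hf _ hg

section

variable {V : Type u} {W : Type v} {H : HoffmanGraph V} {e : W ≃ V}

theorem image_fatNbrs_comap (x : W) : e '' (H.comap e).fatNbrs x = H.fatNbrs (e x) := by
  ext f
  constructor
  · rintro ⟨g, hg, rfl⟩
    exact hg
  · intro h
    exact ⟨e.symm f, by simpa [fatNbrs, comap] using h, by simp⟩

theorem entry_comap (x y : W) : (H.comap e).entry x y = H.entry (e x) (e y) := by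
  unfold entry
  rw [← image_fatNbrs_comap, ← image_fatNbrs_comap, ← Set.image_inter e.injective,
    Set.ncard_image_of_injective _ e.injective]
  rfl

theorem isFat_comap (hf : H.IsFat) : (H.comap e).IsFat := by
  intro x hx
  rw [← Set.image_nonempty (f := e), image_fatNbrs_comap]
  exact hf _ hx

open Classical in
theorem isGood_comap [Fintype V] [Fintype W] (hg : H.IsGood) : (H.comap e).IsGood :=
  (hg.comp (f := fun x : (H.comap e).slim => ⟨e x, x.2⟩) fun x y h => by
    simpa [Subtype.ext_iff] using h).congr fun x y => (entry_comap x.1 y.1).symm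

end

/-- Fat Hoffman graphs with smallest eigenvalue at least `-1 - τ` are line graphs over the list. -/
theorem isLineGraph_of_le_lambdaMin {V : Type u} [Fintype V] {H : HoffmanGraph V} (hf : H.IsFat)
    (hl : -1 - Real.goldenRatio ≤ H.lambdaMin) :
    H.IsLineGraph (Set.range fun i => isoClass (maximalList i)) := by
  classical
  -- Line graphs are defined through host graphs on vertex sets in `Type`, so H is first copied to
  -- the lowest universe.
  let e : Fin (Fintype.card V) ≃ V := (Fintype.equivFin V).symm
  have h := isLineGraph_of_isGood (H := H.comap e) (isGood_comap ((le_lambdaMin_iff H).1 hl))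
    (isFat_comap hf)
  have i : Iso (H.comap e) H := ⟨⟨e, Iff.rfl⟩, fun _ => Iff.rfl⟩
  exact IsLineGraph.of_isInducedIn i.symm.isInducedIn h

end HoffmanGraph

/-- Here `M` is the special graph, `E x` the set of new fat neighbours of `x`, and `b` the matrix in
the extension. The vertices at `g` have diagonal -2, so their mutual entries in `b` vanish and `M`
is 1 there. A vertex joined to one of them has diagonal -1, and by `IsPsd.isolated` it has no other
neighbour. -/
theorem isPendantClique_of_isPsd {S W : Type*} [Fintype S] {M b : S → S → ℤ} (E : S → Set W)
    (hE : ∀ x, (E x).Finite) (hb : IsPsd b) (hM : ∀ x y, M x y = M y x) (hM0 : ∀ x, M x x = 0)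
    (hMc : ∀ x y, M x y = 0 ∨ M x y = 1 ∨ M x y = -1)
    (hbM : ∀ x y, x ≠ y → b x y = M x y - (E x ∩ E y).ncard)
    (hbE : ∀ x, b x x = -1 - (E x).ncard)
    (hconn : ∀ T : Set S, T.Nonempty → (∀ x ∉ T, ∀ y ∈ T, M x y = 0) → T = Set.univ)
    {x₀ y₀ : S} (hxy₀ : x₀ ≠ y₀) {g : W} (hx₀ : g ∈ E x₀) (hy₀ : g ∈ E y₀) :
    SignedCode.IsPendantClique M {x | g ∈ E x} := by
  have hs : ∀ x y, b x y = b y x := fun x y => by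
    by_cases hxy : x = y
    · rw [hxy]
    · rw [hbM x y hxy, hbM y x (Ne.symm hxy), hM, Set.inter_comm]
  have hle : ∀ x, (E x).ncard ≤ 1 := fun x => by
    have := hb.neg_two_le x
    rw [hbE] at this
    omega
  have hEU : ∀ u, g ∈ E u → E u = {g} := fun u hu => by
    obtain ⟨a, ha⟩ := Set.ncard_eq_one.1 (le_antisymm (hle u) ((Set.ncard_pos (hE u)).2 ⟨g, hu⟩))
    rw [ha] at hu ⊢
    rw [Set.mem_singleton_iff.1 hu]
  have hbU : ∀ u, g ∈ E u → b u u = -2 := fun u hu => by rw [hbE, hEU u hu]; simp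
  have hne : ∀ {x y}, M x y ≠ 0 → x ≠ y := by
    rintro x _ h rfl
    exact h (hM0 x)
  have hUx : ∀ u, g ∈ E u → ∀ x, g ∉ E x → b u x = M u x := fun u hu x hx => by
    rw [hbM u x (by rintro rfl; exact hx hu), hEU u hu, Set.singleton_inter_eq_empty.2 hx]
    simp
  have hpend : ∀ u, g ∈ E u → ∀ x, g ∉ E x → M u x ≠ 0 → b x x = -1 ∧ E x = ∅ := by
    intro u hu x hx hux
    have h0 : (E x).ncard = 0 := by
      by_contra h
      have h1 := hle x
      refine hux ?_
      rw [← hUx u hu x hx]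
      refine hb.eq_zero_of_two_two hs (hne hux) (hbU u hu) ?_
      rw [hbE]; omega
    exact ⟨by rw [hbE, h0]; rfl, (Set.ncard_eq_zero (hE x)).1 h0⟩
  have hiso : ∀ u, g ∈ E u → ∀ x, g ∉ E x → M u x ≠ 0 → ∀ z, u ≠ z → x ≠ z →
      b u z = 0 ∧ b x z = 0 := by
    intro u hu x hx hux z huz hxz
    refine hb.isolated hs (hne hux) huz hxz (hbU u hu) (hpend u hu x hx hux).1 ?_
    rw [hUx u hu x hx]
    exact (hMc u x).resolve_left hux
  have hpM : ∀ u, g ∈ E u → ∀ x, g ∉ E x → M u x ≠ 0 → ∀ z, u ≠ z → x ≠ z → M x z = 0 := by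
    intro u hu x hx hux z huz hxz
    have := (hiso u hu x hx hux z huz hxz).2
    rwa [hbM x z hxz, (hpend u hu x hx hux).2, Set.empty_inter, Set.ncard_empty, Nat.cast_zero,
      sub_zero] at this
  -- The vertices at `g` and their neighbours are closed under adjacency in `M`, so they are all
  -- vertices.
  have hall : ∀ x, g ∉ E x → ∃ u, g ∈ E u ∧ M u x ≠ 0 := by
    have := hconn {x | g ∈ E x ∨ ∃ u, g ∈ E u ∧ M u x ≠ 0} ⟨x₀, Or.inl hx₀⟩ (by
      rintro x hx y hy
      simp only [Set.mem_ofPred_eq, not_or, not_exists, not_and, not_not] at hx hy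
      by_cases hyU : g ∈ E y
      · rw [hM]; exact hx.2 y hyU
      · obtain ⟨u, hu, huy⟩ := hy.resolve_left hyU
        rw [hM]
        refine hpM u hu y hyU huy x (by rintro rfl; exact hx.1 hu) ?_
        rintro rfl
        exact huy (hx.2 u hu))
    intro x hx
    exact (Set.eq_univ_iff_forall.1 this x).resolve_left hx
  refine ⟨⟨x₀, hx₀, y₀, hy₀, hxy₀⟩, ?_, ?_, ?_, ?_⟩
  · intro u hu v hv huv
    have h1 := hb.eq_zero_of_two_two hs huv (hbU u hu) (hbU v hv)
    rw [hbM u v huv, hEU u hu, hEU v hv] at h1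
    simp at h1
    omega
  · intro u hu x hx y hy hux huy
    by_contra hxy
    refine huy ?_
    rw [← hUx u hu y hy]
    exact (hiso u hu x hx hux y (hne huy) hxy).1
  · intro x hx y hy hxy
    obtain ⟨u, hu, hux⟩ := hall x hx
    exact hpM u hu x hx hux y (by rintro rfl; exact hy hu) hxy
  · intro x hx u hu v hv hxu hxv
    by_contra huv
    refine hxv ?_
    rw [hM] at hxu
    exact hpM u hu x hx hxu v huv (by rintro rfl; exact hx hv)

/-! ### Irreducibility of the listed graphs -/

namespace HoffmanGraph

section

variable {V W : Type*} {H : HoffmanGraph V} {K : HoffmanGraph W} (e : Embedding H K)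

theorem Embedding.image_fatNbrs (x : V) :
    e.toEmbedding '' H.fatNbrs x = K.fatNbrs (e.toEmbedding x) ∩ Set.range e.toEmbedding := by
  ext f
  constructor
  · rintro ⟨g, hg, rfl⟩
    exact ⟨⟨(e.map_fat g).2 hg.1, e.toEmbedding.map_adj_iff.2 hg.2⟩, g, rfl⟩
  · rintro ⟨h, g, rfl⟩
    exact ⟨g, ⟨(e.map_fat g).1 h.1, e.toEmbedding.map_adj_iff.1 h.2⟩, rfl⟩

theorem Embedding.map_mem_slim {x : V} : e.toEmbedding x ∈ K.slim ↔ x ∈ H.slim :=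
  not_congr (e.map_fat x)

/-- The fat neighbours of a vertex outside of an induced subgraph. -/
def Embedding.outer (x : V) : Set W := K.fatNbrs (e.toEmbedding x) \ Set.range e.toEmbedding

theorem Embedding.entry_eq [Finite W] (x y : V) : K.entry (e.toEmbedding x) (e.toEmbedding y) =
    H.entry x y - (e.outer x ∩ e.outer y).ncard := by
  have h : K.fatNbrs (e.toEmbedding x) ∩ K.fatNbrs (e.toEmbedding y) =
      e.toEmbedding '' (H.fatNbrs x ∩ H.fatNbrs y) ∪ (e.outer x ∩ e.outer y) := by
    rw [Set.image_inter e.toEmbedding.injective, e.image_fatNbrs, e.image_fatNbrs]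
    ext f
    simp only [outer, Set.mem_inter_iff, Set.mem_union, Set.mem_sdiff]
    tauto
  have hd : Disjoint (e.toEmbedding '' (H.fatNbrs x ∩ H.fatNbrs y)) (e.outer x ∩ e.outer y) := by
    rw [Set.disjoint_left]
    rintro _ ⟨g, -, rfl⟩ ⟨hg, -⟩
    exact hg.2 ⟨g, rfl⟩
  unfold entry
  rw [h, Set.ncard_union_eq hd (Set.toFinite _) (Set.toFinite _),
    Set.ncard_image_of_injective _ e.toEmbedding.injective, e.toEmbedding.map_adj_iff]
  push_cast
  ring

open Classical in
theorem IsGood.isPsd_embedding [Fintype V] [Fintype W] (hg : K.IsGood) :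
    IsPsd fun x y : H.slim => K.entry (e.toEmbedding x) (e.toEmbedding y) :=
  hg.comp (f := fun x : H.slim => ⟨e.toEmbedding x, e.map_mem_slim.2 x.2⟩) fun _ _ h =>
    Subtype.ext (e.toEmbedding.injective (Subtype.ext_iff.1 h))

end

end HoffmanGraph

namespace FinHoffmanGraph

open HoffmanGraph SignedCode

variable {G : FinHoffmanGraph} {C : List (List ℕ)}

theorem HasCode.exists_list (h : G.HasCode C) : ∃ l : List G.toHoffman.slim, l.Nodup ∧
    (∀ x, x ∈ l) ∧ code (fun x y : G.toHoffman.slim => G.toHoffman.enc x y) l = C := by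
  obtain ⟨l, hl, hmem, hc⟩ := h.list
  have hmap := List.attachWith_map_subtype_val (l := l) (p := (· ∈ G.toHoffman.slim))
    fun x hx => (hmem x).1 hx
  set l' := l.attachWith (· ∈ G.toHoffman.slim) fun x hx => (hmem x).1 hx with hl'
  have hnd : l'.Nodup := List.Nodup.of_map Subtype.val (by rwa [hmap])
  refine ⟨l', hnd, fun x => ?_, ?_⟩
  · simpa [hl'] using (hmem x).2 x.2
  · rw [← hc, ← hmap]
    exact (code_map (e' := G.toHoffman.enc) hnd fun _ _ _ _ _ => rfl).symm

theorem HasCode.isFat (h : G.HasCode C) : G.toHoffman.IsFat := fun x hx =>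
  Set.nonempty_of_ncard_ne_zero (by rw [h.ncard x hx]; decide)

theorem HasCode.isCode_slim (h : G.HasCode C) :
    IsCode fun x y : G.toHoffman.slim => G.toHoffman.enc x y :=
  isCode_enc Subtype.val fun x => subsingleton_fatNbrs (h.ncard x x.2)

open Classical in
theorem HasCode.isGood (h : G.HasCode C) (hC : IsPsd (matrixOf C)) : G.toHoffman.IsGood := by
  obtain ⟨l, hl, hmem, rfl⟩ := h.exists_list
  have hlt : ∀ x, l.idxOf x < (code (fun x y : G.toHoffman.slim => G.toHoffman.enc x y) l).length :=
    fun x => by rw [length_code]; exact List.idxOf_lt_length_of_mem (hmem x)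
  refine (hC.comp (f := fun x => ⟨l.idxOf x, hlt x⟩) fun x y hxy => ?_).congr fun x y => ?_
  · exact (List.idxOf_inj (hmem x)).1 (Fin.mk.inj_iff.1 hxy)
  · unfold matrixOf
    by_cases hxy : x = y
    · subst hxy
      rw [if_pos rfl, entry_self, h.ncard x x.2]; rfl
    · have hne : l.idxOf x ≠ l.idxOf y := fun h => hxy ((List.idxOf_inj (hmem x)).1 h)
      have hx := hlt x
      have hy := hlt y
      rw [length_code] at hx hy
      rw [if_neg (by simpa using hne), entry_eq_mval (h.ncard x x.2),
        look_code h.isCode_slim x l hx hy hne, List.getD_eq_getElem _ _ hx,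
        List.getD_eq_getElem _ _ hy, List.getElem_idxOf, List.getElem_idxOf]

open Classical in
-- A separation in an extension cuts an edge of the connected special graph. Its entry has become
-- zero, so its ends share a new fat vertex, and the special graph would be a pendant clique.
theorem HasCode.isFatIrreducible (h : G.HasCode C) (hC : C ∈ targets) :
    G.IsFatIrreducible (-1 - Real.goldenRatio) := by
  refine ⟨h.isFat, (le_lambdaMin_iff _).2 (h.isGood (isPsd_target C hC)), ?_⟩
  rw [isReducible_iff]
  rintro ⟨W, _, K, e, T, hg, hT, ⟨x, hx, hxT⟩, y, hy, hyT⟩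
  obtain ⟨l, hl, hmem, hc⟩ := h.exists_list
  have hcheck := List.all_eq_true.1 targets_noPendantClique C hC
  rw [Bool.and_eq_true, ← hc] at hcheck
  have he := h.isCode_slim
  set M := signed fun x y : G.toHoffman.slim => G.toHoffman.enc x y with hM
  have hMe : ∀ x y : G.toHoffman.slim, x ≠ y → M x y = G.toHoffman.entry x y := fun x y hxy => by
    rw [hM, signed_of_ne hxy, entry_eq_mval (h.ncard x x.2)]
  have hconn : ∀ T : Set G.toHoffman.slim, T.Nonempty → (∀ x ∉ T, ∀ y ∈ T, M x y = 0) →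
      T = Set.univ := by
    rintro T ⟨t, ht⟩ hT
    refine Set.eq_univ_iff_forall.2 fun x =>
      connected_of_linked he hl hcheck.2 T ⟨t, hmem t, ht⟩ ?_ x (hmem x)
    intro x _ hx y _ hy
    rw [← signed_of_ne (e := fun x y : G.toHoffman.slim => G.toHoffman.enc x y)
      (show x ≠ y by rintro rfl; exact hx hy)]
    exact hT x hx y hy
  have hcross : ∃ a b : G.toHoffman.slim, e.toEmbedding a ∉ T ∧ e.toEmbedding b ∈ T ∧
      M a b ≠ 0 := by
    by_contra! hcon
    have := hconn {a | e.toEmbedding a ∈ T} ⟨⟨x, hx⟩, hxT⟩ fun a ha b hb => hcon a b ha hb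
    exact hyT (Set.eq_univ_iff_forall.1 this ⟨y, hy⟩)
  obtain ⟨a, b, ha, hb, hab⟩ := hcross
  have hab' : a ≠ b := ne_of_signed hab
  have h0 := hT _ (e.map_mem_slim.2 a.2) _ (e.map_mem_slim.2 b.2) ha hb
  rw [e.entry_eq, ← hMe a b hab'] at h0
  have hne : (e.outer a ∩ e.outer b).Nonempty := by
    refine Set.nonempty_of_ncard_ne_zero fun h1 => hab ?_
    rw [h1] at h0
    simpa using h0
  obtain ⟨g, hga, hgb⟩ := hne
  exact not_isPendantClique he hl hmem hcheck.1 _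
    (isPendantClique_of_isPsd (fun x : G.toHoffman.slim => e.outer x) (fun _ => Set.toFinite _)
      (hg.isPsd_embedding e) (signed_symm he) signed_self signed_cases
      (fun x y hxy => (e.entry_eq x y).trans (by rw [← hMe x y hxy]))
      (fun x => by simp only [e.entry_eq, Set.inter_self, entry_self, h.ncard x x.2]; rfl)
      hconn hab' hga hgb)

open Classical in
-- The vertex `y` already has diagonal -2, so an extension adds no fat neighbour to it, and the
-- nonzero entry of `x` and `y` survives.
theorem isFatIrreducible_pair {x y : G.V} (hxy : x ≠ y)
    (hs : ∀ z, z ∈ G.toHoffman.slim ↔ z = x ∨ z = y) (hx : (G.toHoffman.fatNbrs x).ncard = 1)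
    (hy : (G.toHoffman.fatNbrs y).ncard = 2)
    (h : G.toHoffman.entry x y = 1 ∨ G.toHoffman.entry x y = -1) :
    G.IsFatIrreducible (-1 - Real.goldenRatio) := by
  have hxs : x ∈ G.toHoffman.slim := (hs x).2 (Or.inl rfl)
  have hys : y ∈ G.toHoffman.slim := (hs y).2 (Or.inr rfl)
  refine ⟨fun z hz => ?_, (le_lambdaMin_iff _).2 ?_, ?_⟩
  · refine Set.nonempty_of_ncard_ne_zero ?_
    rcases (hs z).1 hz with rfl | rfl
    · rw [hx]; decide
    · rw [hy]; decide
  · intro c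
    rw [← psdForm, psdForm_of_support_pair (x := ⟨x, hxs⟩) (y := ⟨y, hys⟩) _
      (by simpa using hxy)]
    · simp only [entry_self, hx, hy, G.toHoffman.entry_symm y x]
      have h1 : (G.toHoffman.entry x y : ℝ) * G.toHoffman.entry x y = 1 := by
        rcases h with h | h <;> rw [h] <;> norm_num
      have h2 := Real.goldenRatio_sq
      have h3 : 0 ≤ (Real.goldenRatio - 1) *
          (c ⟨y, hys⟩ + Real.goldenRatio * G.toHoffman.entry x y * c ⟨x, hxs⟩) ^ 2 :=
        mul_nonneg (by linarith [lt_goldenRatio]) (sq_nonneg _)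
      push_cast
      generalize (G.toHoffman.entry x y : ℝ) = ε at *
      generalize c ⟨y, hys⟩ = s at *
      generalize c ⟨x, hxs⟩ = t at *
      have h4 : (Real.goldenRatio - 1) * Real.goldenRatio = 1 := by linear_combination h2
      linear_combination h3 + (2 * ε * s * t + Real.goldenRatio * t ^ 2 * ε ^ 2) * h4 +
        (t ^ 2 * Real.goldenRatio) * h1
    · intro z hzx hzy
      rcases (hs z).1 z.2 with h | h
      · exact absurd (Subtype.ext h) hzx
      · exact absurd (Subtype.ext h) hzy
  · rw [isReducible_iff]
    rintro ⟨W, _, K, e, T, hg, hT, ⟨a, ha, haT⟩, b, hb, hbT⟩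
    have h0 : K.entry (e.toEmbedding x) (e.toEmbedding y) = 0 := by
      have h1 := hT _ (e.map_mem_slim.2 hb) _ (e.map_mem_slim.2 ha) hbT haT
      rcases (hs a).1 ha with rfl | rfl <;> rcases (hs b).1 hb with rfl | rfl
      · exact absurd haT hbT
      · rwa [entry_symm]
      · exact h1
      · exact absurd haT hbT
    have h1 := (hg.isPsd_embedding e).neg_two_le ⟨y, hys⟩
    simp only [e.entry_eq, Set.inter_self, entry_self, hy] at h1
    have h2 : (e.outer y).ncard = 0 := by omega
    rw [Set.ncard_eq_zero (Set.toFinite _)] at h2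
    rw [e.entry_eq, h2, Set.inter_empty, Set.ncard_empty] at h0
    omega

end FinHoffmanGraph

/-! ### The listed graphs form an antichain -/

namespace FinHoffmanGraph

open HoffmanGraph SignedCode

variable {G K : FinHoffmanGraph} {C C' : List (List ℕ)}

/-- Slim vertices have one fat neighbour in both graphs, so an embedding cannot create a new common
fat neighbour. -/
theorem HasCode.enc_embedding (h : G.HasCode C) (h' : K.HasCode C')
    (e : Embedding G.toHoffman K.toHoffman) {x y : G.V} (hx : x ∈ G.toHoffman.slim)
    (hy : y ∈ G.toHoffman.slim) :
    G.toHoffman.enc x y = K.toHoffman.enc (e.toEmbedding x) (e.toEmbedding y) := by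
  have key : ∀ z ∈ G.toHoffman.slim, K.toHoffman.fatNbrs (e.toEmbedding z) =
      e.toEmbedding '' G.toHoffman.fatNbrs z := by
    intro z hz
    refine (Set.eq_of_subset_of_ncard_le ?_ ?_ (Set.toFinite _)).symm
    · rw [e.image_fatNbrs]
      exact Set.inter_subset_left
    · rw [Set.ncard_image_of_injective _ e.toEmbedding.injective, h.ncard z hz,
        h'.ncard _ (e.map_mem_slim.2 hz)]
  refine enc_eq_enc e.toEmbedding.map_adj_iff.symm ?_
  rw [key x hx, key y hy, ← Set.image_inter e.toEmbedding.injective, Set.image_nonempty]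

theorem HasCode.embeds (h : G.HasCode C) (h' : K.HasCode C')
    (e : Embedding G.toHoffman K.toHoffman) : embeds C' C = true := by
  classical
  have hcode := h'.isCode
  obtain ⟨l, hl, hmem, rfl⟩ := h.list
  obtain ⟨l', hl', hmem', rfl⟩ := h'.list
  have hpos : ∀ x ∈ l, l'.idxOf (e.toEmbedding x) < l'.length := fun x hx =>
    List.idxOf_lt_length_of_mem ((hmem' _).2 (e.map_mem_slim.2 ((hmem x).1 hx)))
  have hinj : ∀ x ∈ l, ∀ y ∈ l, l'.idxOf (e.toEmbedding x) = l'.idxOf (e.toEmbedding y) → x = y := by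
    intro x hx y hy hxy
    exact e.toEmbedding.injective ((List.idxOf_inj
      ((hmem' _).2 (e.map_mem_slim.2 ((hmem x).1 hx)))).1 hxy)
  simp only [SignedCode.embeds, Bool.not_eq_true', List.isEmpty_eq_false_iff_exists_mem, mem_isos]
  refine ⟨l.map fun x => l'.idxOf (e.toEmbedding x), hl.map_on hinj, ?_, ?_⟩
  · rw [length_code]
    intro i hi
    obtain ⟨x, hx, rfl⟩ := List.mem_map.1 hi
    exact hpos x hx
  · refine code_map hl fun x hx y hy hxy => ?_
    rw [look_code hcode (e.toEmbedding x) l' (hpos x hx) (hpos y hy)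
      fun h => hxy (hinj x hx y hy h), List.getD_eq_getElem _ _ (hpos x hx),
      List.getD_eq_getElem _ _ (hpos y hy), List.getElem_idxOf, List.getElem_idxOf]
    exact h.enc_embedding h' e ((hmem x).1 hx) ((hmem y).1 hy)

theorem HasCode.length_le_ncard_slim (h : G.HasCode C) : C.length = G.toHoffman.slim.ncard := by
  classical
  obtain ⟨l, hl, hmem, rfl⟩ := h.list
  rw [length_code, ← List.toFinset_card_of_nodup hl, ← Set.ncard_coe_finset]
  congr 1
  ext x
  simp [hmem]

theorem ncard_slim_le (e : Embedding G.toHoffman K.toHoffman) :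
    G.toHoffman.slim.ncard ≤ K.toHoffman.slim.ncard := by
  rw [← Set.ncard_image_of_injective _ e.toEmbedding.injective]
  refine Set.ncard_le_ncard ?_ (Set.toFinite _)
  rintro _ ⟨x, hx, rfl⟩
  exact e.map_mem_slim.2 hx

theorem ncard_fatNbrs_le (e : Embedding G.toHoffman K.toHoffman) (x : G.V) :
    (G.toHoffman.fatNbrs x).ncard ≤ (K.toHoffman.fatNbrs (e.toEmbedding x)).ncard := by
  rw [← Set.ncard_image_of_injective _ e.toEmbedding.injective, e.image_fatNbrs]
  exact Set.ncard_le_ncard Set.inter_subset_left (Set.toFinite _)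

/-- The properties of the first two listed graphs: there are exactly two slim vertices, one of them
has one fat neighbour and the other has two. -/
structure IsPair (G : FinHoffmanGraph) (x y : G.V) : Prop where
  ne : x ≠ y
  slim : ∀ z, z ∈ G.toHoffman.slim ↔ z = x ∨ z = y
  ncard_left : (G.toHoffman.fatNbrs x).ncard = 1
  ncard_right : (G.toHoffman.fatNbrs y).ncard = 2

theorem IsPair.ncard_slim {x y : G.V} (h : G.IsPair x y) : G.toHoffman.slim.ncard = 2 := by
  have : G.toHoffman.slim = {x, y} := Set.ext h.slim
  rw [this, Set.ncard_pair h.ne]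

theorem IsPair.not_isInducedIn_of_hasCode {x y : G.V} (h : G.IsPair x y) (h' : K.HasCode C) :
    ¬ G.toHoffman.IsInducedIn K.toHoffman := by
  rintro ⟨e⟩
  have := ncard_fatNbrs_le e y
  rw [h.ncard_right, h'.ncard _ (e.map_mem_slim.2 ((h.slim y).2 (Or.inr rfl)))] at this
  omega

theorem HasCode.not_isInducedIn_of_isPair {x y : K.V} (h : G.HasCode C) (h' : K.IsPair x y)
    (hC : 2 < C.length) : ¬ G.toHoffman.IsInducedIn K.toHoffman := by
  rintro ⟨e⟩
  have := ncard_slim_le e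
  rw [← h.length_le_ncard_slim, h'.ncard_slim] at this
  omega

theorem IsPair.adj_iff {x y : G.V} {x' y' : K.V} (h : G.IsPair x y) (h' : K.IsPair x' y')
    (hi : G.toHoffman.IsInducedIn K.toHoffman) :
    G.toHoffman.graph.Adj x y ↔ K.toHoffman.graph.Adj x' y' := by
  obtain ⟨e⟩ := hi
  rw [← e.toEmbedding.map_adj_iff]
  have hne : e.toEmbedding x ≠ e.toEmbedding y := e.toEmbedding.injective.ne h.ne
  have hx := (h'.slim _).1 (e.map_mem_slim.2 ((h.slim x).2 (Or.inl rfl)))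
  have hy := (h'.slim _).1 (e.map_mem_slim.2 ((h.slim y).2 (Or.inr rfl)))
  rcases hx with hx | hx <;> rcases hy with hy | hy <;> rw [hx, hy] at hne ⊢
  · exact absurd rfl hne
  · exact K.toHoffman.graph.adj_comm _ _
  · exact absurd rfl hne

section OfLists

variable {m : ℕ} {E : List (Fin 2 × Fin 2)} {F : Fin m → List (Fin 2)} {hF : ∀ k, F k ≠ []}

theorem isPair_ofLists (h0 : (Finset.univ.filter fun k => 0 ∈ F k).card = 1)
    (h1 : (Finset.univ.filter fun k => 1 ∈ F k).card = 2) :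
    IsPair (ofLists E F hF) (Sum.inl 0) (Sum.inl 1) where
  ne h := by simpa using Sum.inl_injective h
  slim z := by
    refine (ofLists_slim (E := E) (F := F) (hF := hF)).trans ?_
    constructor
    · rintro ⟨i, rfl⟩
      fin_cases i
      · exact Or.inl rfl
      · exact Or.inr rfl
    · rintro (rfl | rfl)
      · exact ⟨0, rfl⟩
      · exact ⟨1, rfl⟩
  ncard_left := by
    change ((HoffmanGraph.ofLists E F hF).fatNbrs (Sum.inl 0)).ncard = 1
    rw [ofLists_fatNbrs, Set.ncard_image_of_injective _ Sum.inr_injective,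
      Set.ncard_eq_toFinset_card']
    simpa using h0
  ncard_right := by
    change ((HoffmanGraph.ofLists E F hF).fatNbrs (Sum.inl 1)).ncard = 2
    rw [ofLists_fatNbrs, Set.ncard_image_of_injective _ Sum.inr_injective,
      Set.ncard_eq_toFinset_card']
    simpa using h1

open Classical in
theorem entry_ofLists {n : ℕ} {E : List (Fin n × Fin n)} {F : Fin m → List (Fin n)}
    {hF : ∀ k, F k ≠ []} {i j : Fin n} :
    (HoffmanGraph.ofLists E F hF).entry (Sum.inl i) (Sum.inl j) =
      (if i ≠ j ∧ ((i, j) ∈ E ∨ (j, i) ∈ E) then 1 else 0) -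
        (Finset.univ.filter fun k => i ∈ F k ∧ j ∈ F k).card := by
  unfold entry
  rw [ofLists_fatNbrs, ofLists_fatNbrs, ← Set.image_inter Sum.inr_injective,
    Set.ncard_image_of_injective _ Sum.inr_injective, ← Set.ncard_coe_finset]
  simp only [ofLists_adj_inl]
  congr 3
  ext k
  simp

end OfLists

theorem isPair_maximalList_zero : IsPair (maximalList 0) (Sum.inl (0 : Fin 2))
    (Sum.inl (1 : Fin 2)) :=
  isPair_ofLists (by decide) (by decide)

theorem isPair_maximalList_one : IsPair (maximalList 1) (Sum.inl (0 : Fin 2))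
    (Sum.inl (1 : Fin 2)) :=
  isPair_ofLists (by decide) (by decide)

theorem adj_maximalList_zero :
    (maximalList 0).toHoffman.graph.Adj (Sum.inl (0 : Fin 2)) (Sum.inl (1 : Fin 2)) := by
  change (HoffmanGraph.ofLists (n := 2) (m := 3) [(0, 1)] ![[0], [1], [1]] (by decide)).graph.Adj
    (Sum.inl 0) (Sum.inl 1)
  rw [ofLists_adj_inl]
  decide

theorem not_adj_maximalList_one :
    ¬ (maximalList 1).toHoffman.graph.Adj (Sum.inl (0 : Fin 2)) (Sum.inl (1 : Fin 2)) := by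
  change ¬ (HoffmanGraph.ofLists (n := 2) (m := 2) [] ![[0, 1], [1]] (by decide)).graph.Adj
    (Sum.inl 0) (Sum.inl 1)
  rw [ofLists_adj_inl]
  decide

theorem targets_getD_mem (k : Fin 18) : targets.getD k [] ∈ targets := by
  have hk : (k : ℕ) < targets.length := k.2
  rw [List.getD_eq_getElem _ _ hk]
  exact List.getElem_mem _

theorem two_lt_length_targets (k : Fin 18) : 2 < (targets.getD k []).length := by
  revert k; decide

theorem isFatIrreducible_maximalList (i : Fin 20) :
    (maximalList i).IsFatIrreducible (-1 - Real.goldenRatio) := by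
  refine Fin.addCases (m := 2) (n := 18) (fun i => ?_) (fun i => ?_) i
  · fin_cases i
    · refine isFatIrreducible_pair isPair_maximalList_zero.ne isPair_maximalList_zero.slim
        isPair_maximalList_zero.ncard_left isPair_maximalList_zero.ncard_right (Or.inl ?_)
      exact (entry_ofLists (n := 2) (E := [(0, 1)]) (F := ![[0], [1], [1]]) (hF := by decide)
        (i := 0) (j := 1)).trans (by simp; decide)
    · refine isFatIrreducible_pair isPair_maximalList_one.ne isPair_maximalList_one.slim
        isPair_maximalList_one.ncard_left isPair_maximalList_one.ncard_right (Or.inr ?_)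
      exact (entry_ofLists (n := 2) (E := []) (F := ![[0, 1], [1]]) (hF := by decide)
        (i := 0) (j := 1)).trans (by simp; decide)
  · exact (hasCode_maximalList i).isFatIrreducible (targets_getD_mem i)

/-- The two graphs with two slim vertices differ in adjacency. They do not embed into the others,
which lack vertices with two fat neighbours, nor conversely by the number of slim vertices. The
others are compared by their codes. -/
theorem eq_of_isInducedIn_maximalList {i j : Fin 20}
    (h : (maximalList i).toHoffman.IsInducedIn (maximalList j).toHoffman) : i = j := by
  have hpair : ∀ k : Fin 2, ∃ x y, IsPair (maximalList (Fin.castAdd 18 k)) x y := by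
    intro k
    fin_cases k
    · exact ⟨_, _, isPair_maximalList_zero⟩
    · exact ⟨_, _, isPair_maximalList_one⟩
  revert h
  refine Fin.addCases (m := 2) (n := 18) (fun i => ?_) (fun i => ?_) i <;>
    refine Fin.addCases (m := 2) (n := 18) (fun j => ?_) (fun j => ?_) j <;> intro h
  · fin_cases i <;> fin_cases j
    · rfl
    · exact absurd ((isPair_maximalList_zero.adj_iff isPair_maximalList_one h).1
        adj_maximalList_zero) not_adj_maximalList_one
    · exact absurd ((isPair_maximalList_one.adj_iff isPair_maximalList_zero h).2
        adj_maximalList_zero) not_adj_maximalList_one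
    · rfl
  · obtain ⟨x, y, hxy⟩ := hpair i
    exact absurd h (hxy.not_isInducedIn_of_hasCode (hasCode_maximalList j))
  · obtain ⟨x, y, hxy⟩ := hpair j
    exact absurd h ((hasCode_maximalList i).not_isInducedIn_of_isPair hxy (two_lt_length_targets i))
  · obtain ⟨e⟩ := h
    have h1 := (hasCode_maximalList i).embeds (hasCode_maximalList j) e
    have h2 := List.all_eq_true.1 (List.all_eq_true.1 targets_not_embed i (by simp)) j (by simp)
    rw [h1] at h2
    have : (i : ℕ) = j := by simpa using h2
    rw [Fin.ext this]

theorem isoClass_eq_iff : isoClass G = isoClass K ↔ Nonempty (Iso G.toHoffman K.toHoffman) :=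
  Quotient.eq

theorem isoClass_eq_of_isInducedIn (h : G.toHoffman.IsInducedIn K.toHoffman)
    (h' : K.toHoffman.IsInducedIn G.toHoffman) : isoClass G = isoClass K := by
  obtain ⟨e⟩ := h
  obtain ⟨f⟩ := h'
  have hcard : Fintype.card G.V = Fintype.card K.V :=
    le_antisymm (Fintype.card_le_of_injective _ e.toEmbedding.injective)
      (Fintype.card_le_of_injective _ f.toEmbedding.injective)
  have hb : Function.Bijective e.toEmbedding :=
    (Fintype.bijective_iff_injective_and_card _).2 ⟨e.toEmbedding.injective, hcard⟩
  exact isoClass_eq_iff.2 ⟨⟨⟨Equiv.ofBijective _ hb, e.toEmbedding.map_adj_iff⟩, e.map_fat⟩⟩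

theorem isMaximalFatIrreducible_maximalList (i : Fin 20) :
    (maximalList i).IsMaximalFatIrreducible (-1 - Real.goldenRatio) := by
  refine ⟨isFatIrreducible_maximalList i, fun K hK h => ?_⟩
  obtain ⟨j, hj⟩ := hK.exists_isInducedIn
  -- Any fat irreducible graph above a listed one lies below a listed one, which must be the same;
  -- mutual embeddings of finite graphs give an isomorphism.
  obtain rfl := eq_of_isInducedIn_maximalList (h.trans hj)
  exact isoClass_eq_of_isInducedIn h hj

theorem maximalClasses_eq : maximalClasses (-1 - Real.goldenRatio) =
    Set.range fun i => isoClass (maximalList i) := by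
  ext c
  constructor
  · rintro ⟨G, ⟨hG, hmax⟩, rfl⟩
    obtain ⟨i, hi⟩ := hG.exists_isInducedIn
    exact ⟨i, (hmax _ (isFatIrreducible_maximalList i) hi).symm⟩
  · rintro ⟨i, rfl⟩
    exact ⟨_, isMaximalFatIrreducible_maximalList i, rfl⟩

theorem injective_isoClass_maximalList :
    Function.Injective fun i => isoClass (maximalList i) := by
  intro i j h
  obtain ⟨e⟩ := isoClass_eq_iff.1 h
  exact eq_of_isInducedIn_maximalList e.isInducedIn

end FinHoffmanGraph

theorem mainTheorem3 :
    FinHoffmanGraph.maximalClasses (-1 - Real.goldenRatio)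
        = Set.range (fun i => FinHoffmanGraph.isoClass (maximalList i)) ∧
      Function.Injective (fun i => FinHoffmanGraph.isoClass (maximalList i)) ∧
      ∀ {V : Type u} [Fintype V] (H : HoffmanGraph V),
        H.IsFat → -1 - Real.goldenRatio ≤ H.lambdaMin →
          H.IsLineGraph (FinHoffmanGraph.maximalClasses (-1 - Real.goldenRatio)) := by
  refine ⟨FinHoffmanGraph.maximalClasses_eq, FinHoffmanGraph.injective_isoClass_maximalList,
    fun H hf hl => ?_⟩
  rw [FinHoffmanGraph.maximalClasses_eq]
  exact HoffmanGraph.isLineGraph_of_le_lambdaMin hf hl
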